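/- Let $d\ge 2$, let $D\subset\mathbb R^d$ be a bounded open set (for instance a bounded Lipschitz domain), and let $\mathbf s=(\mathbf s_1,\dots,\mathbf s_N)\in\mathbb R^{dN}$ be seeds and $\boldsymbol\psi=(\psi_1,\dots,\psi_N)\in\mathbb R^N$ be weights. For $i=1,\dots,N$ put $$V_i(\mathbf s,\boldsymbol\psi)=\{x\in\overline D:\ |x-\mathbf s_i|^2-\psi_i\le |x-\mathbf s_j|^2-\psi_j\ \ \forall j\ne i\}\cap\overline{B(\mathbf s_i,\psi_i^{1/2})},$$ and let $V_0(\mathbf s,\boldsymbol\psi)=\{x\in\overline D:\ 0\le|x-\mathbf s_i|^2-\psi_i\ \ \forall i=1,\dots,N\}$ be the void cell. Two different cells $V_i,V_j$ with $i,j\in\{1,\dots,N\}$ are called neighbours if $V_i\cap V_j$ has positive $(d-1)$-dimensional Hausdorff measure (positive length if $d=2$). A vertex of the diagram $\mathbf V(\mathbf s,\boldsymbol\psi)=(V_1,\dots,V_N)$ is a point that belongs to at least three of the cells $V_0,\dots,V_N$, or to $\partial D$ and at least two of these cells (under the assumptions below, when $d=2$, these are the endpoints of the edges $V_i\cap V_j$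 and of the circular arcs $V_i\cap V_0$). At a point $\mathbf q$ near which $\partial D$ is smooth ($C^\infty$), $\mathbf n(\mathbf q)$ is the outward unit normal vector. Assume that the seeds are pairwise distinct and that: * (G1) all the cells $V_0,V_1,\dots,V_N$ have positive Lebesgue measure; * (G2) no three distinct seeds are aligned; * (G3) if a vertex $\mathbf q$ lies in $V_i\cap V_j\cap V_0$ with $i\ne j$ in $\{1,\dots,N\}$, then $\mathbf q,\mathbf s_i,\mathbf s_j$ are not aligned; * (G4) each vertex lies in at most three of the cells $V_0,\dots,V_N$; * (G5) $\partial D$ is smooth near each vertex lying on $\partial D$, and such a vertex lies in at most two of the cells $V_0,\dots,V_N$; * (G6) if a vertex $\mathbf q$ lies in $\partial D\cap V_i\cap V_j$ with $i\ne j$ in $\{1,\dots,N\}$, then the line (hyperplane if $d\ge3$) carrying $V_i\cap V_j$ is not orthogonal to $\mathbf n(\mathbf q)$, i.e. $\mathbf s_j-\mathbf s_i$ is not parallel to $\mathbf n(\mathbf q)$; * (G7) if a vertex $\mathbf q$ lies in $\partial D\cap V_i\cap V_0$ with $i\in\{1,\dots,N\}$, then the tangent line (hyperplane) at $\mathbf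 q$ to the sphere of center $\mathbf s_i$ is not orthogonal to $\mathbf n(\mathbf q)$, i.e. $\mathbf q-\mathbf s_i$ is not parallel to $\mathbf n(\mathbf q)$. **(A)** For all sufficiently small $\widehat{\mathbf s}\in\mathbb R^{dN}$ and $\widehat{\boldsymbol\psi}\in\mathbb R^N$, the diagrams $\mathbf V(\mathbf s+\widehat{\mathbf s},\boldsymbol\psi+\widehat{\boldsymbol\psi})$ and $\mathbf V(\mathbf s,\boldsymbol\psi)$ have the same neighbour relations: $V_i,V_j$ are neighbours in one if and only if they are in the other. Moreover, there is a map $\mathbf m:\mathbb R^{dN}\times\mathbb R^N\to W^{1,\infty}(\mathbb R^d,\mathbb R^d)$, differentiable in a neighbourhood of $(\mathbf 0,\mathbf 0)$, such that for all sufficiently small $(\widehat{\mathbf s},\widehat{\boldsymbol\psi})$ the continuous representative of $\mathbf m(\widehat{\mathbf s},\widehat{\boldsymbol\psi})$ satisfies $$\mathbf m(\widehat{\mathbf s},\widehat{\boldsymbol\psi})\big(V_i(\mathbf s,\boldsymbol\psi)\big)=V_i(\mathbf s+\widehat{\mathbf s},\boldsymbol\psi+\widehat{\boldsymbol\psi}),\qquad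 i=1,\dots,N,$$ and the set of vertices of $\mathbf V(\mathbf s+\widehat{\mathbf s},\boldsymbol\psi+\widehat{\boldsymbol\psi})$ is exactly the image under $\mathbf m(\widehat{\mathbf s},\widehat{\boldsymbol\psi})$ of the set of vertices of $\mathbf V(\mathbf s,\boldsymbol\psi)$. **(B)** Let $d=2$. The set of vertices is finite. For each vertex $\mathbf q_*$ of $\mathbf V(\mathbf s,\boldsymbol\psi)$ there is a function $\mathbf q$ of the parameters, with values in $\mathbb R^2$, that is $C^\infty$ in a neighbourhood of $(\mathbf s,\boldsymbol\psi)$, takes the value $\mathbf q_*$ at $(\mathbf s,\boldsymbol\psi)$, and is such that at all parameters close to $(\mathbf s,\boldsymbol\psi)$ its value is a vertex of the corresponding diagram, lies in the same cells as $\mathbf q_*$, lies on $\partial D$ if and only if $\mathbf q_*$ does, and is the only vertex close to $\mathbf q_*$. For parameters close to $(\mathbf s,\boldsymbol\psi)$ (still denoted by $\mathbf s,\boldsymbol\psi$), the derivatives of $\mathbf q$ with respect to $\mathbf s_l$ and $\psi_l$ vanish when $\mathbf q_*\notin V_l$, and the following linear systems hold, whose $2\times2$ matrices are invertible; here $\begin{pmatrix}u\\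 v\end{pmatrix}$ is the matrix with rows $u,v$, and $i,j,k\in\{1,\dots,N\}$ are any distinct indices with the stated property. * If $\mathbf q_*\in V_i\cap V_j\cap V_k$: $$\begin{pmatrix}\mathbf s_j-\mathbf s_i\\ \mathbf s_k-\mathbf s_i\end{pmatrix}[\nabla_{\mathbf s_i}\mathbf q]=\begin{pmatrix}\mathbf q-\mathbf s_i\\ \mathbf q-\mathbf s_i\end{pmatrix},\qquad \begin{pmatrix}\mathbf s_j-\mathbf s_i\\ \mathbf s_k-\mathbf s_i\end{pmatrix}\frac{\partial\mathbf q}{\partial\psi_i}=\begin{pmatrix}\frac12\\ \frac12\end{pmatrix}.$$ * If $\mathbf q_*\in V_i\cap V_j\cap V_0$: $$\begin{pmatrix}\mathbf s_j-\mathbf s_i\\ \mathbf q-\mathbf s_i\end{pmatrix}[\nabla_{\mathbf s_i}\mathbf q]=\begin{pmatrix}\mathbf q-\mathbf s_i\\ \mathbf q-\mathbf s_i\end{pmatrix},\qquad \begin{pmatrix}\mathbf s_j-\mathbf s_i\\ \mathbf q-\mathbf s_i\end{pmatrix}\frac{\partial\mathbf q}{\partial\psi_i}=\begin{pmatrix}\frac12\\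 \frac12\end{pmatrix}.$$ * If $\mathbf q_*\in V_i\cap V_j\cap\partial D$: $$\begin{pmatrix}\mathbf s_j-\mathbf s_i\\ \mathbf n(\mathbf q)\end{pmatrix}[\nabla_{\mathbf s_i}\mathbf q]=\begin{pmatrix}\mathbf q-\mathbf s_i\\ \mathbf 0\end{pmatrix},\qquad \begin{pmatrix}\mathbf s_j-\mathbf s_i\\ \mathbf n(\mathbf q)\end{pmatrix}\frac{\partial\mathbf q}{\partial\psi_i}=\begin{pmatrix}\frac12\\ 0\end{pmatrix}.$$ * If $\mathbf q_*\in V_i\cap V_0\cap\partial D$: $$\begin{pmatrix}\mathbf q-\mathbf s_i\\ \mathbf n(\mathbf q)\end{pmatrix}[\nabla_{\mathbf s_i}\mathbf q]=\begin{pmatrix}\mathbf q-\mathbf s_i\\ \mathbf 0\end{pmatrix},\qquad \begin{pmatrix}\mathbf q-\mathbf s_i\\ \mathbf n(\mathbf q)\end{pmatrix}\frac{\partial\mathbf q}{\partial\psi_i}=\begin{pmatrix}\frac12\\ 0\end{pmatrix}.$$ Finally, consider a circular arc of center $\mathbf s_i$ and angle $\alpha_*\in(0,2\pi)$, run counterclockwise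 from a vertex $\mathbf q_{0*}$ to a vertex $\mathbf q_{1*}$, contained in $V_i\cap V_0$ and containing no vertex in its interior. Then there are functions $\mathbf q_0,\mathbf q_1,\alpha$ of the parameters, $C^\infty$ near $(\mathbf s,\boldsymbol\psi)$, with values $\mathbf q_{0*},\mathbf q_{1*},\alpha_*$ at $(\mathbf s,\boldsymbol\psi)$, such that at all nearby parameters the arc of center $\mathbf s_i$ and angle $\alpha$ from $\mathbf q_0$ to $\mathbf q_1$ has the same properties in the corresponding diagram, and, with $u_r=(\mathbf q_r-\mathbf s_i)/|\mathbf q_r-\mathbf s_i|$ for $r=0,1$, $$\cos\alpha=\langle u_0,u_1\rangle,\quad \sin\alpha=\det(u_0,u_1),\quad \alpha=\pi-2\arctan\frac{1+\cos\alpha}{\sin\alpha}$$ (the last fraction being read as $0$ if $\alpha=\pi$). Moreover, for all integers $0\le r\le n$ with $n\ge1$, the subdivision point $$\mathbf s_i+\cos\big(\tfrac rn\alpha\big)(\mathbf q_0-\mathbf s_i)+\sin\big(\tfrac rn\alpha\big)(\mathbf q_0-\mathbf s_i)^\perp,\qquad (u_1,u_2)^\perp:=(-u_2,u_1),$$ is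 a $C^\infty$ function of the parameters near $(\mathbf s,\boldsymbol\psi)$. -/

import Mathlib

open MeasureTheory Filter Topology Set
open scoped ENNReal ContDiff RealInnerProductSpace Matrix

noncomputable section

namespace ModLaguerre

/-- Points of `ℝ^d`, with the Euclidean norm. -/
abbrev Pt (d : ℕ) := EuclideanSpace ℝ (Fin d)

/-- Pairs `(s, ψ)` of `N` seed points in `ℝ^d` and `N` real weights. -/
abbrev Params (d N : ℕ) := (Fin N → Pt d) × (Fin N → ℝ)

section Diagram

variable {d N : ℕ}

/-- The (classical) Laguerre cell `Lag_i(s, ψ)` inside `closure D`. -/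
def lagCell (D : Set (Pt d)) (s : Fin N → Pt d) (ψ : Fin N → ℝ) (i : Fin N) : Set (Pt d) :=
  {x | x ∈ closure D ∧ ∀ j, j ≠ i → ‖x - s i‖ ^ 2 - ψ i ≤ ‖x - s j‖ ^ 2 - ψ j}

/-- The modified cell `V_i(s, ψ)`: the Laguerre cell clipped by the closed ball of center `s_i` and
radius `√ψ_i`. -/
def modCell (D : Set (Pt d)) (s : Fin N → Pt d) (ψ : Fin N → ℝ) (i : Fin N) : Set (Pt d) :=
  lagCell D s ψ i ∩ Metric.closedBall (s i) (Real.sqrt (ψ i))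

/-- The void cell `V_0(s, ψ)`. -/
def voidCell (D : Set (Pt d)) (s : Fin N → Pt d) (ψ : Fin N → ℝ) : Set (Pt d) :=
  {x | x ∈ closure D ∧ ∀ i, 0 ≤ ‖x - s i‖ ^ 2 - ψ i}

/-- All the cells of the modified Laguerre diagram: `none` is the index of the void cell, `some i`
that of the `i`-th cell. -/
def cell (D : Set (Pt d)) (s : Fin N → Pt d) (ψ : Fin N → ℝ) : Option (Fin N) → Set (Pt d)
  | none => voidCell D s ψ
  | some i => modCell D s ψ i

/-- The cells `V_i` and `V_j` are neighbours: they are different cells whose common face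
`V_i ∩ V_j` has positive `(d-1)`-dimensional measure (positive length if `d = 2`). -/
def Neighbours (D : Set (Pt d)) (s : Fin N → Pt d) (ψ : Fin N → ℝ) (i j : Fin N) : Prop :=
  i ≠ j ∧ 0 < Measure.hausdorffMeasure ((d : ℝ) - 1) (modCell D s ψ i ∩ modCell D s ψ j)

/-- The number of cells, the void included, to which `x` belongs. -/
def cellCount (D : Set (Pt d)) (s : Fin N → Pt d) (ψ : Fin N → ℝ) (x : Pt d) : ℕ :=
  {a : Option (Fin N) | x ∈ cell D s ψ a}.ncard

/-- The vertices of the diagram: the points where three different cells meet, or two different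
cells and the boundary of `D` (the void counts as a cell). -/
def vertices (D : Set (Pt d)) (s : Fin N → Pt d) (ψ : Fin N → ℝ) : Set (Pt d) :=
  {q | 3 ≤ cellCount D s ψ q ∨ (q ∈ frontier D ∧ 2 ≤ cellCount D s ψ q)}

/-- `φ` is a smooth level set function for `D` near `q`, with non-vanishing gradient at `q`. -/
def IsLevelSetAt (D : Set (Pt d)) (q : Pt d) (φ : Pt d → ℝ) : Prop :=
  ContDiff ℝ ∞ φ ∧ gradient φ q ≠ 0 ∧
    ∀ᶠ x in 𝓝 q, (x ∈ D ↔ φ x < 0) ∧ (x ∈ frontier D ↔ φ x = 0)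

/-- The boundary of `D` is smooth near its point `q`. -/
def SmoothBoundaryAt (D : Set (Pt d)) (q : Pt d) : Prop :=
  q ∈ frontier D ∧ ∃ φ, IsLevelSetAt D q φ

/-- `n` is the unit normal vector to the boundary of `D` at `q`, pointing outward `D`. -/
def IsUnitNormalAt (D : Set (Pt d)) (q n : Pt d) : Prop :=
  q ∈ frontier D ∧ ∃ φ, IsLevelSetAt D q φ ∧ n = ‖gradient φ q‖⁻¹ • gradient φ q

/-- The hyperplanes orthogonal to `u` (lines if `d = 2`) are not orthogonal to `n`: they have a
direction `t` which is not orthogonal to `n`. -/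
def HyperplaneNotOrthogonal (u n : Pt d) : Prop :=
  ∃ t : Pt d, ⟪t, u⟫ = 0 ∧ ⟪t, n⟫ ≠ 0

/-- The genericity assumptions on seeds and weights. -/
structure Generic (D : Set (Pt d)) (s : Fin N → Pt d) (ψ : Fin N → ℝ) : Prop where
  /-- All the cells, the void included, have positive Lebesgue measure. -/
  measure_pos : ∀ a, 0 < volume (cell D s ψ a)
  /-- The seed points are pairwise distinct. -/
  seeds_injective : Function.Injective s
  /-- No three seed points are aligned. -/
  seeds_not_aligned : ∀ i j k, i ≠ j → i ≠ k → j ≠ k → ¬ Collinear ℝ {s i, s j, s k}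
  /-- At a vertex between two cells and the void, the vertex and the two seeds are not aligned. -/
  void_not_aligned : ∀ i j, i ≠ j → ∀ q ∈ vertices D s ψ,
    q ∈ modCell D s ψ i → q ∈ modCell D s ψ j → q ∈ voidCell D s ψ → ¬ Collinear ℝ {q, s i, s j}
  /-- At most three cells meet at a vertex. -/
  at_most_three : ∀ q ∈ vertices D s ψ, cellCount D s ψ q ≤ 3
  /-- The boundary of `D` is smooth at each vertex on it. -/
  boundary_smooth : ∀ q ∈ vertices D s ψ, q ∈ frontier D → SmoothBoundaryAt D q
  /-- At most two cells meet at a vertex on the boundary of `D`. -/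
  boundary_at_most_two : ∀ q ∈ vertices D s ψ, q ∈ frontier D → cellCount D s ψ q ≤ 2
  /-- At a vertex between two cells and the boundary of `D`, the line carrying the common edge of
  the two cells (which is orthogonal to `s_j - s_i`) is not orthogonal to the normal vector. -/
  edge_transversal : ∀ i j, i ≠ j → ∀ q ∈ vertices D s ψ,
    q ∈ frontier D → q ∈ modCell D s ψ i → q ∈ modCell D s ψ j →
      ∀ n, IsUnitNormalAt D q n → HyperplaneNotOrthogonal (s j - s i) n
  /-- At a vertex between a cell, the void and the boundary of `D`, the line tangent to the circle
  of center `s_i` (which is orthogonal to `q - s_i`) is not orthogonal to the normal vector. -/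
  circle_transversal : ∀ i, ∀ q ∈ vertices D s ψ,
    q ∈ frontier D → q ∈ modCell D s ψ i → q ∈ voidCell D s ψ →
      ∀ n, IsUnitNormalAt D q n → HyperplaneNotOrthogonal (q - s i) n

end Diagram

section Sobolev

/-- `v` is the weak derivative of the vector field `u` on `ℝ^d`. -/
def IsWeakFDeriv {d : ℕ} (u : Pt d → Pt d) (v : Pt d → Pt d →L[ℝ] Pt d) : Prop :=
  ∀ η : Pt d → ℝ, ContDiff ℝ ∞ η → HasCompactSupport η → ∀ w : Pt d,
    ∫ x, (fderiv ℝ η x w) • u x = - ∫ x, η x • (v x w)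

theorem integrable_smul_of_memLp_top {d : ℕ} {F : Type*} [NormedAddCommGroup F] [NormedSpace ℝ F]
    {η : Pt d → ℝ} (hc : Continuous η) (hs : HasCompactSupport η) {u : Pt d → F}
    (hu : MemLp u ∞ volume) : Integrable (fun x => η x • u x) volume :=
  (hc.integrable_of_hasCompactSupport hs).smul_of_top_left hu

theorem integrable_test_left {d : ℕ} {η : Pt d → ℝ} (hη : ContDiff ℝ ∞ η)
    (hs : HasCompactSupport η) (w : Pt d) (u : Lp (Pt d) ∞ (volume : Measure (Pt d))) :
    Integrable (fun x => (fderiv ℝ η x w) • u x) volume :=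
  integrable_smul_of_memLp_top ((hη.continuous_fderiv (by simp)).clm_apply continuous_const)
    (hs.fderiv_apply ℝ w) (Lp.memLp u)

theorem integrable_test_right {d : ℕ} {η : Pt d → ℝ} (hη : ContDiff ℝ ∞ η)
    (hs : HasCompactSupport η) (w : Pt d) (v : Lp (Pt d →L[ℝ] Pt d) ∞ (volume : Measure (Pt d))) :
    Integrable (fun x => η x • (v x w)) volume := by
  have h := integrable_smul_of_memLp_top hη.continuous hs (Lp.memLp v)
  have h2 := ((ContinuousLinearMap.apply ℝ (Pt d)) w).integrable_comp h
  simpa using h2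

/-- The Sobolev space `W^{1,∞}(ℝ^d, ℝ^d)`: the pairs `(u, ∇u)` formed by an essentially bounded
vector field and its essentially bounded weak derivative. It carries the norm
`max (‖u‖_{L^∞}) (‖∇u‖_{L^∞})`. -/
def W1inf (d : ℕ) : Submodule ℝ (Lp (Pt d) ∞ (volume : Measure (Pt d)) ×
    Lp (Pt d →L[ℝ] Pt d) ∞ (volume : Measure (Pt d))) where
  carrier := {p | IsWeakFDeriv p.1 p.2}
  zero_mem' := by
    intro η _ _ w
    have h1 : ∀ᵐ x ∂(volume : Measure (Pt d)), (fderiv ℝ η x w) •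
        (0 : Lp (Pt d) ∞ (volume : Measure (Pt d))) x = 0 := by
      filter_upwards [Lp.coeFn_zero (Pt d) ∞ (volume : Measure (Pt d))] with x hx
      rw [hx]; simp
    have h2 : ∀ᵐ x ∂(volume : Measure (Pt d)), η x •
        ((0 : Lp (Pt d →L[ℝ] Pt d) ∞ (volume : Measure (Pt d))) x w) = 0 := by
      filter_upwards [Lp.coeFn_zero (Pt d →L[ℝ] Pt d) ∞ (volume : Measure (Pt d))] with x hx
      rw [hx]; simp
    simp only [Prod.fst_zero, Prod.snd_zero]
    rw [integral_congr_ae h1, integral_congr_ae h2]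
    simp
  add_mem' := by
    intro p q hp hq η hη hs w
    have h1 : ∀ᵐ x ∂(volume : Measure (Pt d)), (fderiv ℝ η x w) • (p.1 + q.1) x =
        (fderiv ℝ η x w) • p.1 x + (fderiv ℝ η x w) • q.1 x := by
      filter_upwards [Lp.coeFn_add p.1 q.1] with x hx
      rw [hx]; simp
    have h2 : ∀ᵐ x ∂(volume : Measure (Pt d)), η x • ((p.2 + q.2) x w) =
        η x • (p.2 x w) + η x • (q.2 x w) := by
      filter_upwards [Lp.coeFn_add p.2 q.2] with x hx
      rw [hx]; simp
    simp only [Prod.fst_add, Prod.snd_add]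
    rw [integral_congr_ae h1, integral_congr_ae h2,
      integral_add (integrable_test_left hη hs w p.1) (integrable_test_left hη hs w q.1),
      integral_add (integrable_test_right hη hs w p.2) (integrable_test_right hη hs w q.2),
      hp η hη hs w, hq η hη hs w, neg_add]
  smul_mem' := by
    intro c p hp η hη hs w
    have h1 : ∀ᵐ x ∂(volume : Measure (Pt d)), (fderiv ℝ η x w) • (c • p.1) x =
        c • ((fderiv ℝ η x w) • p.1 x) := by
      filter_upwards [Lp.coeFn_smul c p.1] with x hx
      rw [hx, Pi.smul_apply, smul_comm]
    have h2 : ∀ᵐ x ∂(volume : Measure (Pt d)), η x • ((c • p.2) x w) =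
        c • (η x • (p.2 x w)) := by
      filter_upwards [Lp.coeFn_smul c p.2] with x hx
      rw [hx, Pi.smul_apply, _root_.smul_apply, smul_comm]
    simp only [Prod.smul_fst, Prod.smul_snd]
    rw [integral_congr_ae h1, integral_congr_ae h2, integral_smul, integral_smul, hp η hη hs w,
      smul_neg]

/-- `g` is the continuous representative of the element `u` of `W^{1,∞}(ℝ^d, ℝ^d)`. -/
def IsContinuousRep {d : ℕ} (u : W1inf d) (g : Pt d → Pt d) : Prop :=
  Continuous g ∧ g =ᵐ[volume] (u.1.1 : Pt d → Pt d)

end Sobolev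

section Plane

variable {N : ℕ}

/-- The `2 × 2` matrix with rows `u` and `v`. -/
def rows (u v : Pt 2) : Matrix (Fin 2) (Fin 2) ℝ :=
  !![u 0, u 1; v 0, v 1]

/-- The `2 × 2` matrix `[∇_{s_i} Q]` at the parameters `p`. -/
def seedJacobian (Q : Params 2 N → Pt 2) (p : Params 2 N) (i : Fin N) :
    Matrix (Fin 2) (Fin 2) ℝ :=
  Matrix.of fun a b => (fderiv ℝ Q p (Pi.single i (EuclideanSpace.single b 1), 0)) a

/-- The vector `∂Q/∂ψ_i` at the parameters `p`. -/
def weightDeriv (Q : Params 2 N → Pt 2) (p : Params 2 N) (i : Fin N) : Fin 2 → ℝ :=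
  fun a => (fderiv ℝ Q p (0, Pi.single i 1)) a

/-- The `90°` counterclockwise rotate of `u`. -/
def perp (u : Pt 2) : Pt 2 := !₂[-(u 1), u 0]

/-- The image of `q` by the counterclockwise rotation of center `c` and angle `θ`. -/
def rotateAbout (c q : Pt 2) (θ : ℝ) : Pt 2 :=
  c + (Real.cos θ • (q - c) + Real.sin θ • perp (q - c))

/-- The circular arc of center `s_i` and angle `α`, run counterclockwise from the vertex `q₀` to
the vertex `q₁`, is a piece of the boundary of `V_i`: it lies between `V_i` and the void, and it
contains no vertex but its endpoints. -/
def IsArc (D : Set (Pt 2)) (p : Params 2 N) (i : Fin N) (q₀ q₁ : Pt 2) (α : ℝ) : Prop :=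
  0 < α ∧ α < 2 * Real.pi ∧ q₀ ∈ vertices D p.1 p.2 ∧ q₁ ∈ vertices D p.1 p.2 ∧
    rotateAbout (p.1 i) q₀ α = q₁ ∧
    (∀ θ ∈ Icc 0 α, rotateAbout (p.1 i) q₀ θ ∈ modCell D p.1 p.2 i ∩ voidCell D p.1 p.2) ∧
    ∀ θ ∈ Ioo 0 α, rotateAbout (p.1 i) q₀ θ ∉ vertices D p.1 p.2

end Plane

end ModLaguerre

end

open ModLaguerre

noncomputable section

namespace ModLaguerre

/-! ### Minimization diagrams, active sets and Gram determinants -/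

section

variable {d N : ℕ}

/-! Adjoin the zero function, for the void, to the power functions `‖x - s i‖ ^ 2 - ψ i`. The cells
are then the minimization diagram of one finite family inside `closure D` (`mem_cell_iff`), and
cells, vertices and neighbours are governed by the set `active p 0 x` of minimizers at `x` and by
membership in `D` and `frontier D`. It suffices to move each `x` so that these data are preserved
when the parameters change. Genericity enters only through `IsRegularAt`: wherever two or more
equations meet, those of the equal powers and of a level set function `φ` of `D`, their gradients
are independent.

Independence gives, near each point, a smooth family of linear maps `v x` such that the displacement
`v x c` has prescribed first order effects `c` on `φ` and, up to a common constant, on the active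
powers. These conditions are affine in `v x`, so a partition of unity makes the field global
(`exists_adaptedMaps`). The displacement is `v x c`, where `c` is a fixed point of the Taylor
`remainder` of the powers and of `φ`. For such a `c` the error terms cancel exactly: the powers
near-minimal at `x` all change by the same amount, and `φ` does not change. Since the remainder has
zero derivative in `c` at the origin, the implicit function theorem solves the equation smoothly
(`exists_fixedPoint`). A cutoff `χ` of the perturbation switches the motion off near frontier points
with a single minimizer, where no smoothness of the boundary is assumed. The result is
`Generic.exists_isDeformation`.

Part (A): compactness makes the displacement 1/2-Lipschitz for small perturbations, so the motion is
a bi-Lipschitz bijection and preserves the positivity of Hausdorff measures. A jointly smooth family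
with a common compact support is differentiable in the `C¹` norm, hence in `W1inf`
(`exists_differentiable_family`).

Part (B): the vertex functions are the trajectories `follow u p₀ q` of the same motion.
Differentiating the equality of powers and `φ (Q p) = 0` yields the rows of the linear systems, and
the Gram determinants make the matrices invertible. An arc is carried into a circle of the new
center; the intermediate value theorem applied to the angle of its image shows that the whole new
arc is covered (`IsDeformation.eventually_isArc`). -/

/-- The functions whose minimization diagram is the modified Laguerre diagram: the power distances
to the seeds, and the zero function for the void. -/
def power (p : Params d N) : Option (Fin N) → Pt d → ℝ
  | none, _ => 0
  | some i, x => ‖x - p.1 i‖ ^ 2 - p.2 i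

/-- The gradient of `power p a`. -/
def powerGrad (p : Params d N) : Option (Fin N) → Pt d → Pt d
  | none, _ => 0
  | some i, x => (2 : ℝ) • (x - p.1 i)

/-- The indices that minimize `power p · x` up to an error `ε`. -/
def active (p : Params d N) (ε : ℝ) (x : Pt d) : Set (Option (Fin N)) :=
  {a | ∀ b, power p a x ≤ power p b x + ε}

/-- For a nonnegative weight, the clipping ball is the set where the power is at most zero, that is,
where the seed beats the void. With a negative weight the real square root would be zero and the
ball would still contain the seed. -/
theorem mem_cell_iff {D : Set (Pt d)} {p : Params d N} (hp : ∀ i, 0 ≤ p.2 i)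
    {a : Option (Fin N)} {x : Pt d} :
    x ∈ cell D p.1 p.2 a ↔ x ∈ closure D ∧ a ∈ active p 0 x := by
  rcases a with _ | i
  · simp [cell, voidCell, active, power, Option.forall]
  · have h : x ∈ Metric.closedBall (p.1 i) (Real.sqrt (p.2 i)) ↔ ‖x - p.1 i‖ ^ 2 - p.2 i ≤ 0 := by
      rw [mem_closedBall_iff_norm, Real.le_sqrt (norm_nonneg _) (hp i), sub_nonpos]
    simp only [cell, modCell, lagCell, mem_inter_iff, h, mem_ofPred_eq, active, power,
      Option.forall, add_zero, and_assoc]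
    refine and_congr_right fun _ => ?_
    rw [and_comm]
    refine and_congr_right fun _ => forall_congr' fun j => ?_
    by_cases hj : j = i
    · simp [hj]
    · simp [hj]

theorem mem_modCell_iff {D : Set (Pt d)} {p : Params d N} (hp : ∀ i, 0 ≤ p.2 i)
    {i : Fin N} {x : Pt d} :
    x ∈ modCell D p.1 p.2 i ↔ x ∈ closure D ∧ some i ∈ active p 0 x :=
  mem_cell_iff (a := some i) hp

theorem mem_voidCell_iff {D : Set (Pt d)} {p : Params d N} (hp : ∀ i, 0 ≤ p.2 i) {x : Pt d} :
    x ∈ voidCell D p.1 p.2 ↔ x ∈ closure D ∧ none ∈ active p 0 x :=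
  mem_cell_iff (a := none) hp

theorem cellCount_eq {D : Set (Pt d)} {p : Params d N} (hp : ∀ i, 0 ≤ p.2 i) {x : Pt d}
    (hx : x ∈ closure D) : cellCount D p.1 p.2 x = (active p 0 x).ncard := by
  unfold cellCount
  congr 1
  ext a
  simp [mem_cell_iff hp, hx]

theorem cellCount_eq_zero {D : Set (Pt d)} {p : Params d N} (hp : ∀ i, 0 ≤ p.2 i) {x : Pt d}
    (hx : x ∉ closure D) : cellCount D p.1 p.2 x = 0 := by
  unfold cellCount
  simp [mem_cell_iff hp, hx]

theorem mem_vertices_iff {D : Set (Pt d)} {p : Params d N} (hp : ∀ i, 0 ≤ p.2 i) {x : Pt d} :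
    x ∈ vertices D p.1 p.2 ↔ x ∈ closure D ∧ (3 ≤ (active p 0 x).ncard ∨
      (x ∈ frontier D ∧ 2 ≤ (active p 0 x).ncard)) := by
  by_cases hx : x ∈ closure D
  · simp [vertices, cellCount_eq hp hx, hx]
  · simp [vertices, cellCount_eq_zero hp hx, hx]

theorem active_nonempty (p : Params d N) (x : Pt d) : (active p 0 x).Nonempty := by
  obtain ⟨a, ha⟩ := Finite.exists_min (fun a => power p a x)
  exact ⟨a, fun b => by simpa using ha b⟩

theorem contDiff_power {n : WithTop ℕ∞} (a : Option (Fin N)) :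
    ContDiff ℝ n (fun z : Params d N × Pt d => power z.1 a z.2) := by
  rcases a with _ | i
  · exact contDiff_const
  · have h : ContDiff ℝ n (fun z : Params d N × Pt d => z.2 - z.1.1 i) := by fun_prop
    have h2 : ContDiff ℝ n (fun z : Params d N × Pt d => z.1.2 i) := by fun_prop
    exact (h.norm_sq ℝ).sub h2

theorem contDiff_powerGrad {n : WithTop ℕ∞} (a : Option (Fin N)) :
    ContDiff ℝ n (fun z : Params d N × Pt d => powerGrad z.1 a z.2) := by
  rcases a with _ | i
  · exact contDiff_const
  · have h : ContDiff ℝ n (fun z : Params d N × Pt d => z.2 - z.1.1 i) := by fun_prop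
    exact h.const_smul (2 : ℝ)

theorem continuous_power (a : Option (Fin N)) :
    Continuous (fun z : Params d N × Pt d => power z.1 a z.2) :=
  (contDiff_power (n := 0) a).continuous

theorem contDiff_powerGrad_right {n : WithTop ℕ∞} (p : Params d N) (a : Option (Fin N)) :
    ContDiff ℝ n (powerGrad p a) :=
  (contDiff_powerGrad a).comp (contDiff_const.prodMk contDiff_id)

theorem hasFDerivAt_power (p : Params d N) (a : Option (Fin N)) (x : Pt d) :
    HasFDerivAt (power p a) (innerSL ℝ (powerGrad p a x)) x := by
  rcases a with _ | i
  · have : innerSL ℝ (powerGrad p none x) = 0 := by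
      ext v; simp [powerGrad]
    rw [this]
    exact hasFDerivAt_const (0 : ℝ) x
  · have h := (((hasFDerivAt_id x).sub_const (p.1 i)).norm_sq).sub_const (p.2 i)
    refine h.congr_fderiv ?_
    ext v
    simp [powerGrad]

/-- Approximate minimality is an upper semicontinuous condition. -/
theorem eventually_active_subset (ε : ℝ) (p : Params d N) (x : Pt d) :
    ∀ᶠ z : ℝ × Params d N × Pt d in 𝓝 (ε, p, x), active z.2.1 z.1 z.2.2 ⊆ active p ε x := by
  have h : ∀ a, a ∉ active p ε x →
      ∀ᶠ z : ℝ × Params d N × Pt d in 𝓝 (ε, p, x), a ∉ active z.2.1 z.1 z.2.2 := by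
    intro a ha
    simp only [active, mem_ofPred_eq, not_forall, not_le] at ha
    obtain ⟨b, hb⟩ := ha
    have hc : ∀ a : Option (Fin N), Continuous
        (fun z : ℝ × Params d N × Pt d => power z.2.1 a z.2.2) :=
      fun a => (continuous_power a).comp continuous_snd
    have := ((hc b).add continuous_fst).continuousAt.eventually_lt (x₀ := (ε, p, x))
      (hc a).continuousAt hb
    filter_upwards [this] with z hz hza
    exact absurd (hza b) (not_le.2 hz)
  have h2 : ∀ᶠ z : ℝ × Params d N × Pt d in 𝓝 (ε, p, x),
      ∀ a, a ∉ active p ε x → a ∉ active z.2.1 z.1 z.2.2 := by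
    rw [eventually_all]
    intro a
    by_cases ha : a ∈ active p ε x
    · simp [ha]
    · simpa [ha] using h a ha
  filter_upwards [h2] with z hz a ha
  by_contra hn
  exact hz a hn ha

theorem eventually_active_subset_params (p : Params d N) (x : Pt d) :
    ∀ᶠ z : Params d N × Pt d in 𝓝 (p, x), active z.1 0 z.2 ⊆ active p 0 x := by
  have h : Tendsto (fun z : Params d N × Pt d => ((0 : ℝ), z)) (𝓝 (p, x)) (𝓝 (0, p, x)) :=
    (Continuous.prodMk_right (0 : ℝ)).tendsto _
  exact h.eventually (eventually_active_subset 0 p x)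

theorem eventually_active_subset_point (ε : ℝ) (p : Params d N) (x : Pt d) :
    ∀ᶠ z : ℝ × Pt d in 𝓝 (ε, x), active p z.1 z.2 ⊆ active p ε x := by
  have h : Tendsto (fun z : ℝ × Pt d => (z.1, p, z.2)) (𝓝 (ε, x)) (𝓝 (ε, p, x)) :=
    Continuous.tendsto (by fun_prop) _
  exact h.eventually (eventually_active_subset ε p x)

/-- Minimality is stable under a small change of the point, up to an error. -/
theorem eventually_subset_active {ε ε' : ℝ} (h : ε < ε') (p : Params d N) (x : Pt d) :
    ∀ᶠ y in 𝓝 x, active p ε x ⊆ active p ε' y := by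
  have hc : ∀ a : Option (Fin N), Continuous (power p a) := fun a =>
    (continuous_power a).comp (Continuous.prodMk_right p)
  have h2 : ∀ᶠ y in 𝓝 x, ∀ a b, a ∈ active p ε x → power p a y ≤ power p b y + ε' := by
    rw [eventually_all]; intro a
    rw [eventually_all]; intro b
    by_cases ha : a ∈ active p ε x
    · have := (hc a).continuousAt.eventually_lt (x₀ := x) ((hc b).add_const ε').continuousAt
        ((ha b).trans_lt (by linarith))
      filter_upwards [this] with y hy _ using hy.le
    · simp [ha]
  filter_upwards [h2] with y hy a ha b using hy a b ha

section Gram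

variable {E : Type*} [NormedAddCommGroup E] [InnerProductSpace ℝ E]

/-- The Gram determinant of two vectors. -/
def gram (u v : E) : ℝ := ‖u‖ ^ 2 * ‖v‖ ^ 2 - ⟪u, v⟫ ^ 2

theorem gram_comm (u v : E) : gram u v = gram v u := by
  unfold gram; rw [real_inner_comm]; ring

/-- The Gram determinant is `‖u‖ ^ 2` times the squared distance from `v` to the line spanned by
`u`. -/
theorem gram_ne_zero {u v : E} (hu : u ≠ 0) (h : ∀ c : ℝ, v ≠ c • u) : gram u v ≠ 0 := by
  intro h0
  have hn : ‖u‖ ^ 2 ≠ 0 := by positivity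
  apply h (⟪u, v⟫ / ‖u‖ ^ 2)
  rw [← sub_eq_zero, ← norm_eq_zero, ← sq_eq_zero_iff, norm_sub_sq_real, inner_smul_right,
    norm_smul, mul_pow, Real.norm_eq_abs, sq_abs, real_inner_comm u v]
  unfold gram at h0
  field_simp
  linear_combination h0

theorem contDiffOn_inv_gram {g₁ g₂ : E → E} (h₁ : ContDiff ℝ ∞ g₁) (h₂ : ContDiff ℝ ∞ g₂) :
    ContDiffOn ℝ ∞ (fun x => (gram (g₁ x) (g₂ x))⁻¹) {x | gram (g₁ x) (g₂ x) ≠ 0} := by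
  refine ContDiffOn.inv (ContDiff.contDiffOn ?_) fun x hx => hx
  exact ((h₁.norm_sq ℝ).mul (h₂.norm_sq ℝ)).sub ((h₁.inner ℝ h₂).pow 2)

theorem continuous_gram {X : Type*} [TopologicalSpace X] {g₁ g₂ : X → E} (h₁ : Continuous g₁)
    (h₂ : Continuous g₂) : Continuous (fun x => gram (g₁ x) (g₂ x)) := by
  unfold gram; fun_prop

/-- The vector `w` with `⟪u, w⟫ = 1` and `⟪v, w⟫ = 0`, in the plane spanned by `u` and `v`. -/
def dualVec (u v : E) : E := (gram u v)⁻¹ • (‖v‖ ^ 2 • u - ⟪u, v⟫ • v)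

theorem inner_dualVec_left {u v : E} (h : gram u v ≠ 0) : ⟪u, dualVec u v⟫ = 1 := by
  have : ‖v‖ ^ 2 * ‖u‖ ^ 2 - ⟪u, v⟫ * ⟪u, v⟫ = gram u v := by unfold gram; ring
  rw [dualVec, inner_smul_right, inner_sub_right, inner_smul_right, inner_smul_right,
    real_inner_self_eq_norm_sq, this, inv_mul_cancel₀ h]

theorem inner_dualVec_right (u v : E) : ⟪v, dualVec u v⟫ = 0 := by
  rw [dualVec, inner_smul_right, inner_sub_right, inner_smul_right, inner_smul_right,
    real_inner_self_eq_norm_sq, real_inner_comm u v]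
  ring

theorem contDiffOn_dualVec {g₁ g₂ : E → E} (h₁ : ContDiff ℝ ∞ g₁) (h₂ : ContDiff ℝ ∞ g₂) :
    ContDiffOn ℝ ∞ (fun x => dualVec (g₁ x) (g₂ x)) {x | gram (g₁ x) (g₂ x) ≠ 0} :=
  (contDiffOn_inv_gram h₁ h₂).smul
    (((h₂.norm_sq ℝ).smul h₁).sub ((h₁.inner ℝ h₂).smul h₂)).contDiffOn

end Gram

end

/-! ### Patching local level set functions of the domain -/

section

variable {d N : ℕ}

theorem eventually_pos_of_hasDerivAt_pos {k : ℝ → ℝ} {k' : ℝ} (h : HasDerivAt k k' 0)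
    (h0 : k 0 = 0) (hk : 0 < k') : ∀ᶠ t in 𝓝[>] (0 : ℝ), 0 < k t := by
  have h1 := (hasDerivAt_iff_tendsto_slope.1 h).mono_left
    (nhdsWithin_mono 0 (fun t (ht : 0 < t) => ht.ne') : 𝓝[>] (0 : ℝ) ≤ 𝓝[≠] 0)
  filter_upwards [h1.eventually (lt_mem_nhds hk), self_mem_nhdsWithin] with t ht (ht0 : 0 < t)
  rw [slope_def_field, h0, sub_zero, sub_zero] at ht
  exact (div_pos_iff_of_pos_right ht0).1 ht

theorem hasDerivAt_line {f : Pt d → ℝ} {f' : Pt d →L[ℝ] ℝ} {q : Pt d}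
    (h : HasFDerivAt f f' q) (w : Pt d) : HasDerivAt (fun t : ℝ => f (q + t • w)) (f' w) 0 := by
  have h1 : HasDerivAt (fun t : ℝ => q + t • w) w 0 := by
    simpa using ((hasDerivAt_id (0 : ℝ)).smul_const w).const_add q
  have h2 : HasFDerivAt f f' (q + (0 : ℝ) • w) := by simpa using h
  exact h2.comp_hasDerivAt (0 : ℝ) h1

/-- The weighted sum of local level set functions has the sign of any of them. -/
theorem finsum_levelSet_sign {ι : Type*} {D : Set (Pt d)} (hD : IsOpen D) {ρ φ : ι → ℝ} {x : Pt d}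
    (hρ : ∀ i, 0 ≤ ρ i) (hfin : (Function.support ρ).Finite) (hpos : ∃ i, 0 < ρ i)
    (hφ : ∀ i, ρ i ≠ 0 → (x ∈ D ↔ φ i < 0) ∧ (x ∈ frontier D ↔ φ i = 0)) :
    (x ∈ D ↔ ∑ᶠ i, ρ i * φ i < 0) ∧ (x ∈ frontier D ↔ ∑ᶠ i, ρ i * φ i = 0) := by
  have hs : (Function.support fun i => ρ i * φ i).Finite :=
    hfin.subset fun i hi => left_ne_zero_of_mul hi
  obtain ⟨i₀, hi₀⟩ := hpos
  have hdf : x ∈ D → x ∉ frontier D := fun h h' => by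
    rw [hD.frontier_eq] at h'; exact h'.2 h
  by_cases h1 : x ∈ D
  · have hneg : 0 < ∑ᶠ i, -(ρ i * φ i) := by
      refine finsum_pos (fun i => ?_) ⟨i₀, ?_⟩ ?_
      · by_cases hi : ρ i = 0
        · simp [hi]
        · have := ((hφ i hi).1.1 h1).le
          nlinarith [hρ i]
      · have := (hφ i₀ hi₀.ne').1.1 h1
        nlinarith
      · exact hs.subset fun i hi => by simpa using hi
    rw [finsum_neg_distrib] at hneg
    have := hdf h1
    exact ⟨by simp [h1]; linarith, by simp [this]; linarith⟩
  · by_cases h2 : x ∈ frontier D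
    · have : ∑ᶠ i, ρ i * φ i = 0 := by
        refine finsum_eq_zero_of_forall_eq_zero fun i => ?_
        by_cases hi : ρ i = 0
        · simp [hi]
        · simp [(hφ i hi).2.1 h2]
      simp [h1, h2, this]
    · have hp : ∀ i, ρ i ≠ 0 → 0 < φ i := fun i hi => by
        have h3 := (hφ i hi).1.not.1 h1
        have h4 := (hφ i hi).2.not.1 h2
        exact lt_of_le_of_ne (not_lt.1 h3) (Ne.symm h4)
      have hneg : 0 < ∑ᶠ i, ρ i * φ i := by
        refine finsum_pos (fun i => ?_) ⟨i₀, mul_pos hi₀ (hp i₀ hi₀.ne')⟩ hs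
        by_cases hi : ρ i = 0
        · simp [hi]
        · exact mul_nonneg (hρ i) (hp i hi).le
      simp only [h1, h2, false_iff]
      exact ⟨by linarith, by linarith⟩

open scoped Manifold in
/-- Local level set functions can be patched together. -/
theorem exists_levelSet {D Z : Set (Pt d)} (hD : IsOpen D) (hZ : IsClosed Z)
    (h : ∀ q ∈ Z, SmoothBoundaryAt D q) :
    ∃ φ : Pt d → ℝ, ContDiff ℝ ∞ φ ∧ ∀ q ∈ Z, IsLevelSetAt D q φ := by
  choose hfr f hf using h
  let S : Z → Set (Pt d) := fun q =>
    {x | ((x ∈ D ↔ f q.1 q.2 x < 0) ∧ (x ∈ frontier D ↔ f q.1 q.2 x = 0)) ∧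
      fderiv ℝ (f q.1 q.2) x ≠ 0}
  let U : Z → Set (Pt d) := fun q => interior (S q)
  have hfs : ∀ q : Z, ContDiff ℝ ∞ (f q.1 q.2) := fun q => (hf q.1 q.2).1
  have hnhds : ∀ q : Z, U q ∈ 𝓝 q.1 := fun q => by
    refine interior_mem_nhds.2 ((hf q.1 q.2).2.2.and ?_)
    refine (((hfs q).continuous_fderiv (by simp)).continuousAt).eventually_ne fun h0 => ?_
    exact (hf q.1 q.2).2.1 (by simp [gradient, h0])
  obtain ⟨ρ, hρ⟩ := SmoothPartitionOfUnity.exists_isSubordinate 𝓘(ℝ, Pt d) hZ U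
    (fun _ => isOpen_interior) (fun q hq => mem_iUnion.2 ⟨⟨q, hq⟩,
      mem_of_mem_nhds (hnhds ⟨q, hq⟩)⟩)
  let φ : Pt d → ℝ := fun x => ∑ᶠ q : Z, ρ q x * f q.1 q.2 x
  have hφ : ContDiff ℝ ∞ φ := by
    rw [← contMDiff_iff_contDiff]
    exact ρ.contMDiff_finsum_smul fun q x _ => (hfs q).contMDiff.contMDiffAt
  have hρs : ∀ q : Z, ContDiff ℝ ∞ (ρ q) := fun q => (ρ q).contMDiff.contDiff
  have hU : ∀ (q : Z) x, ρ q x ≠ 0 →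
      ((x ∈ D ↔ f q.1 q.2 x < 0) ∧ (x ∈ frontier D ↔ f q.1 q.2 x = 0)) ∧
        fderiv ℝ (f q.1 q.2) x ≠ 0 := fun q x hx => by
    have : x ∈ S q := interior_subset (hρ q (subset_tsupport _ hx))
    exact this
  have hsign : ∀ x, (∃ q : Z, 0 < ρ q x) → (x ∈ D ↔ φ x < 0) ∧ (x ∈ frontier D ↔ φ x = 0) :=
    fun x hx => finsum_levelSet_sign (ρ := fun q => ρ q x) hD (fun q => ρ.nonneg q x)
      (ρ.locallyFinite.point_finite x) hx fun q hq => (hU q x hq).1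
  refine ⟨φ, hφ, fun q hq => ?_⟩
  obtain ⟨i, hi⟩ := ρ.exists_pos_of_mem hq
  have hi' : ∀ᶠ x in 𝓝 q, 0 < ρ i x := (hρs i).continuous.continuousAt.eventually (lt_mem_nhds hi)
  have hqi : f i.1 i.2 q = 0 := (hU i q hi.ne').1.2.1 (hfr q hq)
  have hqφ : φ q = 0 := (hsign q ⟨i, hi⟩).2.1 (hfr q hq)
  refine ⟨hφ, fun h0 => ?_, hi'.mono fun x hx => hsign x ⟨i, hx⟩⟩
  have hdf : HasFDerivAt (f i.1 i.2) (fderiv ℝ (f i.1 i.2) q) q :=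
    ((hfs i).differentiable (by simp) q).hasFDerivAt
  have hdφ : HasFDerivAt φ (0 : Pt d →L[ℝ] ℝ) q := by
    have := (hφ.differentiable (by simp) q).hasGradientAt.hasFDerivAt
    rwa [h0, map_zero] at this
  have hdρ : HasFDerivAt (ρ i) (fderiv ℝ (ρ i) q) q :=
    ((hρs i).differentiable (by simp) q).hasFDerivAt
  -- Go along a direction `w` in which one local function decreases, hence into `D`. If the gradient
  -- of the sum `φ` vanished at `q`, the difference between `φ` and its `i`-th term would be
  -- positive on this ray near `q`; but all terms are nonpositive inside `D`.
  obtain ⟨w, hw⟩ : ∃ w, fderiv ℝ (f i.1 i.2) q w < 0 := by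
    obtain ⟨w, hw⟩ : ∃ w, fderiv ℝ (f i.1 i.2) q w ≠ 0 := by
      by_contra! hc
      exact (hU i q hi.ne').2 (ContinuousLinearMap.ext hc)
    rcases lt_or_gt_of_ne hw with hw | hw
    · exact ⟨w, hw⟩
    · exact ⟨-w, by simpa using hw⟩
  have hk1 := eventually_pos_of_hasDerivAt_pos (hasDerivAt_line hdf w).neg (by simp [hqi])
    (by simpa using hw)
  have hk2 := eventually_pos_of_hasDerivAt_pos (hasDerivAt_line (hdφ.sub (hdρ.mul hdf)) w)
    (by simp [hqi, hqφ]) (by simpa [hqi] using mul_neg_of_pos_of_neg hi hw)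
  have hl : Tendsto (fun t : ℝ => q + t • w) (𝓝[>] 0) (𝓝 q) := by
    have : Continuous (fun t : ℝ => q + t • w) := by fun_prop
    simpa using (this.tendsto 0).mono_left nhdsWithin_le_nhds
  obtain ⟨t, ht1, ht2, ht3⟩ := (hk1.and (hk2.and (hl.eventually hi'))).exists
  -- on this ray, the sum is below each of its terms
  have hx := (hU i _ ht3.ne').1.1
  have hD' : q + t • w ∈ D := hx.2 (by simpa using ht1)
  have hle : φ (q + t • w) ≤ ρ i (q + t • w) * f i.1 i.2 (q + t • w) := by
    have hs : (Function.support fun j : Z => ρ j (q + t • w) * f j.1 j.2 (q + t • w)).Finite :=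
      (ρ.locallyFinite.point_finite (q + t • w)).subset fun j hj => left_ne_zero_of_mul hj
    have := single_le_finsum i (f := fun j : Z => -(ρ j (q + t • w) * f j.1 j.2 (q + t • w)))
      (hs.subset fun j hj => by simpa using hj) (fun j => by
        by_cases hj : ρ j (q + t • w) = 0
        · simp [hj]
        · have := ((hU j _ hj).1.1.1 hD').le
          have := ρ.nonneg j (q + t • w)
          nlinarith)
    rw [finsum_neg_distrib] at this
    exact neg_le_neg_iff.1 this
  simp only [Pi.sub_apply, Pi.mul_apply] at ht2
  linarith

end

/-! ### Genericity implies regularity -/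

section

variable {d N : ℕ} {D : Set (Pt d)}

/-- With a nonpositive weight the clipped cell is contained in a single point, which is a null set.
-/
theorem Generic.weight_pos {s : Fin N → Pt d} {ψ : Fin N → ℝ} (hd : 2 ≤ d) (h : Generic D s ψ)
    (i : Fin N) : 0 < ψ i := by
  by_contra! hi
  have : Nonempty (Fin d) := ⟨⟨0, by omega⟩⟩
  have h1 : cell D s ψ (some i) ⊆ {s i} := fun x hx => by
    have := hx.2
    rwa [Real.sqrt_eq_zero_of_nonpos hi, Metric.closedBall_zero] at this
  have := (h.measure_pos (some i)).trans_le (measure_mono h1)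
  simp at this

theorem gram_smul_left {E : Type*} [NormedAddCommGroup E] [InnerProductSpace ℝ E] (c : ℝ)
    (u v : E) : gram (c • u) v = c ^ 2 * gram u v := by
  unfold gram
  rw [norm_smul, real_inner_smul_left, mul_pow, Real.norm_eq_abs, sq_abs]
  ring

theorem gram_smul_right {E : Type*} [NormedAddCommGroup E] [InnerProductSpace ℝ E] (c : ℝ)
    (u v : E) : gram u (c • v) = c ^ 2 * gram u v := by
  rw [gram_comm, gram_smul_left, gram_comm]

theorem gram_ne_zero_of_not_collinear {a b c : Pt d} (h : ¬ Collinear ℝ {a, b, c}) :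
    gram (c - a) (c - b) ≠ 0 := by
  refine gram_ne_zero (fun h0 => h ?_) fun r hr => h ?_
  · rw [sub_eq_zero.1 h0, Set.pair_comm b, Set.insert_eq_of_mem (by simp)]
    exact collinear_pair ℝ _ _
  · rw [collinear_iff_of_mem (p₀ := c) (by simp)]
    refine ⟨c - a, ?_⟩
    simp only [mem_insert_iff, mem_singleton_iff, vadd_eq_add, forall_eq_or_imp, forall_eq]
    refine ⟨⟨-1, by module⟩, ⟨-r, ?_⟩, ⟨0, by simp⟩⟩
    rw [neg_smul, ← hr]; abel

/-- If `n` were a multiple of `u`, every `t` orthogonal to `u` would be orthogonal to `n`. The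
factor `r` absorbs the normalization of the normal vector. -/
theorem gram_ne_zero_of_hyperplaneNotOrthogonal {u n : Pt d} {r : ℝ} (hu : u ≠ 0)
    (h : HyperplaneNotOrthogonal u (r • n)) : gram u n ≠ 0 := by
  refine gram_ne_zero hu fun c hc => ?_
  obtain ⟨t, ht, hn⟩ := h
  apply hn
  rw [hc, inner_smul_right, inner_smul_right, ht]
  simp

theorem powerGrad_some_sub_some (p : Params d N) (i j : Fin N) (x : Pt d) :
    powerGrad p (some i) x - powerGrad p (some j) x = (2 : ℝ) • (p.1 j - p.1 i) := by
  simp only [powerGrad]; module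

theorem powerGrad_some_sub_none (p : Params d N) (i : Fin N) (x : Pt d) :
    powerGrad p (some i) x - powerGrad p none x = (2 : ℝ) • (x - p.1 i) := by
  simp [powerGrad]

theorem power_eq_of_mem_active {p : Params d N} {x : Pt d} {a b : Option (Fin N)}
    (ha : a ∈ active p 0 x) (hb : b ∈ active p 0 x) : power p a x = power p b x := by
  have h1 := ha b
  have h2 := hb a
  linarith

theorem sub_seed_ne_zero {p : Params d N} {x : Pt d} {i : Fin N} (hi : 0 < p.2 i)
    (ha : some i ∈ active p 0 x) (hb : none ∈ active p 0 x) : x - p.1 i ≠ 0 := by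
  intro h0
  have := power_eq_of_mem_active ha hb
  simp only [power, h0, norm_zero] at this
  linarith

/-- At `x`, the equations of the cells to which `x` belongs, and that of the boundary of `D`
(of level set function `φ`), have independent gradients. -/
def IsRegularAt (D : Set (Pt d)) (p : Params d N) (φ : Pt d → ℝ) (x : Pt d) : Prop :=
  (active p 0 x).Subsingleton ∨
  (x ∈ frontier D ∧ ∃ a b, active p 0 x = {a, b} ∧
    gram (powerGrad p a x - powerGrad p b x) (gradient φ x) ≠ 0) ∨
  (x ∉ frontier D ∧ ∃ a b, active p 0 x = {a, b} ∧ powerGrad p a x - powerGrad p b x ≠ 0) ∨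
  (x ∉ frontier D ∧ ∃ a b c, active p 0 x = {a, b, c} ∧
    gram (powerGrad p a x - powerGrad p c x) (powerGrad p b x - powerGrad p c x) ≠ 0)

section

variable {p : Params d N} {φ : Pt d → ℝ} {x : Pt d}

theorem Generic.powerGrad_ne (hd : 2 ≤ d) (h : Generic D p.1 p.2) {a b : Option (Fin N)}
    (hab : a ≠ b) (ha : a ∈ active p 0 x) (hb : b ∈ active p 0 x) :
    powerGrad p a x - powerGrad p b x ≠ 0 := by
  rcases a with _ | i <;> rcases b with _ | j
  · exact absurd rfl hab
  · rw [← neg_sub, powerGrad_some_sub_none]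
    exact neg_ne_zero.2 (smul_ne_zero two_ne_zero (sub_seed_ne_zero (h.weight_pos hd j) hb ha))
  · rw [powerGrad_some_sub_none]
    exact smul_ne_zero two_ne_zero (sub_seed_ne_zero (h.weight_pos hd i) ha hb)
  · rw [powerGrad_some_sub_some]
    refine smul_ne_zero two_ne_zero (sub_ne_zero.2 fun hs => hab ?_)
    rw [h.seeds_injective hs]

/-- This is where the two transversality assumptions are used: a difference of power gradients is,
up to a nonzero factor, `s j - s i` between two seeds and `x - s i` against the void. -/
theorem Generic.gram_frontier_ne_zero (hd : 2 ≤ d) (h : Generic D p.1 p.2)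
    {a b : Option (Fin N)} (hab : a ≠ b) (ha : a ∈ active p 0 x) (hb : b ∈ active p 0 x)
    (hx : x ∈ frontier D) (hv : x ∈ vertices D p.1 p.2) (hφ : IsLevelSetAt D x φ) :
    gram (powerGrad p a x - powerGrad p b x) (gradient φ x) ≠ 0 := by
  have hp : ∀ i, 0 ≤ p.2 i := fun i => (h.weight_pos hd i).le
  have hn : IsUnitNormalAt D x (‖gradient φ x‖⁻¹ • gradient φ x) := ⟨hx, φ, hφ, rfl⟩
  have hcl := frontier_subset_closure hx
  have hcell : ∀ i, some i ∈ active p 0 x → x ∈ modCell D p.1 p.2 i := fun i hi =>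
    (mem_modCell_iff hp).2 ⟨hcl, hi⟩
  have hvoid : none ∈ active p 0 x → x ∈ voidCell D p.1 p.2 := fun hi =>
    (mem_voidCell_iff hp).2 ⟨hcl, hi⟩
  have key : ∀ i, some i ∈ active p 0 x → none ∈ active p 0 x →
      gram (x - p.1 i) (gradient φ x) ≠ 0 := fun i hi h0 =>
    gram_ne_zero_of_hyperplaneNotOrthogonal (sub_seed_ne_zero (h.weight_pos hd i) hi h0)
      (h.circle_transversal i x hv hx (hcell i hi) (hvoid h0) _ hn)
  rcases a with _ | i <;> rcases b with _ | j
  · exact absurd rfl hab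
  · rw [← neg_sub, powerGrad_some_sub_none, ← neg_one_smul ℝ, gram_smul_left, gram_smul_left]
    have := key j hb ha
    simpa
  · rw [powerGrad_some_sub_none, gram_smul_left]
    have := key i ha hb
    simpa
  · have hij : i ≠ j := fun hij => hab (by rw [hij])
    rw [powerGrad_some_sub_some, gram_smul_left]
    have := gram_ne_zero_of_hyperplaneNotOrthogonal
      (sub_ne_zero.2 fun hs => hij (h.seeds_injective hs).symm)
      (h.edge_transversal i j hij x hv hx (hcell i ha) (hcell j hb) _ hn)
    simpa

/-- Relative to `c`, both gradients are multiples of differences from one point, the third seed or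
`x` itself if `c` is the void; they are independent because the three points involved are not
aligned. -/
theorem Generic.gram_three_ne_zero (hd : 2 ≤ d) (h : Generic D p.1 p.2)
    {i j : Fin N} {c : Option (Fin N)} (hij : i ≠ j) (hic : some i ≠ c) (hjc : some j ≠ c)
    (hv : x ∈ vertices D p.1 p.2) (hi : some i ∈ active p 0 x) (hj : some j ∈ active p 0 x)
    (hc : c ∈ active p 0 x) :
    gram (powerGrad p (some i) x - powerGrad p c x)
      (powerGrad p (some j) x - powerGrad p c x) ≠ 0 := by
  have hp : ∀ i, 0 ≤ p.2 i := fun i => (h.weight_pos hd i).le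
  have hcl := ((mem_vertices_iff hp).1 hv).1
  rcases c with _ | k
  · rw [powerGrad_some_sub_none, powerGrad_some_sub_none, gram_smul_left, gram_smul_right]
    have := h.void_not_aligned i j hij x hv ((mem_modCell_iff hp).2 ⟨hcl, hi⟩)
      ((mem_modCell_iff hp).2 ⟨hcl, hj⟩) ((mem_voidCell_iff hp).2 ⟨hcl, hc⟩)
    rw [show ({x, p.1 i, p.1 j} : Set (Pt d)) = {p.1 i, p.1 j, x} by
      ext; simp only [mem_insert_iff, mem_singleton_iff]; tauto] at this
    simpa using gram_ne_zero_of_not_collinear this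
  · rw [powerGrad_some_sub_some, powerGrad_some_sub_some, gram_smul_left, gram_smul_right]
    have := h.seeds_not_aligned i j k hij (fun hh => hic (by rw [hh])) fun hh => hjc (by rw [hh])
    simpa using gram_ne_zero_of_not_collinear this

theorem Generic.isRegularAt (hd : 2 ≤ d) (h : Generic D p.1 p.2)
    (hφ : ∀ q ∈ vertices D p.1 p.2, q ∈ frontier D → IsLevelSetAt D q φ) (hx : x ∈ closure D) :
    IsRegularAt D p φ x := by
  have hp : ∀ i, 0 ≤ p.2 i := fun i => (h.weight_pos hd i).le
  have hcount := cellCount_eq hp hx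
  rcases Nat.lt_or_ge (active p 0 x).ncard 2 with h1 | h2
  · exact Or.inl (ncard_le_one_iff_subsingleton.1 (by omega))
  rcases Nat.lt_or_ge (active p 0 x).ncard 3 with h3 | h3
  · obtain ⟨a, b, hab, hA⟩ := ncard_eq_two.1 (show (active p 0 x).ncard = 2 by omega)
    have ha : a ∈ active p 0 x := by simp [hA]
    have hb : b ∈ active p 0 x := by simp [hA]
    by_cases hf : x ∈ frontier D
    · have hv : x ∈ vertices D p.1 p.2 := (mem_vertices_iff hp).2 ⟨hx, Or.inr ⟨hf, h2⟩⟩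
      exact Or.inr (Or.inl ⟨hf, a, b, hA, h.gram_frontier_ne_zero hd hab ha hb hf hv (hφ x hv hf)⟩)
    · exact Or.inr (Or.inr (Or.inl ⟨hf, a, b, hA, h.powerGrad_ne hd hab ha hb⟩))
  · have hv : x ∈ vertices D p.1 p.2 := (mem_vertices_iff hp).2 ⟨hx, Or.inl h3⟩
    have hf : x ∉ frontier D := fun hf => by
      have := h.boundary_at_most_two x hv hf
      omega
    have h4 := h.at_most_three x hv
    obtain ⟨a, b, c, hab, hac, hbc, hA⟩ :=
      ncard_eq_three.1 (show (active p 0 x).ncard = 3 by omega)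
    have ha : a ∈ active p 0 x := by simp [hA]
    have hb : b ∈ active p 0 x := by simp [hA]
    have hc : c ∈ active p 0 x := by simp [hA]
    refine Or.inr (Or.inr (Or.inr ⟨hf, ?_⟩))
    -- The three indices are reordered so that the void, if it occurs, is the base index `c`.
    have key : ∀ {i j c}, some i ≠ some j → some i ≠ c → some j ≠ c → some i ∈ active p 0 x →
        some j ∈ active p 0 x → c ∈ active p 0 x → _ := fun {i j c} h1 h2 h3 h4 h5 h6 =>
      h.gram_three_ne_zero (x := x) hd (i := i) (j := j) (c := c) (fun hh => h1 (by rw [hh])) h2 h3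
        hv h4 h5 h6
    rcases a with _ | i
    · rcases b with _ | j
      · exact absurd rfl hab
      · rcases c with _ | k
        · exact absurd rfl hac
        · refine ⟨some j, some k, none, ?_, key hbc hab.symm hac.symm hb hc ha⟩
          rw [hA]; ext; simp only [mem_insert_iff, mem_singleton_iff]; tauto
    · rcases b with _ | j
      · rcases c with _ | k
        · exact absurd rfl hbc
        · refine ⟨some i, some k, none, ?_, key hac hab hbc.symm ha hc hb⟩
          rw [hA]; ext; simp only [mem_insert_iff, mem_singleton_iff]; tauto
      · exact ⟨some i, some j, c, hA, key hab hac hbc ha hb hc⟩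

end

end

/-! ### Smooth fields of adapted linear maps -/

section

variable {d N : ℕ} {D : Set (Pt d)}

/-- Prescribed variations of the functions `power p a` and of a level set function. -/
abbrev Variation (N : ℕ) := (Option (Fin N) → ℝ) × ℝ

/-- Moving `x` in the direction `w c` changes the functions `power p a`, `a ∈ A`, by `c.1 a`, up to
a common constant. -/
def IsAdapted (p : Params d N) (A : Set (Option (Fin N))) (x : Pt d)
    (w : Variation N →L[ℝ] Pt d) : Prop :=
  ∀ a ∈ A, ∀ b ∈ A, ∀ c, ⟪powerGrad p a x, w c⟫ - c.1 a = ⟪powerGrad p b x, w c⟫ - c.1 b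

theorem IsAdapted.mono {p : Params d N} {A B : Set (Option (Fin N))} {x : Pt d}
    {w : Variation N →L[ℝ] Pt d} (h : IsAdapted p A x w) (hBA : B ⊆ A) : IsAdapted p B x w :=
  fun a ha b hb => h a (hBA ha) b (hBA hb)

theorem isAdapted_of_forall_eq {p : Params d N} {A : Set (Option (Fin N))} {x : Pt d}
    {w : Variation N →L[ℝ] Pt d} (b : Option (Fin N))
    (h : ∀ a ∈ A, ∀ c, ⟪powerGrad p a x - powerGrad p b x, w c⟫ = c.1 a - c.1 b) :
    IsAdapted p A x w := by
  intro a ha a' ha' c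
  have h1 := h a ha c
  have h2 := h a' ha' c
  rw [inner_sub_left] at h1 h2
  linarith

theorem contDiff_gradient {φ : Pt d → ℝ} (hφ : ContDiff ℝ ∞ φ) : ContDiff ℝ ∞ (gradient φ) :=
  ((InnerProductSpace.toDual ℝ (Pt d)).symm.contDiff).comp
    (hφ.fderiv_right (m := ∞) (by simp))

/-- The continuous linear form `c ↦ c.1 a - c.1 b`. -/
def variationDiff (a b : Option (Fin N)) : Variation N →L[ℝ] ℝ :=
  (ContinuousLinearMap.proj (R := ℝ) (φ := fun _ : Option (Fin N) => ℝ) a -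
    ContinuousLinearMap.proj b).comp (ContinuousLinearMap.fst ℝ _ _)

@[simp] theorem variationDiff_apply (a b : Option (Fin N)) (c : Variation N) :
    variationDiff a b c = c.1 a - c.1 b := rfl

/-- Near a regular point there is a smooth field of adapted linear maps. -/
theorem IsRegularAt.exists_local_field {p : Params d N} {φ : Pt d → ℝ} {x₀ : Pt d}
    (hφ : ContDiff ℝ ∞ φ) (h : IsRegularAt D p φ x₀) :
    ∃ U ∈ 𝓝 x₀, ∃ v : Pt d → Variation N →L[ℝ] Pt d, ContDiffOn ℝ ∞ v U ∧
      ∀ x ∈ U, IsAdapted p (active p 0 x₀) x (v x) ∧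
        (x₀ ∈ frontier D → ¬ (active p 0 x₀).Subsingleton → ∀ c, ⟪gradient φ x, v x c⟫ = c.2) := by
  have hg : ∀ a b, ContDiff ℝ ∞ (fun x => powerGrad p a x - powerGrad p b x) := fun a b =>
    (contDiff_powerGrad_right p a).sub (contDiff_powerGrad_right p b)
  rcases h with h | ⟨hf, a, b, hA, hgr⟩ | ⟨hf, a, b, hA, hgr⟩ | ⟨hf, a, b, c, hA, hgr⟩
  · refine ⟨univ, univ_mem, fun _ => 0, contDiffOn_const, fun x _ => ⟨?_, fun _ h' => absurd h h'⟩⟩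
    intro a ha b hb c
    rw [h ha hb]
  · have hφ' := contDiff_gradient hφ
    -- The dual basis of the two independent gradients prescribes both pairings at once: `c.1 a -
    -- c.1 b` with the difference of power gradients and `c.2` with the gradient of `φ`.
    refine ⟨{x | gram (powerGrad p a x - powerGrad p b x) (gradient φ x) ≠ 0}, ?_, fun x =>
      (variationDiff a b).smulRight (dualVec (powerGrad p a x - powerGrad p b x) (gradient φ x)) +
      (ContinuousLinearMap.snd ℝ _ _).smulRight
        (dualVec (gradient φ x) (powerGrad p a x - powerGrad p b x)), ?_, fun x hx => ⟨?_, ?_⟩⟩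
    · exact (continuous_gram (hg a b).continuous hφ'.continuous).continuousAt.eventually_ne hgr
    · refine (contDiffOn_const.smulRight (contDiffOn_dualVec (hg a b) hφ')).add
        (contDiffOn_const.smulRight ((contDiffOn_dualVec hφ' (hg a b)).mono fun x hx => ?_))
      rwa [mem_ofPred_eq, gram_comm]
    · rw [hA]
      refine isAdapted_of_forall_eq b fun a' ha' c => ?_
      rcases ha' with rfl | rfl
      · simp [inner_add_right, inner_smul_right, inner_dualVec_left hx, inner_dualVec_right]
      · simp
    · intro _ _ c
      have hx' : gram (gradient φ x) (powerGrad p a x - powerGrad p b x) ≠ 0 := by rwa [gram_comm]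
      simp [-inner_gradient_left, inner_add_right, inner_smul_right, inner_dualVec_left hx',
        inner_dualVec_right]
  · have hgn : ContDiffOn ℝ ∞ (fun x => (‖powerGrad p a x - powerGrad p b x‖ ^ 2)⁻¹)
        {x | powerGrad p a x - powerGrad p b x ≠ 0} :=
      ((hg a b).norm_sq ℝ).contDiffOn.inv fun x hx => by
        have : powerGrad p a x - powerGrad p b x ≠ 0 := hx
        positivity
    refine ⟨{x | powerGrad p a x - powerGrad p b x ≠ 0}, ?_, fun x =>
      (variationDiff a b).smulRight ((‖powerGrad p a x - powerGrad p b x‖ ^ 2)⁻¹ •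
        (powerGrad p a x - powerGrad p b x)), ?_, fun x hx => ⟨?_, fun h' => absurd h' hf⟩⟩
    · exact (hg a b).continuous.continuousAt.eventually_ne hgr
    · exact contDiffOn_const.smulRight (hgn.smul (hg a b).contDiffOn)
    · rw [hA]
      refine isAdapted_of_forall_eq b fun a' ha' c => ?_
      have hx' : powerGrad p a x - powerGrad p b x ≠ 0 := hx
      rcases ha' with rfl | rfl
      · rw [ContinuousLinearMap.smulRight_apply, inner_smul_right, inner_smul_right,
          real_inner_self_eq_norm_sq, inv_mul_cancel₀ (by positivity), mul_one, variationDiff_apply]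
      · simp
  · refine ⟨{x | gram (powerGrad p a x - powerGrad p c x) (powerGrad p b x - powerGrad p c x) ≠ 0},
      ?_, fun x => (variationDiff a c).smulRight
        (dualVec (powerGrad p a x - powerGrad p c x) (powerGrad p b x - powerGrad p c x)) +
      (variationDiff b c).smulRight
        (dualVec (powerGrad p b x - powerGrad p c x) (powerGrad p a x - powerGrad p c x)), ?_,
      fun x hx => ⟨?_, fun h' => absurd h' hf⟩⟩
    · exact (continuous_gram (hg a c).continuous (hg b c).continuous).continuousAt.eventually_ne hgr
    · refine (contDiffOn_const.smulRight (contDiffOn_dualVec (hg a c) (hg b c))).add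
        (contDiffOn_const.smulRight ((contDiffOn_dualVec (hg b c) (hg a c)).mono fun x hx => ?_))
      rwa [mem_ofPred_eq, gram_comm]
    · rw [hA]
      have hx' : gram (powerGrad p b x - powerGrad p c x)
          (powerGrad p a x - powerGrad p c x) ≠ 0 := by
        rwa [gram_comm]
      refine isAdapted_of_forall_eq c fun a' ha' e => ?_
      rcases ha' with rfl | rfl | rfl
      · simp [inner_add_right, inner_smul_right, inner_dualVec_left hx, inner_dualVec_right]
      · simp [inner_add_right, inner_smul_right, inner_dualVec_left hx', inner_dualVec_right]
      · simp

/-- The sign of `φ` describes `D` and its frontier near `x`. -/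
def IsSignAt (D : Set (Pt d)) (φ : Pt d → ℝ) (x : Pt d) : Prop :=
  ∀ᶠ y in 𝓝 x, (y ∈ D ↔ φ y < 0) ∧ (y ∈ frontier D ↔ φ y = 0)

/-- The adapted linear maps at `x`, for the cells that are `ε`-close to `x`. -/
def adaptedMaps (D : Set (Pt d)) (p : Params d N) (φ : Pt d → ℝ) (ε : ℝ) (x : Pt d) :
    Set (Variation N →L[ℝ] Pt d) :=
  {w | (x ∈ closure D → IsAdapted p (active p ε x) x w) ∧
    (x ∈ Metric.cthickening ε (frontier D) → ¬ (active p ε x).Subsingleton →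
      (∀ c, ⟪gradient φ x, w c⟫ = c.2) ∧ IsSignAt D φ x)}

/-- The conditions on the linear map are affine, and the sign condition does not involve it.
Convexity is what allows gluing by a partition of unity. -/
theorem convex_adaptedMaps (D : Set (Pt d)) (p : Params d N) (φ : Pt d → ℝ) (ε : ℝ) (x : Pt d) :
    Convex ℝ (adaptedMaps D p φ ε x) := by
  intro w hw w' hw' r r' _ _ hr
  refine ⟨fun hx a ha b hb c => ?_, fun hx hs => ⟨fun c => ?_, (hw.2 hx hs).2⟩⟩
  · have h1 := hw.1 hx a ha b hb c
    have h2 := hw'.1 hx a ha b hb c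
    simp only [add_apply, smul_apply, inner_add_right,
      inner_smul_right]
    obtain rfl : r' = 1 - r := by linarith
    linear_combination r * h1 + (1 - r) * h2
  · have h1 := (hw.2 hx hs).1 c
    have h2 := (hw'.2 hx hs).1 c
    simp only [add_apply, smul_apply, inner_add_right,
      inner_smul_right]
    obtain rfl : r' = 1 - r := by linarith
    linear_combination r * h1 + (1 - r) * h2

theorem eventually_notMem_cthickening {X : Type*} [PseudoMetricSpace X] {F : Set X} {x : X}
    (hF : IsClosed F) (hx : x ∉ F) :
    ∀ᶠ z : ℝ × X in 𝓝 (0, x), z.2 ∉ Metric.cthickening z.1 F := by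
  have hc : IsClosed {z : ℝ × X | Metric.infEDist z.2 F ≤ ENNReal.ofReal z.1} :=
    isClosed_le (Metric.continuous_infEDist.comp continuous_snd)
      (ENNReal.continuous_ofReal.comp continuous_fst)
  refine hc.isOpen_compl.mem_nhds fun h => hx ?_
  have : x ∈ Metric.cthickening 0 F := h
  rwa [Metric.cthickening_zero, hF.closure_eq] at this

/-- By upper semicontinuity, the `ε`-active indices near `x₀` are among those active at `x₀`, for
which regularity provides a field. The statement is joint in `ε` and the point so that compactness
can later extract one `ε`. -/
theorem exists_local_adaptedMaps {p : Params d N} {φ : Pt d → ℝ} (hφ : ContDiff ℝ ∞ φ)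
    (hreg : ∀ x ∈ closure D, IsRegularAt D p φ x)
    (hsign : ∀ x ∈ frontier D, ¬ (active p 0 x).Subsingleton → IsSignAt D φ x) (x₀ : Pt d) :
    ∀ᶠ z : ℝ × Pt d in 𝓝 (0, x₀), ∃ U ∈ 𝓝 z.2, ∃ v : Pt d → Variation N →L[ℝ] Pt d,
      ContDiffOn ℝ ∞ v U ∧ ∀ y ∈ U, v y ∈ adaptedMaps D p φ z.1 y := by
  suffices h : ∃ U ∈ 𝓝 x₀, ∃ v : Pt d → Variation N →L[ℝ] Pt d, ContDiffOn ℝ ∞ v U ∧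
      ∀ᶠ z : ℝ × Pt d in 𝓝 (0, x₀), v z.2 ∈ adaptedMaps D p φ z.1 z.2 by
    obtain ⟨U, hU, v, hv, hz⟩ := h
    obtain ⟨S, W, hS, hS0, hW, hxW, hSW⟩ := mem_nhds_prod_iff'.1 hz
    obtain ⟨U', hU'U, hU', hxU'⟩ := mem_nhds_iff.1 hU
    filter_upwards [prod_mem_nhds (hS.mem_nhds hS0) ((hW.inter hU').mem_nhds ⟨hxW, hxU'⟩)]
      with z hz
    refine ⟨W ∩ U', (hW.inter hU').mem_nhds hz.2, v, hv.mono (inter_subset_right.trans hU'U),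
      fun y hy => ?_⟩
    exact hSW (show (z.1, y) ∈ S ×ˢ W from ⟨hz.1, hy.1⟩)
  by_cases hx : x₀ ∈ closure D
  · obtain ⟨U, hU, v, hv, hvU⟩ := (hreg x₀ hx).exists_local_field hφ
    refine ⟨U, hU, v, hv, ?_⟩
    have hU' : ∀ᶠ z : ℝ × Pt d in 𝓝 (0, x₀), z.2 ∈ U := continuous_snd.continuousAt hU
    by_cases hf : x₀ ∈ frontier D
    · by_cases hs : (active p 0 x₀).Subsingleton
      · filter_upwards [hU', eventually_active_subset_point 0 p x₀] with z h1 h2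
        exact ⟨fun _ => (hvU _ h1).1.mono h2, fun _ h3 => absurd (hs.anti h2) h3⟩
      · have h4 : ∀ᶠ z : ℝ × Pt d in 𝓝 (0, x₀), IsSignAt D φ z.2 :=
          continuous_snd.continuousAt.eventually (eventually_eventually_nhds.2 (hsign x₀ hf hs))
        filter_upwards [hU', eventually_active_subset_point 0 p x₀, h4] with z h1 h2 h4
        exact ⟨fun _ => (hvU _ h1).1.mono h2, fun _ _ => ⟨(hvU _ h1).2 hf hs, h4⟩⟩
    · filter_upwards [hU', eventually_active_subset_point 0 p x₀,
        eventually_notMem_cthickening isClosed_frontier hf] with z h1 h2 h3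
      exact ⟨fun _ => (hvU _ h1).1.mono h2, fun h4 => absurd h4 h3⟩
  · refine ⟨univ, univ_mem, fun _ => 0, contDiffOn_const, ?_⟩
    have h1 : ∀ᶠ z : ℝ × Pt d in 𝓝 (0, x₀), z.2 ∉ closure D :=
      continuous_snd.continuousAt
        (isClosed_closure.isOpen_compl.mem_nhds (show x₀ ∈ (closure D)ᶜ from hx))
    filter_upwards [h1, eventually_notMem_cthickening isClosed_frontier
      (fun h => hx (frontier_subset_closure h))] with z h1 h2
    exact ⟨fun h3 => absurd h3 h1, fun h3 => absurd h3 h2⟩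

-- The tolerance `ε` fattens the constraints to open neighbourhoods, uniformly on a compact set, so
-- that local fields coexist; their convex combinations give a global one.
open scoped Manifold in
theorem exists_adaptedMaps {p : Params d N} {φ : Pt d → ℝ} (hD : Bornology.IsBounded D)
    (hφ : ContDiff ℝ ∞ φ) (hreg : ∀ x ∈ closure D, IsRegularAt D p φ x)
    (hsign : ∀ x ∈ frontier D, ¬ (active p 0 x).Subsingleton → IsSignAt D φ x) :
    ∃ ε > 0, ∃ v : Pt d → Variation N →L[ℝ] Pt d, ContDiff ℝ ∞ v ∧
      ∀ x, v x ∈ adaptedMaps D p φ ε x := by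
  have hK : IsCompact (Metric.cthickening 1 (closure D)) := hD.isCompact_closure.cthickening
  have h1 := hK.eventually_forall_of_forall_eventually (x₀ := (0 : ℝ))
    (P := fun ε x => ∃ U ∈ 𝓝 x, ∃ v : Pt d → Variation N →L[ℝ] Pt d,
      ContDiffOn ℝ ∞ v U ∧ ∀ y ∈ U, v y ∈ adaptedMaps D p φ ε y)
    fun x _ => exists_local_adaptedMaps hφ hreg hsign x
  obtain ⟨ε, hε, hε0, hε1⟩ := ((h1.filter_mono nhdsWithin_le_nhds).and
    (Ioo_mem_nhdsGT (zero_lt_one' ℝ))).exists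
  have h2 : ∀ x, ∃ U ∈ 𝓝 x, ∃ v : Pt d → Variation N →L[ℝ] Pt d,
      ContMDiffOn 𝓘(ℝ, Pt d) 𝓘(ℝ, Variation N →L[ℝ] Pt d) ∞ v U ∧
        ∀ y ∈ U, v y ∈ adaptedMaps D p φ ε y := by
    intro x
    by_cases hx : x ∈ Metric.cthickening 1 (closure D)
    · obtain ⟨U, hU, v, hv, hvU⟩ := hε x hx
      exact ⟨U, hU, v, hv.contMDiffOn, hvU⟩
    -- Off the 1-thickening of `closure D` both constraints are vacuous, because `ε < 1`; the zero
    -- field will do.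
    · refine ⟨_, Metric.isClosed_cthickening.isOpen_compl.mem_nhds hx, fun _ => 0,
        contMDiffOn_const, fun y hy => ⟨fun h => ?_, fun h => ?_⟩⟩
      · exact absurd (Metric.self_subset_cthickening _ h) hy
      · exact absurd (Metric.cthickening_subset_of_subset _ frontier_subset_closure
          (Metric.cthickening_mono hε1.le _ h)) hy
  obtain ⟨g, hg⟩ := exists_contMDiffMap_forall_mem_convex_of_local (n := ⊤) 𝓘(ℝ, Pt d)
    (convex_adaptedMaps D p φ ε) h2
  exact ⟨ε, hε0, g, g.contMDiff.contDiff, hg⟩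

theorem isOpen_setOf_active_subsingleton (p : Params d N) (ε : ℝ) :
    IsOpen {x | (active p ε x).Subsingleton} := by
  rw [isOpen_iff_mem_nhds]
  intro x hx
  have h := ((Continuous.prodMk_right ε).tendsto x).eventually
    (eventually_active_subset_point ε p x)
  filter_upwards [h] with y hy
  exact Subsingleton.anti hx hy

open scoped Manifold in
/-- A global smooth field of adapted linear maps, and a cutoff function that vanishes at the points
of the frontier of `D` near which this field is not tangent to the frontier. -/
theorem exists_field {p : Params d N} {φ : Pt d → ℝ} (hD : Bornology.IsBounded D)
    (hφ : ContDiff ℝ ∞ φ) (hreg : ∀ x ∈ closure D, IsRegularAt D p φ x)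
    (hsign : ∀ x ∈ frontier D, ¬ (active p 0 x).Subsingleton → IsSignAt D φ x) :
    ∃ (v : Pt d → Variation N →L[ℝ] Pt d) (χ : Pt d → ℝ) (K : Set (Pt d)),
      ContDiff ℝ ∞ v ∧ ContDiff ℝ ∞ χ ∧ IsCompact K ∧ (∀ x ∉ K, v x = 0 ∧ χ x = 0) ∧
      (∀ x₀ ∈ closure D, ¬ (active p 0 x₀).Subsingleton →
        ∀ᶠ x in 𝓝 x₀, x ∈ closure D → χ x = 1 ∧ IsAdapted p (active p 0 x₀) x (v x)) ∧
      ∀ x₀ ∈ frontier D, (∀ᶠ x in 𝓝 x₀, χ x = 0) ∨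
        ((∀ᶠ x in 𝓝 x₀, ∀ c, ⟪gradient φ x, v x c⟫ = c.2) ∧ IsSignAt D φ x₀) := by
  obtain ⟨ε, hε, v, hv, hvt⟩ := exists_adaptedMaps hD hφ hreg hsign
  set K₁ := Metric.cthickening 1 (closure D)
  set K₂ := Metric.cthickening 2 (closure D)
  have hK₁ : ∀ x ∈ closure D, K₁ ∈ 𝓝 x := fun x hx => Filter.mem_of_superset
    (Metric.isOpen_thickening.mem_nhds (Metric.self_subset_thickening one_pos _ hx))
    (Metric.thickening_subset_cthickening _ _)
  have hK₁₂ : K₁ ⊆ interior K₂ := (Metric.cthickening_subset_thickening' two_pos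
    (by norm_num) _).trans (Metric.thickening_subset_interior_cthickening _ _)
  have hK₂ : IsCompact K₂ := hD.isCompact_closure.cthickening
  -- `β` gives the field a compact support without changing it on the neighbourhood `K₁` of `closure
  -- D`.
  obtain ⟨β, hβ, -, hβ0, hβ1⟩ := exists_contMDiff_support_eq_eq_one_iff (n := ⊤) 𝓘(ℝ, Pt d)
    (isOpen_interior (s := K₂)) (Metric.isClosed_cthickening) hK₁₂
  -- Three thresholds `ε / 3 < ε / 2 < ε`: `χ` equals 1 at the points of `closure D` with two `ε /
  -- 3`-active indices, and vanishes where at most one index is `ε / 2`-active; near the remaining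
  -- frontier points two indices are `ε`-active, so the field controls `φ`. The gaps absorb small
  -- moves of the point.
  let F := closure D ∩ {x | (active p (ε / 3) x).Subsingleton}ᶜ
  have hF : IsClosed F :=
    isClosed_closure.inter (isOpen_setOf_active_subsingleton p _).isClosed_compl
  let O := interior {x | (active p (ε / 2) x).Subsingleton}ᶜ ∩ interior K₁
  have hFO : F ⊆ O := by
    refine fun x hx => ⟨?_, mem_interior_iff_mem_nhds.2 (hK₁ x hx.1)⟩
    rw [mem_interior_iff_mem_nhds]
    filter_upwards [eventually_subset_active (show ε / 3 < ε / 2 by linarith) p x] with y hy hs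
    exact hx.2 (Subsingleton.anti hs hy)
  obtain ⟨χ, hχ, -, hχ0, hχ1⟩ := exists_contMDiff_support_eq_eq_one_iff (n := ⊤) 𝓘(ℝ, Pt d)
    (isOpen_interior.inter isOpen_interior : IsOpen O) hF hFO
  have hχz : ∀ x, x ∉ O → χ x = 0 := fun x hx => by
    have h : x ∉ Function.support χ := fun h => hx (hχ0.subset h)
    exact Function.notMem_support.1 h
  have hvβ : ∀ x ∈ K₁, β x • v x = v x := fun x hx => by rw [(hβ1 x).1 hx, one_smul]
  refine ⟨fun x => β x • v x, χ, K₂, hβ.contDiff.smul hv, hχ.contDiff, hK₂, fun x hx => ?_,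
    fun x₀ hx₀ hs => ?_, fun x₀ hx₀ => ?_⟩
  · have h1 : x ∉ interior K₂ := fun h => hx (interior_subset h)
    refine ⟨?_, hχz x fun h => h1 (hK₁₂ (interior_subset h.2))⟩
    rw [← hβ0] at h1
    simp only [Function.notMem_support.1 h1]
    exact zero_smul ℝ (v x)
  · filter_upwards [hK₁ x₀ hx₀, eventually_subset_active (show 0 < ε / 3 by linarith) p x₀,
      eventually_subset_active hε p x₀] with x h1 h2 h3 hx
    refine ⟨(hχ1 x).1 ⟨hx, fun h => hs (Subsingleton.anti h h2)⟩, ?_⟩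
    rw [hvβ x h1]
    exact ((hvt x).1 hx).mono h3
  · by_cases hs : (active p (ε / 2) x₀).Subsingleton
    · left
      filter_upwards [(isOpen_setOf_active_subsingleton p (ε / 2)).mem_nhds hs] with x hx
      exact hχz x fun h => (interior_subset h.1) hx
    · right
      have h0 := eventually_subset_active (show ε / 2 < ε by linarith) p x₀
      have h1 : ∀ᶠ x in 𝓝 x₀, x ∈ Metric.cthickening ε (frontier D) := Filter.mem_of_superset
        (Metric.isOpen_thickening.mem_nhds (Metric.self_subset_thickening hε _ hx₀))
        (Metric.thickening_subset_cthickening _ _)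
      have h2 : ∀ᶠ x in 𝓝 x₀, (∀ c, ⟪gradient φ x, v x c⟫ = c.2) ∧ IsSignAt D φ x := by
        filter_upwards [h0, h1] with x h0 h1
        exact (hvt x).2 h1 fun h => hs (Subsingleton.anti h h0)
      refine ⟨?_, h2.self_of_nhds.2⟩
      filter_upwards [h2, hK₁ x₀ (frontier_subset_closure hx₀)] with x h2 h3
      rw [hvβ x h3]
      exact h2.1

end

/-! ### Fixed points depending smoothly on parameters -/

section

section ImplicitFunction

variable {Z H X C : Type*} [NormedAddCommGroup Z] [NormedSpace ℝ Z] [FiniteDimensional ℝ Z]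
  [NormedAddCommGroup H] [NormedSpace ℝ H] [FiniteDimensional ℝ H]
  [NormedAddCommGroup X] [NormedSpace ℝ X] [FiniteDimensional ℝ X]
  [NormedAddCommGroup C] [NormedSpace ℝ C] [FiniteDimensional ℝ C]

/-- The local smooth dependence of a fixed point on parameters. -/
theorem exists_local_fixedPoint {T : Z × C → C} (hT : ContDiff ℝ ∞ T) {z₀ : Z} {c₀ : C}
    (h₀ : T (z₀, c₀) = c₀)
    (hA : ‖(fderiv ℝ T (z₀, c₀)).comp (ContinuousLinearMap.inr ℝ Z C)‖ < 1) :
    ∃ f : Z → C, ContDiffAt ℝ ∞ f z₀ ∧ f z₀ = c₀ ∧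
      ∀ᶠ w : Z × C in 𝓝 (z₀, c₀), T w = w.2 ↔ f w.1 = w.2 := by
  have := FiniteDimensional.complete ℝ (Z × C)
  -- Fixed points of `T` are the points that `Ψ` sends to a pair with second component 0. As the
  -- partial derivative of `T` in `c` has norm less than 1, the derivative of `Ψ` is injective,
  -- hence invertible in finite dimension, and the inverse function theorem applies.
  let Ψ : Z × C → Z × C := fun w => (w.1, w.2 - T w)
  have hΨ : ContDiff ℝ ∞ Ψ := contDiff_fst.prodMk (contDiff_snd.sub hT)
  let L : Z × C →L[ℝ] Z × C := (ContinuousLinearMap.fst ℝ Z C).prod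
    (ContinuousLinearMap.snd ℝ Z C - fderiv ℝ T (z₀, c₀))
  have hL : HasFDerivAt Ψ L (z₀, c₀) := by
    have h1 : HasFDerivAt T (fderiv ℝ T (z₀, c₀)) (z₀, c₀) :=
      (hT.differentiable (by simp) _).hasFDerivAt
    exact hasFDerivAt_fst.prodMk (hasFDerivAt_snd.sub h1)
  have hinj : Function.Injective (L : Z × C →ₗ[ℝ] Z × C) := by
    rw [← LinearMap.ker_eq_bot, LinearMap.ker_eq_bot']
    rintro ⟨z, c⟩ hzc
    have h1 : z = 0 := congrArg Prod.fst hzc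
    have h2 : c - fderiv ℝ T (z₀, c₀) (z, c) = 0 := congrArg Prod.snd hzc
    subst h1
    have h3 := ((fderiv ℝ T (z₀, c₀)).comp (ContinuousLinearMap.inr ℝ Z C)).le_opNorm c
    rw [ContinuousLinearMap.comp_apply, ContinuousLinearMap.inr_apply, ← sub_eq_zero.1 h2] at h3
    have h4 : ‖c‖ = 0 := by
      by_contra hc
      have : 0 < ‖c‖ := lt_of_le_of_ne (norm_nonneg _) (Ne.symm hc)
      nlinarith
    rw [norm_eq_zero.1 h4]; rfl
  let e : (Z × C) ≃L[ℝ] Z × C := (LinearEquiv.ofInjectiveEndo _ hinj).toContinuousLinearEquiv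
  have he : HasFDerivAt Ψ (e : Z × C →L[ℝ] Z × C) (z₀, c₀) := by
    convert hL using 1
    ext w <;> rfl
  have hΨ0 : Ψ (z₀, c₀) = (z₀, 0) := by simp [Ψ, h₀]
  have hn : (∞ : WithTop ℕ∞) ≠ 0 := by simp
  let Φ := hΨ.contDiffAt.toOpenPartialHomeomorph Ψ he hn
  have hsrc : (z₀, c₀) ∈ Φ.source := hΨ.contDiffAt.mem_toOpenPartialHomeomorph_source he hn
  have hcoe : ∀ w, Φ w = Ψ w := fun w => rfl
  have htgt : (z₀, (0 : C)) ∈ Φ.target := by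
    rw [← hΨ0, ← hcoe]; exact Φ.map_source hsrc
  have hinv : Φ.symm (z₀, 0) = (z₀, c₀) := by
    rw [← hΨ0, ← hcoe]; exact Φ.left_inv hsrc
  have hsymm : ContDiffAt ℝ ∞ Φ.symm (z₀, 0) := by
    rw [← hΨ0]
    exact hΨ.contDiffAt.to_localInverse he hn
  have hz : ContDiffAt ℝ ∞ (fun z : Z => (z, (0 : C))) z₀ :=
    contDiffAt_id.prodMk contDiffAt_const
  refine ⟨fun z => (Φ.symm (z, 0)).2, contDiffAt_snd.comp _ (hsymm.comp z₀ hz), ?_, ?_⟩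
  · simp only [hinv]
  · have h1 : ∀ᶠ w : Z × C in 𝓝 (z₀, c₀), w ∈ Φ.source := Φ.open_source.mem_nhds hsrc
    have h2 : ∀ᶠ w : Z × C in 𝓝 (z₀, c₀), (w.1, (0 : C)) ∈ Φ.target := by
      have : Continuous (fun w : Z × C => (w.1, (0 : C))) := by fun_prop
      exact this.continuousAt (Φ.open_target.mem_nhds htgt)
    filter_upwards [h1, h2] with w h1 h2
    constructor
    · intro h
      have h3 : Φ w = (w.1, 0) := by rw [hcoe]; simp [Ψ, h]
      rw [← h3, Φ.left_inv h1]
    · intro h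
      have h3 : Ψ (Φ.symm (w.1, 0)) = (w.1, 0) := Φ.right_inv h2
      have h5 : (Ψ (Φ.symm (w.1, 0))).1 = w.1 := by rw [h3]
      have h4 : Φ.symm (w.1, 0) = w := Prod.ext h5 h
      rw [h4] at h3
      exact (sub_eq_zero.1 (congrArg Prod.snd h3)).symm

/-- The local implicit functions agree because small fixed points are unique, with a radius `r`
uniform in `x`: by compactness on `K`, and trivially off `K`, where `T` vanishes. One global choice
of a small fixed point is therefore locally smooth. -/
theorem exists_fixedPoint {T : (H × X) × C → C} (hT : ContDiff ℝ ∞ T) {K : Set X}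
    (hK : IsCompact K) (hTK : ∀ x ∉ K, ∀ h c, T ((h, x), c) = 0) (h₀ : ∀ x, T ((0, x), 0) = 0)
    (hA : ∀ x, (fderiv ℝ T ((0, x), 0)).comp (ContinuousLinearMap.inr ℝ (H × X) C) = 0) :
    ∃ f : H × X → C, (∀ x, f (0, x) = 0) ∧ (∀ x ∉ K, ∀ h, f (h, x) = 0) ∧
      ∀ x, ∀ᶠ z in 𝓝 ((0 : H), x), T (z, f z) = f z ∧ ContDiffAt ℝ ∞ f z ∧
        (T (z, 0) = 0 → f z = 0) := by
  have hloc : ∀ x, ∃ f : H × X → C, ContDiffAt ℝ ∞ f (0, x) ∧ f (0, x) = 0 ∧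
      ∀ᶠ w : (H × X) × C in 𝓝 ((0, x), 0), T w = w.2 ↔ f w.1 = w.2 := fun x =>
    exists_local_fixedPoint hT (h₀ x) (by rw [hA]; simp)
  -- small fixed points are unique
  have huniq : ∀ x, ∀ᶠ w : (H × C × C) × X in 𝓝 (0, x),
      T ((w.1.1, w.2), w.1.2.1) = w.1.2.1 → T ((w.1.1, w.2), w.1.2.2) = w.1.2.2 →
        w.1.2.1 = w.1.2.2 := by
    intro x
    obtain ⟨f, -, -, hf⟩ := hloc x
    have h1 : Tendsto (fun w : (H × C × C) × X => ((w.1.1, w.2), w.1.2.1)) (𝓝 (0, x))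
        (𝓝 ((0, x), 0)) := Continuous.tendsto' (by fun_prop) _ _ rfl
    have h2 : Tendsto (fun w : (H × C × C) × X => ((w.1.1, w.2), w.1.2.2)) (𝓝 (0, x))
        (𝓝 ((0, x), 0)) := Continuous.tendsto' (by fun_prop) _ _ rfl
    filter_upwards [h1.eventually hf, h2.eventually hf] with w h1 h2 h3 h4
    exact (h1.1 h3).symm.trans (h2.1 h4)
  have huniq' := hK.eventually_forall_of_forall_eventually (x₀ := (0 : H × C × C))
    (P := fun w x => T ((w.1, x), w.2.1) = w.2.1 → T ((w.1, x), w.2.2) = w.2.2 → w.2.1 = w.2.2)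
    fun x _ => huniq x
  obtain ⟨r, hr, hru⟩ := Metric.eventually_nhds_iff.1 huniq'
  have hU : ∀ h x c c', ‖h‖ < r → ‖c‖ < r → ‖c'‖ < r → T ((h, x), c) = c → T ((h, x), c') = c' →
      c = c' := by
    intro h x c c' hh hc hc' h1 h2
    by_cases hx : x ∈ K
    · refine hru (y := (h, c, c')) ?_ x hx h1 h2
      rw [dist_zero_right, Prod.norm_mk, Prod.norm_mk]
      exact max_lt hh (max_lt hc hc')
    · rw [← h1, ← h2, hTK x hx, hTK x hx]
  classical
  -- The value 0 is a default where there is no small fixed point; near `h = 0` one always exists.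
  let f : H × X → C := fun z => if h : ∃ c, ‖c‖ < r ∧ T (z, c) = c then h.choose else 0
  have hf : ∀ z c, ‖z.1‖ < r → ‖c‖ < r → T (z, c) = c → f z = c := by
    intro z c hz hc hTc
    have h : ∃ c, ‖c‖ < r ∧ T (z, c) = c := ⟨c, hc, hTc⟩
    simp only [f, dif_pos h]
    exact hU z.1 z.2 _ _ hz h.choose_spec.1 hc h.choose_spec.2 hTc
  have hf0 : ∀ x, f (0, x) = 0 := fun x => hf _ _ (by simpa) (by simpa) (h₀ x)
  refine ⟨f, hf0, fun x hx h => ?_, fun x => ?_⟩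
  · by_cases hc : ∃ c, ‖c‖ < r ∧ T ((h, x), c) = c
    · simp only [f, dif_pos hc]
      rw [← hc.choose_spec.2, hTK x hx]
    · simp only [f, dif_neg hc]
  · obtain ⟨k, hk, hk0, hkT⟩ := hloc x
    have hz : ∀ᶠ z : H × X in 𝓝 (0, x), ‖z.1‖ < r :=
      continuous_fst.norm.continuousAt.eventually_lt continuousAt_const (by simpa)
    have hcurve : Tendsto (fun z => (z, k z)) (𝓝 ((0 : H), x)) (𝓝 ((0, x), 0)) := by
      have := continuousAt_id.prodMk hk.continuousAt
      rwa [ContinuousAt, hk0] at this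
    have hkf : ∀ᶠ z in 𝓝 ((0 : H), x), T (z, k z) = k z ∧ f z = k z := by
      have h1 : ∀ᶠ z in 𝓝 ((0 : H), x), ‖k z‖ < r :=
        hk.continuousAt.norm.eventually_lt continuousAt_const (by simpa [hk0])
      filter_upwards [hcurve.eventually hkT, h1, hz] with z h1 h2 h3
      have := h1.2 rfl
      exact ⟨this, hf z _ h3 h2 this⟩
    have hfT : ∀ᶠ z in 𝓝 ((0 : H), x), T (z, f z) = f z := hkf.mono fun z h => by
      rw [h.2]; exact h.1
    have hcont : ∀ᶠ z in 𝓝 ((0 : H), x), ContinuousAt f z := by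
      have h1 : ∀ᶠ z in 𝓝 ((0 : H), x), ContDiffAt ℝ 1 k z :=
        (hk.of_le (by simp)).eventually (by simp)
      filter_upwards [h1, eventually_eventually_nhds.2 hkf] with z h1 h2
      exact h1.continuousAt.congr (h2.mono fun y hy => hy.2.symm)
    have hnorm : ∀ᶠ z in 𝓝 ((0 : H), x),
        ‖(fderiv ℝ T (z, f z)).comp (ContinuousLinearMap.inr ℝ (H × X) C)‖ < 1 := by
      have h1 : Tendsto (fun z => (z, f z)) (𝓝 ((0 : H), x)) (𝓝 ((0, x), 0)) :=
        hcurve.congr' (hkf.mono fun z h => by simp only [h.2])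
      have h2 : Continuous fun w => ‖(fderiv ℝ T w).comp (ContinuousLinearMap.inr ℝ (H × X) C)‖ :=
        ((hT.continuous_fderiv (by simp)).clm_comp continuous_const).norm
      exact (h2.continuousAt.tendsto.comp h1).eventually (gt_mem_nhds (by rw [hA]; simp))
    -- `ContDiffAt ℝ ∞` at one point does not spread to a neighbourhood, since the neighbourhoods
    -- may shrink with the order. So the local theorem is applied afresh at each nearby `z`, where
    -- the partial derivative is small but possibly nonzero.
    filter_upwards [hfT, eventually_eventually_nhds.2 hfT, hcont, hnorm, hz] with z h1 h2 h3 h4 h5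
    refine ⟨h1, ?_, fun h => hf z 0 h5 (by simpa) h⟩
    obtain ⟨k', hk', -, hkT'⟩ := exists_local_fixedPoint hT h1 h4
    refine hk'.congr_of_eventuallyEq ?_
    have h6 : Tendsto (fun y => (y, f y)) (𝓝 z) (𝓝 (z, f z)) := continuousAt_id.prodMk h3
    filter_upwards [h6.eventually hkT', h2] with y h6 h2
    exact (h6.1 h2).symm

end ImplicitFunction

end

/-! ### The deformation of the diagram -/

section

variable {d N : ℕ} {D : Set (Pt d)} {p : Params d N}

/-- The displacements `u (h, ·)`, for small `h`, move the diagram of parameters `p` to that of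
parameters `p + h`. -/
structure IsDeformation (D : Set (Pt d)) (p : Params d N) (K : Set (Pt d))
    (u : Params d N × Pt d → Pt d) : Prop where
  isCompact : IsCompact K
  eq_zero_of_notMem : ∀ x ∉ K, ∀ h, u (h, x) = 0
  eq_zero : ∀ x, u (0, x) = 0
  contDiffAt : ∀ x, ∀ᶠ z in 𝓝 ((0 : Params d N), x), ContDiffAt ℝ ∞ u z
  mem_iff : ∀ x, ∀ᶠ z in 𝓝 ((0 : Params d N), x), (z.2 + u z ∈ D ↔ z.2 ∈ D) ∧
    (z.2 + u z ∈ frontier D ↔ z.2 ∈ frontier D)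
  active_eq : ∀ x ∈ closure D, ∀ᶠ z in 𝓝 ((0 : Params d N), x), z.2 ∈ closure D →
    active (p + z.1) 0 (z.2 + u z) = active p 0 z.2

/-- The second order remainders of the functions `power p a` and `φ` at `x`, for the displacement
`v x c` and the perturbation `χ x • h` of the parameters. -/
def remainder (p : Params d N) (φ χ : Pt d → ℝ) (v : Pt d → Variation N →L[ℝ] Pt d)
    (w : (Params d N × Pt d) × Variation N) : Variation N :=
  (fun a => power p a w.1.2 + ⟪powerGrad p a w.1.2, v w.1.2 w.2⟫ -
      power (p + χ w.1.2 • w.1.1) a (w.1.2 + v w.1.2 w.2),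
    φ w.1.2 + ⟪gradient φ w.1.2, v w.1.2 w.2⟫ - φ (w.1.2 + v w.1.2 w.2))

theorem contDiff_remainder {φ χ : Pt d → ℝ} {v : Pt d → Variation N →L[ℝ] Pt d}
    (hφ : ContDiff ℝ ∞ φ) (hχ : ContDiff ℝ ∞ χ) (hv : ContDiff ℝ ∞ v) :
    ContDiff ℝ ∞ (remainder p φ χ v) := by
  have hx : ContDiff ℝ ∞ (fun w : (Params d N × Pt d) × Variation N => w.1.2) :=
    contDiff_snd.comp contDiff_fst
  have hvc : ContDiff ℝ ∞ (fun w : (Params d N × Pt d) × Variation N => v w.1.2 w.2) :=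
    (hv.comp hx).clm_apply contDiff_snd
  have hp : ContDiff ℝ ∞ (fun w : (Params d N × Pt d) × Variation N => p + χ w.1.2 • w.1.1) :=
    contDiff_const.add ((hχ.comp hx).smul (contDiff_fst.comp contDiff_fst))
  refine ContDiff.prodMk (contDiff_pi.2 fun a => ?_) ?_
  · exact (((contDiff_power a).comp (contDiff_const.prodMk hx)).add
      (((contDiff_powerGrad_right p a).comp hx).inner ℝ hvc)).sub
      ((contDiff_power a).comp (hp.prodMk (hx.add hvc)))
  · exact ((hφ.comp hx).add (((contDiff_gradient hφ).comp hx).inner ℝ hvc)).sub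
      (hφ.comp (hx.add hvc))

theorem hasFDerivAt_taylor {f : Pt d → ℝ} {g x : Pt d} (hf : HasFDerivAt f (innerSL ℝ g) x)
    (l : Variation N →L[ℝ] Pt d) :
    HasFDerivAt (fun c : Variation N => f x + ⟪g, l c⟫ - f (x + l c))
      (0 : Variation N →L[ℝ] ℝ) 0 := by
  have h1 : HasFDerivAt (fun c : Variation N => x + l c) l 0 := l.hasFDerivAt.const_add x
  have h2 : HasFDerivAt f (innerSL ℝ g) (x + l 0) := by simpa
  have h3 : HasFDerivAt (fun c : Variation N => ⟪g, l c⟫) ((innerSL ℝ g).comp l) 0 :=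
    ((innerSL ℝ g).comp l).hasFDerivAt
  have h4 := (h3.const_add (f x)).sub (h2.comp 0 h1)
  rwa [sub_self] at h4

/-- At `h = 0` the map `c ↦ remainder` is a Taylor remainder of order two composed with a linear
map, whatever `v` is; this makes the fixed point equation solvable. -/
theorem fderiv_remainder {φ χ : Pt d → ℝ} {v : Pt d → Variation N →L[ℝ] Pt d}
    (hφ : ContDiff ℝ ∞ φ) (hχ : ContDiff ℝ ∞ χ) (hv : ContDiff ℝ ∞ v) (x : Pt d) :
    (fderiv ℝ (remainder p φ χ v) ((0, x), 0)).comp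
      (ContinuousLinearMap.inr ℝ (Params d N × Pt d) (Variation N)) = 0 := by
  have h1 : HasFDerivAt (remainder p φ χ v) (fderiv ℝ (remainder p φ χ v) ((0, x), 0))
      ((0, x), 0) := ((contDiff_remainder hφ hχ hv).differentiable (by simp) _).hasFDerivAt
  have h2 := h1.comp (0 : Variation N) (hasFDerivAt_prodMk_right (0, x) (0 : Variation N))
  have hg : HasFDerivAt φ (innerSL ℝ (gradient φ x)) x :=
    (hφ.differentiable (by simp) x).hasGradientAt.hasFDerivAt
  have h3 : HasFDerivAt (fun c : Variation N => remainder p φ χ v ((0, x), c))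
      (0 : Variation N →L[ℝ] Variation N) 0 := by
    have := (hasFDerivAt_pi.2 fun a => hasFDerivAt_taylor (hasFDerivAt_power p a x) (v x)).prodMk
      (hasFDerivAt_taylor hg (v x))
    have he : (fun c : Variation N => remainder p φ χ v ((0, x), c)) = fun c =>
        (fun a => power p a x + ⟪powerGrad p a x, v x c⟫ - power p a (x + v x c),
          φ x + ⟪gradient φ x, v x c⟫ - φ (x + v x c)) := by
      funext c
      simp [remainder]
    rw [he]
    exact this.congr_fderiv (by ext <;> rfl)
  exact h2.unique h3

/-- If `A` contains all the minimizers, minimality need only be tested inside `A`, where adapted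
displacements control the differences of powers. -/
theorem mem_active_iff_of_subset {A : Set (Option (Fin N))} {x : Pt d} (h : active p 0 x ⊆ A)
    (a : Option (Fin N)) : a ∈ active p 0 x ↔ a ∈ A ∧ ∀ b ∈ A, power p a x ≤ power p b x := by
  refine ⟨fun ha => ⟨h ha, fun b _ => by simpa using ha b⟩, fun ha b => ?_⟩
  obtain ⟨c, hc⟩ := active_nonempty p x
  have h1 := ha.2 c (h hc)
  have h2 := hc b
  linarith

/-- The vertices on `frontier D` are exactly its points with at least two minimizers, a closed set
by upper semicontinuity; closedness is what the patching needs. -/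
theorem Generic.exists_levelSet (hd : 2 ≤ d)
    (hG : Generic D p.1 p.2) (hD : IsOpen D) :
    ∃ φ : Pt d → ℝ, ContDiff ℝ ∞ φ ∧
      ∀ q ∈ vertices D p.1 p.2, q ∈ frontier D → IsLevelSetAt D q φ := by
  have hp : ∀ i, 0 ≤ p.2 i := fun i => (hG.weight_pos hd i).le
  have hnum : ∀ x, ¬ (active p 0 x).Subsingleton ↔ 2 ≤ (active p 0 x).ncard := fun x => by
    rw [← ncard_le_one_iff_subsingleton]; omega
  have hZ : IsClosed (frontier D ∩ {x | (active p 0 x).Subsingleton}ᶜ) :=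
    isClosed_frontier.inter (isOpen_setOf_active_subsingleton p 0).isClosed_compl
  obtain ⟨φ, hφ, hφZ⟩ := ModLaguerre.exists_levelSet hD hZ fun q hq =>
    hG.boundary_smooth q ((mem_vertices_iff hp).2
      ⟨frontier_subset_closure hq.1, Or.inr ⟨hq.1, (hnum q).1 hq.2⟩⟩) hq.1
  refine ⟨φ, hφ, fun q hq hf => hφZ q ⟨hf, (hnum q).2 ?_⟩⟩
  rcases ((mem_vertices_iff hp).1 hq).2 with h | h
  · omega
  · exact h.2

/-- For a fixed point `c = f z` of `remainder`, where `χ = 1`, the power of index `a` at the new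
point and parameters is the old one plus `⟪powerGrad p a x, v x c⟫ - c.1 a`, with `x = z.2`, and
adaptedness makes this increment independent of `a`. Likewise `φ` changes by `⟪gradient φ x, v x c⟫
- c.2 = 0` where the field controls it. -/
theorem Generic.exists_isDeformation (hd : 2 ≤ d) (hD : IsOpen D) (hb : Bornology.IsBounded D)
    (hG : Generic D p.1 p.2) : ∃ K u, IsDeformation D p K u := by
  have hp : ∀ i, 0 ≤ p.2 i := fun i => (hG.weight_pos hd i).le
  obtain ⟨φ, hφ, hφv⟩ := hG.exists_levelSet hd hD
  have hφs : ∀ x ∈ frontier D, ¬ (active p 0 x).Subsingleton → IsSignAt D φ x := fun x hx hs => by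
    rw [← ncard_le_one_iff_subsingleton] at hs
    exact (hφv x ((mem_vertices_iff hp).2
      ⟨frontier_subset_closure hx, Or.inr ⟨hx, by omega⟩⟩) hx).2.2
  obtain ⟨v, χ, K, hv, hχ, hK, hvK, hA, hB⟩ := exists_field hb hφ
    (fun x hx => hG.isRegularAt hd hφv hx) hφs
  obtain ⟨f, hf0, hfK, hf⟩ := exists_fixedPoint (contDiff_remainder (p := p) hφ hχ hv) hK
    (fun x hx h c => by simp [remainder, hvK x hx]; rfl) (fun x => by simp [remainder]; rfl)
    (fderiv_remainder hφ hχ hv)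
  let u : Params d N × Pt d → Pt d := fun z => v z.2 (f z)
  have hu0 : ∀ x, u (0, x) = 0 := fun x => by simp [u, hf0]
  have hu : ∀ x, ∀ᶠ z in 𝓝 ((0 : Params d N), x), ContDiffAt ℝ ∞ u z := fun x =>
    (hf x).mono fun z hz => ((hv.comp contDiff_snd).contDiffAt).clm_apply hz.2.1
  have hcont : ∀ x, Tendsto (fun z : Params d N × Pt d => z.2 + u z) (𝓝 (0, x)) (𝓝 x) := by
    intro x
    have := (continuousAt_snd.add (hu x).self_of_nhds.continuousAt).tendsto
    simp only [Pi.add_apply, hu0, add_zero] at this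
    exact this
  have hsnd : ∀ x, Tendsto (fun z : Params d N × Pt d => z.2) (𝓝 (0, x)) (𝓝 x) := fun x =>
    continuous_snd.tendsto _
  refine ⟨K, u, hK, fun x hx h => by simp [u, hfK x hx], hu0, hu, fun x => ?_, fun x hx => ?_⟩
  · by_cases hxf : x ∈ frontier D
    · rcases hB x hxf with h0 | ⟨hg, hs⟩
      -- Where `χ = 0`, `c = 0` solves the equation, so by uniqueness the point does not move.
      · filter_upwards [(hsnd x).eventually h0, hf x] with z h1 h2
        have : f z = 0 := h2.2.2 (by simp [remainder, h1]; rfl)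
        simp [u, this]
      · filter_upwards [(hsnd x).eventually hg, hf x, (hsnd x).eventually hs,
          (hcont x).eventually hs] with z h1 h2 h3 h4
        have h5 := congrArg Prod.snd h2.1
        have h6 : φ (z.2 + u z) = φ z.2 := by
          have h7 := h1 (f z)
          simp only [remainder] at h5
          simp only [u]
          linarith
        rw [h3.1, h3.2, h4.1, h4.2, h6]
        exact ⟨Iff.rfl, Iff.rfl⟩
    -- Off the frontier, a small displacement stays in the open set `D` or in the open complement of
    -- its closure.
    · rw [hD.frontier_eq] at hxf ⊢
      by_cases hxD : x ∈ D
      · filter_upwards [(hsnd x).eventually (hD.mem_nhds hxD),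
          (hcont x).eventually (hD.mem_nhds hxD)] with z h1 h2
        exact ⟨iff_of_true h2 h1, iff_of_false (fun h => h.2 h2) fun h => h.2 h1⟩
      · have hxc : x ∈ (closure D)ᶜ := fun h => hxf ⟨h, hxD⟩
        have hc := isClosed_closure.isOpen_compl.mem_nhds hxc
        filter_upwards [(hsnd x).eventually hc, (hcont x).eventually hc] with z h1 h2
        have h3 := fun h => h1 (subset_closure h)
        have h4 := fun h => h2 (subset_closure h)
        exact ⟨iff_of_false h4 h3, iff_of_false (fun h => h2 h.1) fun h => h1 h.1⟩
  · have h1 : ∀ᶠ z : Params d N × Pt d in 𝓝 (0, x),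
        active (p + z.1) 0 (z.2 + u z) ⊆ active p 0 x := by
      have : Tendsto (fun z : Params d N × Pt d => (p + z.1, z.2 + u z)) (𝓝 (0, x)) (𝓝 (p, x)) := by
        refine Tendsto.prodMk_nhds ?_ (hcont x)
        exact Continuous.tendsto' (by fun_prop) _ _ (by simp)
      exact this.eventually (eventually_active_subset_params p x)
    have h2 : ∀ᶠ z : Params d N × Pt d in 𝓝 (0, x), active p 0 z.2 ⊆ active p 0 x := by
      have : Tendsto (fun z : Params d N × Pt d => (p, z.2)) (𝓝 (0, x)) (𝓝 (p, x)) :=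
        Continuous.tendsto' (by fun_prop) _ _ rfl
      exact this.eventually (eventually_active_subset_params p x)
    by_cases hs : (active p 0 x).Subsingleton
    -- With a single minimizer at `x`, both active sets are nonempty subsets of the same singleton;
    -- nothing is required of the displacement except smallness.
    · filter_upwards [h1, h2] with z h1 h2 _
      obtain ⟨a, ha⟩ := active_nonempty (p + z.1) (z.2 + u z)
      obtain ⟨b, hb⟩ := active_nonempty p z.2
      rw [(hs.anti h1).eq_singleton_of_mem ha, (hs.anti h2).eq_singleton_of_mem hb,
        hs (h1 ha) (h2 hb)]
    · filter_upwards [h1, h2, hf x, (hsnd x).eventually (hA x hx hs)] with z h1 h2 h3 h4 hz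
      obtain ⟨hχ1, had⟩ := h4 hz
      ext a
      rw [mem_active_iff_of_subset h1, mem_active_iff_of_subset h2]
      refine and_congr_right fun ha => forall₂_congr fun b hb => ?_
      -- Adaptedness and the fixed point equations for `a` and `b` together show that the difference
      -- of the two powers is unchanged.
      have h5 := had a ha b hb (f z)
      have h6 := fun a => congrFun (congrArg Prod.fst h3.1) a
      simp only [remainder, hχ1, one_smul] at h6
      have h7 := h6 a
      have h8 := h6 b
      simp only [u]
      constructor <;> intro h <;> linarith

end

/-! ### Smooth families as differentiable maps into the Sobolev space -/

section

section Sobolev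

variable {d : ℕ}

/-- The compactly supported `C¹` vector fields. -/
def compactC1 (d : ℕ) : Submodule ℝ (Pt d → Pt d) where
  carrier := {f | ContDiff ℝ 1 f ∧ HasCompactSupport f}
  zero_mem' := ⟨contDiff_const, HasCompactSupport.zero⟩
  add_mem' hf hg := ⟨hf.1.add hg.1, hf.2.add hg.2⟩
  smul_mem' c _ hf := ⟨contDiff_const.smul hf.1, hf.2.smul_left (f := fun _ => c)⟩

theorem compactC1.differentiable (f : compactC1 d) : Differentiable ℝ (f : Pt d → Pt d) :=
  f.2.1.differentiable (by simp)

theorem compactC1.memLp (f : compactC1 d) : MemLp (f : Pt d → Pt d) ∞ volume :=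
  f.2.1.continuous.memLp_top_of_hasCompactSupport f.2.2 volume

theorem compactC1.memLp_fderiv (f : compactC1 d) : MemLp (fderiv ℝ (f : Pt d → Pt d)) ∞ volume :=
  (f.2.1.continuous_fderiv (by simp)).memLp_top_of_hasCompactSupport (f.2.2.fderiv ℝ) volume

theorem compactC1.isWeakFDeriv (f : compactC1 d) :
    IsWeakFDeriv ((compactC1.memLp f).toLp f)
      ((compactC1.memLp_fderiv f).toLp (fderiv ℝ (f : Pt d → Pt d))) := by
  intro η hη hηs w
  have hf := f.2.1
  have hs := f.2.2
  have h1 : ∀ᵐ x : Pt d, (fderiv ℝ η x w) • ((compactC1.memLp f).toLp f) x =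
      (fderiv ℝ η x w) • f.1 x := by
    filter_upwards [(compactC1.memLp f).coeFn_toLp] with x hx
    rw [hx]
  have h2 : ∀ᵐ x : Pt d, η x • ((compactC1.memLp_fderiv f).toLp (fderiv ℝ (f : Pt d → Pt d))) x w =
      η x • fderiv ℝ f.1 x w := by
    filter_upwards [(compactC1.memLp_fderiv f).coeFn_toLp] with x hx
    rw [hx]
  rw [integral_congr_ae h1, integral_congr_ae h2,
    integral_smul_fderiv_eq_neg_fderiv_smul_of_integrable, neg_neg]
  · exact (((hη.continuous_fderiv (by simp)).clm_apply continuous_const).smul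
      hf.continuous).integrable_of_hasCompactSupport (hs.smul_left (f := fun x => fderiv ℝ η x w))
  · exact (hη.continuous.smul ((hf.continuous_fderiv (by simp)).clm_apply
      continuous_const)).integrable_of_hasCompactSupport hηs.smul_right
  · exact (hη.continuous.smul hf.continuous).integrable_of_hasCompactSupport hηs.smul_right
  · exact fun x _ => hη.differentiable (by simp) x
  · exact fun x _ => (compactC1.differentiable f) x

/-- The inclusion of the compactly supported `C¹` vector fields in `W^{1,∞}`. -/
def compactC1.toW1inf : compactC1 d →ₗ[ℝ] W1inf d where
  toFun f := ⟨((compactC1.memLp f).toLp f,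
    (compactC1.memLp_fderiv f).toLp (fderiv ℝ (f : Pt d → Pt d))), compactC1.isWeakFDeriv f⟩
  map_add' f g := by
    refine Subtype.ext (Prod.ext rfl ?_)
    change (compactC1.memLp_fderiv (f + g)).toLp _ =
      (compactC1.memLp_fderiv f).toLp _ + (compactC1.memLp_fderiv g).toLp _
    rw [← MemLp.toLp_add]
    exact MemLp.toLp_congr (compactC1.memLp_fderiv _) _ (ae_of_all _ fun x =>
      fderiv_add ((compactC1.differentiable f) x) ((compactC1.differentiable g) x))
  map_smul' c f := by
    refine Subtype.ext (Prod.ext rfl ?_)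
    change (compactC1.memLp_fderiv (c • f)).toLp _ = c • (compactC1.memLp_fderiv f).toLp _
    rw [← MemLp.toLp_const_smul]
    exact MemLp.toLp_congr (compactC1.memLp_fderiv _) _ (ae_of_all _ fun x =>
      fderiv_const_smul ((compactC1.differentiable f) x) c)

theorem compactC1.isContinuousRep_toW1inf (f : compactC1 d) :
    IsContinuousRep (compactC1.toW1inf f) f :=
  ⟨f.2.1.continuous, (compactC1.memLp f).coeFn_toLp.symm⟩

/-- The only fact about the norm of `W1inf` that the differentiability argument uses: uniform bounds
on a field and its derivative control it. -/
theorem compactC1.norm_toW1inf_le (f : compactC1 d) {B : ℝ} (hB : 0 ≤ B)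
    (h : ∀ x, ‖f.1 x‖ ≤ B) (h' : ∀ x, ‖fderiv ℝ f.1 x‖ ≤ B) : ‖(compactC1.toW1inf f)‖ ≤ B := by
  refine max_le ?_ ?_
  · change ‖(compactC1.memLp f).toLp _‖ ≤ B
    rw [Lp.norm_toLp, eLpNorm_exponent_top]
    exact ENNReal.toReal_le_of_le_ofReal hB (eLpNormEssSup_le_of_ae_bound (ae_of_all _ h))
  · change ‖(compactC1.memLp_fderiv f).toLp _‖ ≤ B
    rw [Lp.norm_toLp, eLpNorm_exponent_top]
    exact ENNReal.toReal_le_of_le_ofReal hB (eLpNormEssSup_le_of_ae_bound (ae_of_all _ h'))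

end Sobolev

section Family

variable {H X E : Type*} [NormedAddCommGroup H] [NormedSpace ℝ H]
  [NormedAddCommGroup X] [NormedSpace ℝ X] [NormedAddCommGroup E] [NormedSpace ℝ E]

/-- Local statements become uniform over the noncompact space because outside `K` everything is
trivial. -/
theorem IsCompact.eventually_forall_of_off {α β : Type*} [TopologicalSpace α]
    [TopologicalSpace β] {K : Set β} (hK : IsCompact K) {a : α} {P : α → β → Prop}
    (h : ∀ x ∈ K, ∀ᶠ z : α × β in 𝓝 (a, x), P z.1 z.2) (h' : ∀ x ∉ K, ∀ᶠ b in 𝓝 a, ∀ y ∉ K, P b y) :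
    ∀ᶠ b in 𝓝 a, ∀ x, P b x := by
  by_cases hne : ∃ x, x ∉ K
  · obtain ⟨x, hx⟩ := hne
    filter_upwards [hK.eventually_forall_of_forall_eventually (P := P) h, h' x hx] with b h1 h2 x
    by_cases hx : x ∈ K
    · exact h1 x hx
    · exact h2 x hx
  · push Not at hne
    filter_upwards [hK.eventually_forall_of_forall_eventually (P := P) h] with b h1 x
      using h1 x (hne x)

/-- Strict differentiability gives the estimate with the derivative frozen at `(h₀, x₀)`; continuity
of the derivative moves it to `(h₀, z.2)`. Each of the two steps costs `ε / 2`, and the bound is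
locally uniform in the second variable. -/
theorem eventually_norm_sub_le_left {F : H × X → E} {h₀ : H} {x₀ : X}
    (hF : ContDiffAt ℝ 1 F (h₀, x₀)) {ε : ℝ} (hε : 0 < ε) :
    ∀ᶠ z : H × X in 𝓝 (h₀, x₀),
      ‖F z - F (h₀, z.2) - fderiv ℝ F (h₀, z.2) (z.1 - h₀, 0)‖ ≤ ε * ‖z.1 - h₀‖ := by
  have hs := (hF.hasStrictFDerivAt (by simp)).isLittleO
  have h1 := hs.def (half_pos hε)
  have h2 : Tendsto (fun z : H × X => (z, (h₀, z.2))) (𝓝 (h₀, x₀)) (𝓝 ((h₀, x₀), (h₀, x₀))) :=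
    Continuous.tendsto' (by fun_prop) _ _ rfl
  have h3 : Tendsto (fun z : H × X => (h₀, z.2)) (𝓝 (h₀, x₀)) (𝓝 (h₀, x₀)) :=
    Continuous.tendsto' (by fun_prop) _ _ rfl
  have h4 : ContinuousAt (fderiv ℝ F) (h₀, x₀) := by
    have : ContDiffAt ℝ 0 (fderiv ℝ F) (h₀, x₀) := hF.fderiv_right (by simp)
    exact this.continuousAt
  have h5 := (h4.tendsto.comp h3).eventually (Metric.closedBall_mem_nhds _ (half_pos hε))
  filter_upwards [h2.eventually h1, h5] with z h1 h5
  have h6 : z - (h₀, z.2) = (z.1 - h₀, 0) := by ext <;> simp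
  rw [h6] at h1
  have h7 : ‖((z.1 - h₀, 0) : H × X)‖ = ‖z.1 - h₀‖ := by simp [Prod.norm_def]
  rw [h7] at h1
  have h8 := (fderiv ℝ F (h₀, z.2) - fderiv ℝ F (h₀, x₀)).le_opNorm ((z.1 - h₀, 0) : H × X)
  rw [h7] at h8
  have h9 : ‖fderiv ℝ F (h₀, z.2) - fderiv ℝ F (h₀, x₀)‖ ≤ ε / 2 := by
    rw [← mem_closedBall_iff_norm]; exact h5
  have h10 : F z - F (h₀, z.2) - fderiv ℝ F (h₀, z.2) (z.1 - h₀, 0) =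
      (F z - F (h₀, z.2) - fderiv ℝ F (h₀, x₀) (z.1 - h₀, 0)) -
      (fderiv ℝ F (h₀, z.2) - fderiv ℝ F (h₀, x₀)) (z.1 - h₀, 0) := by
    simp only [_root_.sub_apply]; abel
  rw [h10]
  refine (norm_sub_le _ _).trans ?_
  nlinarith [norm_nonneg (z.1 - h₀)]

/-- Differentiation in the second variable commutes with that in the first one. -/
theorem fderiv_fderiv_left_comm {F : H × X → E} {h₀ : H} {x₀ : X}
    (hF : ContDiffAt ℝ ∞ F (h₀, x₀)) (k : H) :
    HasFDerivAt (fun x => fderiv ℝ F (h₀, x) (k, 0))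
      (fderiv ℝ (fun z => (fderiv ℝ F z).comp (ContinuousLinearMap.inr ℝ H X)) (h₀, x₀) (k, 0))
      x₀ := by
  have hsymm := hF.isSymmSndFDerivAt (by simp; exact WithTop.coe_le_coe.2 le_top)
  have h1 : ContDiffAt ℝ ∞ (fderiv ℝ F) (h₀, x₀) := hF.fderiv_right (by simp)
  have h2 : HasFDerivAt (fderiv ℝ F) (fderiv ℝ (fderiv ℝ F) (h₀, x₀)) (h₀, x₀) :=
    (h1.differentiableAt (by simp)).hasFDerivAt
  have h3 := (h2.comp x₀ (hasFDerivAt_prodMk_right h₀ x₀)).clm_apply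
    (hasFDerivAt_const ((k, 0) : H × X) x₀)
  refine h3.congr_fderiv ?_
  have h4 := (h2.clm_comp (hasFDerivAt_const (ContinuousLinearMap.inr ℝ H X) (h₀, x₀))).fderiv
  rw [h4]
  ext y
  simpa using (hsymm.eq (k, 0) (0, y)).symm

variable {d : ℕ} [FiniteDimensional ℝ H]

/-- A smooth family of vector fields, supported in the same compact set, is differentiable for any
norm that is controlled by the `C¹` norm. -/
theorem exists_differentiable_family {W : Type*} [NormedAddCommGroup W] [NormedSpace ℝ W]
    (ι : compactC1 d →ₗ[ℝ] W) (hι : ∀ (f : compactC1 d) (B : ℝ), 0 ≤ B → (∀ x, ‖f.1 x‖ ≤ B) →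
      (∀ x, ‖fderiv ℝ f.1 x‖ ≤ B) → ‖ι f‖ ≤ B)
    {P : W → (Pt d → Pt d) → Prop} (hP : ∀ f, P (ι f) f.1)
    {G : H × Pt d → Pt d} {K : Set (Pt d)} (hK : IsCompact K)
    (hGK : ∀ x ∉ K, ∀ h, G (h, x) = 0) {a : H}
    (hG : ∀ x, ∀ᶠ z in 𝓝 (a, x), ContDiffAt ℝ ∞ G z) :
    ∃ m : H → W, (∀ᶠ h in 𝓝 a, DifferentiableAt ℝ m h) ∧
      ∀ᶠ h in 𝓝 a, P (m h) fun x => G (h, x) := by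
  have hGn : ∀ x ∉ K, ∀ h, G =ᶠ[𝓝 (h, x)] 0 := fun x hx h => by
    have : ∀ᶠ z : H × Pt d in 𝓝 (h, x), z.2 ∈ Kᶜ :=
      continuous_snd.continuousAt (hK.isClosed.isOpen_compl.mem_nhds (show x ∈ Kᶜ from hx))
    exact this.mono fun z hz => hGK z.2 hz z.1
  have hGs : ∀ᶠ h in 𝓝 a, ∀ x, ContDiffAt ℝ ∞ G (h, x) :=
    IsCompact.eventually_forall_of_off hK (fun x _ => hG x) fun _ _ => .of_forall fun h x hx =>
      contDiffAt_const.congr_of_eventuallyEq (hGn x hx h)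
  have hsupp : ∀ f : Pt d → Pt d, (∀ x ∉ K, f x = 0) → HasCompactSupport f := fun f hf =>
    HasCompactSupport.intro hK hf
  have hmem : ∀ f : Pt d → Pt d, ContDiff ℝ 1 f → (∀ x ∉ K, f x = 0) → f ∈ compactC1 d :=
    fun f hf hf' => ⟨hf, HasCompactSupport.intro hK hf'⟩
  classical
  have hslice : ∀ h, (∀ x, ContDiffAt ℝ ∞ G (h, x)) → ContDiff ℝ 1 (fun x => G (h, x)) :=
    fun h hh => contDiff_iff_contDiffAt.2 fun x =>
      ((hh x).comp x (contDiffAt_const.prodMk contDiffAt_id)).of_le (by simp)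
  -- Where the slice is not known to be smooth, `m` takes the default value 0; this does not happen
  -- for parameters near `a`.
  obtain ⟨m, hm⟩ : ∃ m : H → W, ∀ h, (∀ x, ContDiffAt ℝ ∞ G (h, x)) →
      ∃ f : compactC1 d, f.1 = (fun x => G (h, x)) ∧ m h = ι f := by
    refine ⟨fun h => if hh : ∀ x, ContDiffAt ℝ ∞ G (h, x) then
      ι ⟨_, hmem _ (hslice h hh) fun x hx => hGK x hx h⟩ else 0,
      fun h hh => ⟨⟨_, hmem _ (hslice h hh) fun x hx => hGK x hx h⟩, rfl, dif_pos hh⟩⟩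
  refine ⟨m, ?_, hGs.mono fun h hh => ?_⟩
  swap
  · obtain ⟨f, hf, hmf⟩ := hm h hh
    rw [hmf, ← hf]
    exact hP f
  filter_upwards [eventually_eventually_nhds.2 hGs] with h₀ hev
  have h₀s := hev.self_of_nhds
  have hfd : ∀ x, ContDiffAt ℝ ∞ (fderiv ℝ G) (h₀, x) := fun x => (h₀s x).fderiv_right (by simp)
  have hl : ∀ k, (fun x => fderiv ℝ G (h₀, x) (k, 0)) ∈ compactC1 d := fun k => by
    refine hmem _ (contDiff_iff_contDiffAt.2 fun x => (((hfd x).comp x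
      (contDiffAt_const.prodMk contDiffAt_id)).clm_apply contDiffAt_const).of_le (by simp)) ?_
    intro x hx
    rw [(hGn x hx h₀).fderiv_eq]
    simp
  let l : H →ₗ[ℝ] compactC1 d :=
    { toFun := fun k => ⟨_, hl k⟩
      map_add' := fun k k' => by
        refine Subtype.ext (funext fun x => ?_)
        change _ = fderiv ℝ G (h₀, x) (k, 0) + fderiv ℝ G (h₀, x) (k', 0)
        rw [← map_add, Prod.mk_add_mk, add_zero]
      map_smul' := fun c k => by
        refine Subtype.ext (funext fun x => ?_)
        change _ = c • fderiv ℝ G (h₀, x) (k, 0)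
        rw [← map_smul, Prod.smul_mk, smul_zero] }
  -- The candidate derivative sends `k` to the field of derivatives in the direction `k`; it is
  -- continuous because `H` has finite dimension.
  obtain ⟨L, hL⟩ : ∃ L : H →L[ℝ] W, ∀ k, L k = ι (l k) :=
    ⟨LinearMap.toContinuousLinearMap (ι ∘ₗ l), fun k => rfl⟩
  refine HasFDerivAt.differentiableAt (f' := L) ?_
  rw [hasFDerivAt_iff_isLittleO, Asymptotics.isLittleO_iff]
  intro ε hε
  -- By the symmetry of second derivatives, the spatial derivative of the first order remainder of
  -- `G` is the first order remainder of its spatial derivative `G₂`. Uniform estimates for `G` and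
  -- `G₂` thus bound the remainder in the `C¹` norm.
  let G₂ : H × Pt d → Pt d →L[ℝ] Pt d := fun z =>
    (fderiv ℝ G z).comp (ContinuousLinearMap.inr ℝ H (Pt d))
  have hG₂ : ∀ x, ContDiffAt ℝ 1 G₂ (h₀, x) := fun x =>
    ((hfd x).clm_comp contDiffAt_const).of_le (by simp)
  have hG₂n : ∀ x ∉ K, ∀ h, G₂ =ᶠ[𝓝 (h, x)] 0 := fun x hx h => by
    filter_upwards [(hGn x hx h).eventuallyEq_nhds] with z hz
    simp only [G₂, hz.fderiv_eq]
    ext; simp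
  have e1 : ∀ᶠ h in 𝓝 h₀, ∀ x,
      ‖G (h, x) - G (h₀, x) - fderiv ℝ G (h₀, x) (h - h₀, 0)‖ ≤ ε * ‖h - h₀‖ :=
    IsCompact.eventually_forall_of_off hK
      (fun x _ => eventually_norm_sub_le_left ((h₀s x).of_le (by simp)) hε)
      fun _ _ => .of_forall fun h x hx => by
        rw [(hGn x hx h₀).fderiv_eq, hGK x hx, hGK x hx]
        simp; positivity
  have e2 : ∀ᶠ h in 𝓝 h₀, ∀ x,
      ‖G₂ (h, x) - G₂ (h₀, x) - fderiv ℝ G₂ (h₀, x) (h - h₀, 0)‖ ≤ ε * ‖h - h₀‖ :=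
    IsCompact.eventually_forall_of_off hK
      (fun x _ => eventually_norm_sub_le_left (hG₂ x) hε)
      fun _ _ => .of_forall fun h x hx => by
        rw [(hG₂n x hx h₀).fderiv_eq, (hG₂n x hx h₀).self_of_nhds, (hG₂n x hx h).self_of_nhds]
        simp; positivity
  filter_upwards [e1, e2, hev] with h e1 e2 hh
  obtain ⟨f, hf, hmf⟩ := hm h hh
  obtain ⟨f₀, hf₀, hmf₀⟩ := hm h₀ h₀s
  rw [hmf, hmf₀, hL, ← map_sub, ← map_sub]
  have hval : (f - f₀ - l (h - h₀)).1 =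
      fun x => G (h, x) - G (h₀, x) - fderiv ℝ G (h₀, x) (h - h₀, 0) := by
    change f.1 - f₀.1 - _ = _
    rw [hf, hf₀]
    rfl
  refine hι _ _ (by positivity) (by rwa [hval]) fun x => ?_
  rw [hval]
  have h1 : ∀ h, (∀ x, ContDiffAt ℝ ∞ G (h, x)) →
      HasFDerivAt (fun x => G (h, x)) (G₂ (h, x)) x := fun h hh =>
    ((hh x).differentiableAt (by simp)).hasFDerivAt.comp x (hasFDerivAt_prodMk_right h x)
  have h2 := ((h1 h hh).sub (h1 h₀ h₀s)).sub (fderiv_fderiv_left_comm (h₀s x) (h - h₀))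
  refine le_of_eq_of_le (congrArg norm h2.fderiv) (e2 x)

/-- A smooth family of vector fields, supported in the same compact set, is a differentiable family
in `W^{1,∞}`. -/
theorem exists_W1inf_family {G : H × Pt d → Pt d} {K : Set (Pt d)} (hK : IsCompact K)
    (hGK : ∀ x ∉ K, ∀ h, G (h, x) = 0) {a : H}
    (hG : ∀ x, ∀ᶠ z in 𝓝 (a, x), ContDiffAt ℝ ∞ G z) :
    ∃ m : H → W1inf d, (∀ᶠ h in 𝓝 a, DifferentiableAt ℝ m h) ∧
      ∀ᶠ h in 𝓝 a, IsContinuousRep (m h) fun x => G (h, x) :=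
  exists_differentiable_family compactC1.toW1inf
    (fun f _ => compactC1.norm_toW1inf_le f) compactC1.isContinuousRep_toW1inf hK hGK hG

end Family

end

/-! ### Bi-Lipschitz maps of diagrams and part (A) -/

section

variable {d N : ℕ} {D : Set (Pt d)} {p q : Params d N}

/-- The map `g` sends the diagram of parameters `p` onto that of parameters `q`. -/
structure IsDiagramMap (D : Set (Pt d)) (p q : Params d N) (g : Pt d → Pt d) : Prop where
  nonneg_left : ∀ i, 0 ≤ p.2 i
  nonneg_right : ∀ i, 0 ≤ q.2 i
  surjective : Function.Surjective g
  mem_iff : ∀ x, g x ∈ D ↔ x ∈ D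
  mem_frontier_iff : ∀ x, g x ∈ frontier D ↔ x ∈ frontier D
  active_eq : ∀ x ∈ closure D, active q 0 (g x) = active p 0 x
  lipschitz : ∃ C, LipschitzWith C g
  antilipschitz : ∃ C, AntilipschitzWith C g

namespace IsDiagramMap

variable {g : Pt d → Pt d}

theorem mem_closure_iff (h : IsDiagramMap D p q g) (x : Pt d) :
    g x ∈ closure D ↔ x ∈ closure D := by
  rw [closure_eq_self_union_frontier, mem_union, mem_union, h.mem_iff, h.mem_frontier_iff]

theorem mem_cell_iff (h : IsDiagramMap D p q g) (a : Option (Fin N)) (x : Pt d) :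
    g x ∈ cell D q.1 q.2 a ↔ x ∈ cell D p.1 p.2 a := by
  rw [ModLaguerre.mem_cell_iff h.nonneg_left, ModLaguerre.mem_cell_iff h.nonneg_right,
    h.mem_closure_iff]
  exact and_congr_right fun hx => by rw [h.active_eq x hx]

theorem mem_vertices_iff (h : IsDiagramMap D p q g) (x : Pt d) :
    g x ∈ vertices D q.1 q.2 ↔ x ∈ vertices D p.1 p.2 := by
  rw [ModLaguerre.mem_vertices_iff h.nonneg_left, ModLaguerre.mem_vertices_iff h.nonneg_right,
    h.mem_closure_iff, h.mem_frontier_iff]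
  exact and_congr_right fun hx => by rw [h.active_eq x hx]

theorem image_eq (h : IsDiagramMap D p q g) {S T : Set (Pt d)} (hST : ∀ x, g x ∈ T ↔ x ∈ S) :
    g '' S = T := by
  ext y
  obtain ⟨x, rfl⟩ := h.surjective y
  rw [hST]
  refine ⟨fun ⟨z, hz, hzx⟩ => ?_, fun hx => ⟨x, hx, rfl⟩⟩
  rwa [← hST, ← hzx, hST]

theorem image_modCell (h : IsDiagramMap D p q g) (i : Fin N) :
    g '' modCell D p.1 p.2 i = modCell D q.1 q.2 i :=
  h.image_eq (h.mem_cell_iff (some i))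

theorem image_vertices (h : IsDiagramMap D p q g) :
    g '' vertices D p.1 p.2 = vertices D q.1 q.2 :=
  h.image_eq h.mem_vertices_iff

/-- A bi-Lipschitz bijection preserves the null sets of the Hausdorff measure of each nonnegative
order, in both directions. -/
theorem neighbours_iff (hd : 1 ≤ d) (h : IsDiagramMap D p q g) (i j : Fin N) :
    Neighbours D q.1 q.2 i j ↔ Neighbours D p.1 p.2 i j := by
  have hd' : (0 : ℝ) ≤ (d : ℝ) - 1 := by
    have : (1 : ℝ) ≤ d := by exact_mod_cast hd
    linarith
  have him : g '' (modCell D p.1 p.2 i ∩ modCell D p.1 p.2 j) =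
      modCell D q.1 q.2 i ∩ modCell D q.1 q.2 j :=
    h.image_eq fun x => and_congr (h.mem_cell_iff (some i) x) (h.mem_cell_iff (some j) x)
  obtain ⟨C, hC⟩ := h.lipschitz
  obtain ⟨C', hC'⟩ := h.antilipschitz
  refine and_congr_right fun _ => ?_
  rw [← him, pos_iff_ne_zero, pos_iff_ne_zero]
  refine not_congr ⟨fun h0 => ?_, fun h0 => ?_⟩
  · have := hC'.le_hausdorffMeasure_image hd' (modCell D p.1 p.2 i ∩ modCell D p.1 p.2 j)
    simpa [h0] using this
  · have := hC.hausdorffMeasure_image_le hd' (modCell D p.1 p.2 i ∩ modCell D p.1 p.2 j)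
    simpa [h0] using this

end IsDiagramMap

/-- A preimage of `y` is a fixed point of the contraction `x ↦ y - u x`. The antilipschitz constant
is `2 = 1 / (1 - 1 / 2)`. -/
theorem isDiagramMap_of_lipschitzWith (hp : ∀ i, 0 ≤ p.2 i) (hq : ∀ i, 0 ≤ q.2 i)
    {u : Pt d → Pt d} (hu : LipschitzWith (1 / 2) u)
    (hD : ∀ x, (x + u x ∈ D ↔ x ∈ D) ∧ (x + u x ∈ frontier D ↔ x ∈ frontier D))
    (hA : ∀ x ∈ closure D, active q 0 (x + u x) = active p 0 x) :
    IsDiagramMap D p q fun x => x + u x := by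
  refine ⟨hp, hq, fun y => ?_, fun x => (hD x).1, fun x => (hD x).2, hA,
    ⟨_, LipschitzWith.id.add hu⟩, ⟨2, AntilipschitzWith.of_le_mul_dist fun x y => ?_⟩⟩
  · have hc : ContractingWith (1 / 2) fun x => y - u x :=
      ⟨by rw [← NNReal.coe_lt_coe]; norm_num, by simpa using (LipschitzWith.const y).sub hu⟩
    refine ⟨hc.fixedPoint, ?_⟩
    have : y - u hc.fixedPoint = hc.fixedPoint := hc.fixedPoint_isFixedPt
    rw [eq_comm, ← sub_eq_iff_eq_add]
    exact this
  · have h1 := hu.dist_le_mul x y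
    have h2 : x - y = (x + u x - (y + u y)) - (u x - u y) := by abel
    rw [dist_eq_norm] at h1
    have h3 : dist x y ≤ dist (x + u x) (y + u y) + ‖u x - u y‖ := by
      rw [dist_eq_norm, dist_eq_norm, h2]
      exact norm_sub_le _ _
    push_cast at h1 ⊢
    linarith

namespace IsDeformation

variable {K : Set (Pt d)} {u : Params d N × Pt d → Pt d}

theorem tendsto (h : IsDeformation D p K u) (x : Pt d) :
    Tendsto (fun z : Params d N × Pt d => z.2 + u z) (𝓝 (0, x)) (𝓝 x) := by
  have := (continuousAt_snd.add (h.contDiffAt x).self_of_nhds.continuousAt).tendsto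
  simp only [Pi.add_apply, h.eq_zero, add_zero] at this
  exact this

theorem eventually_eq_zero (h : IsDeformation D p K u) {x : Pt d} (hx : x ∉ K) (b : Params d N) :
    u =ᶠ[𝓝 (b, x)] 0 := by
  have : ∀ᶠ z : Params d N × Pt d in 𝓝 (b, x), z.2 ∈ Kᶜ := continuous_snd.continuousAt
    (h.isCompact.isClosed.isOpen_compl.mem_nhds (show x ∈ Kᶜ from hx))
  exact this.mono fun z hz => h.eq_zero_of_notMem z.2 hz z.1

theorem eventually_contDiffAt (h : IsDeformation D p K u) :
    ∀ᶠ b in 𝓝 (0 : Params d N), ∀ x, ContDiffAt ℝ ∞ u (b, x) :=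
  IsCompact.eventually_forall_of_off h.isCompact (fun x _ => h.contDiffAt x)
    fun _ _ => .of_forall fun b _ hx =>
      contDiffAt_const.congr_of_eventuallyEq (h.eventually_eq_zero hx b)

/-- The spatial derivative of `u` vanishes for the zero perturbation, and by continuity and
compactness it stays below 1/2 everywhere for small ones. -/
theorem eventually_lipschitzWith (h : IsDeformation D p K u) :
    ∀ᶠ b in 𝓝 (0 : Params d N), LipschitzWith (1 / 2) fun x => u (b, x) := by
  let F : Params d N × Pt d → Pt d →L[ℝ] Pt d := fun z =>
    (fderiv ℝ u z).comp (ContinuousLinearMap.inr ℝ (Params d N) (Pt d))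
  have hF : ∀ b x, ContDiffAt ℝ ∞ u (b, x) → HasFDerivAt (fun x => u (b, x)) (F (b, x)) x :=
    fun b x hb => (hb.differentiableAt (by simp)).hasFDerivAt.comp x (hasFDerivAt_prodMk_right b x)
  have hF0 : ∀ x, F (0, x) = 0 := fun x => by
    refine (hF 0 x (h.contDiffAt x).self_of_nhds).unique ?_
    simp only [h.eq_zero]
    exact hasFDerivAt_const _ _
  have hFc : ∀ x, ContinuousAt F (0, x) := fun x => by
    have : ContDiffAt ℝ 0 (fderiv ℝ u) (0, x) :=
      (h.contDiffAt x).self_of_nhds.fderiv_right (by simp)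
    exact this.continuousAt.clm_comp continuousAt_const
  have hFb : ∀ᶠ b in 𝓝 (0 : Params d N), ∀ x, ‖F (b, x)‖ < 1 / 2 := by
    refine IsCompact.eventually_forall_of_off h.isCompact (fun x _ => ?_)
      fun _ _ => .of_forall fun b x hx => ?_
    · exact (hFc x).norm.eventually_lt continuousAt_const (by simp [hF0])
    · simp only [F, (h.eventually_eq_zero hx b).fderiv_eq]
      simp
  filter_upwards [hFb, h.eventually_contDiffAt] with b h1 h2
  refine lipschitzWith_of_nnnorm_fderiv_le (𝕜 := ℝ)
    (fun x => (hF b x (h2 x)).differentiableAt) fun x => ?_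
  rw [(hF b x (h2 x)).fderiv, ← NNReal.coe_le_coe]
  simpa using (h1 x).le

theorem eventually_isDiagramMap (h : IsDeformation D p K u) (hb : Bornology.IsBounded D)
    (hp : ∀ i, 0 < p.2 i) :
    ∀ᶠ b in 𝓝 (0 : Params d N), IsDiagramMap D p (p + b) fun x => x + u (b, x) := by
  have h1 : ∀ᶠ b in 𝓝 (0 : Params d N), ∀ x, (x + u (b, x) ∈ D ↔ x ∈ D) ∧
      (x + u (b, x) ∈ frontier D ↔ x ∈ frontier D) :=
    IsCompact.eventually_forall_of_off h.isCompact (fun x _ => h.mem_iff x)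
      fun _ _ => .of_forall fun b x hx => by simp [h.eq_zero_of_notMem x hx b]
  have h2 := hb.isCompact_closure.eventually_forall_of_forall_eventually (x₀ := (0 : Params d N))
    (P := fun b x => x ∈ closure D → active (p + b) 0 (x + u (b, x)) = active p 0 x)
    fun x hx => h.active_eq x hx
  have h3 : ∀ᶠ b in 𝓝 (0 : Params d N), ∀ i, 0 < (p + b).2 i := by
    rw [eventually_all]
    intro i
    have : Continuous fun b : Params d N => (p + b).2 i := by
      simp only [Prod.snd_add, Pi.add_apply]; fun_prop
    exact continuousAt_const.eventually_lt this.continuousAt (by simpa using hp i)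
  filter_upwards [h1, h2, h3, h.eventually_lipschitzWith] with b h1 h2 h3 h4
  exact isDiagramMap_of_lipschitzWith (fun i => (hp i).le) (fun i => (h3 i).le) h4 h1
    fun x hx => h2 x hx hx

/-- The identity is unbounded, so `x ↦ x + u (b, x)` is not in `W1inf`. Cutting off the identity
outside a ball that contains `closure D` does not change the map on the diagram. -/
theorem exists_W1inf (h : IsDeformation D p K u) (hb : Bornology.IsBounded D) :
    ∃ m : Params d N → W1inf d, (∀ᶠ b in 𝓝 0, DifferentiableAt ℝ m b) ∧
      ∀ᶠ b in 𝓝 0, ∃ g : Pt d → Pt d, IsContinuousRep (m b) g ∧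
        ∀ x ∈ closure D, g x = x + u (b, x) := by
  obtain ⟨R, hR, hDR⟩ := hb.closure.subset_closedBall_lt 0 (0 : Pt d)
  let θ : ContDiffBump (0 : Pt d) := ⟨R, R + 1, hR, by linarith⟩
  have hθ : ContDiff ℝ ∞ θ := θ.contDiff
  obtain ⟨m, hm, hm'⟩ := exists_W1inf_family (a := (0 : Params d N))
    (G := fun z => θ z.2 • z.2 + u z) (h.isCompact.union (isCompact_closedBall 0 (R + 1)))
    (fun x hx b => by
      rw [mem_union, not_or] at hx
      have : θ x = 0 := θ.zero_of_le_dist (not_le.1 hx.2).le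
      simp [h.eq_zero_of_notMem x hx.1, this])
    (fun x => (h.contDiffAt x).mono fun z hz =>
      ((hθ.comp contDiff_snd).smul contDiff_snd).contDiffAt.add hz)
  refine ⟨m, hm, hm'.mono fun b hb => ⟨_, hb, fun x hx => ?_⟩⟩
  have : θ x = 1 := θ.one_of_mem_closedBall (hDR hx)
  simp [this]

end IsDeformation

theorem modCell_subset_closure (D : Set (Pt d)) (s : Fin N → Pt d) (ψ : Fin N → ℝ) (i : Fin N) :
    modCell D s ψ i ⊆ closure D := fun _ hx => hx.1.1

theorem vertices_subset_closure (hp : ∀ i, 0 ≤ p.2 i) : vertices D p.1 p.2 ⊆ closure D :=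
  fun _ hx => ((mem_vertices_iff hp).1 hx).1

theorem Generic.exists_deformation (hd : 2 ≤ d) (hD : IsOpen D) (hb : Bornology.IsBounded D)
    (s : Fin N → Pt d) (ψ : Fin N → ℝ) (hG : Generic D s ψ) :
    (∀ᶠ h : Params d N in 𝓝 0, ∀ i j,
      Neighbours D (s + h.1) (ψ + h.2) i j ↔ Neighbours D s ψ i j) ∧
    ∃ m : Params d N → W1inf d,
      (∀ᶠ h in 𝓝 0, DifferentiableAt ℝ m h) ∧
      ∀ᶠ h in 𝓝 0, ∃ g : Pt d → Pt d, IsContinuousRep (m h) g ∧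
        (∀ i, g '' modCell D s ψ i = modCell D (s + h.1) (ψ + h.2) i) ∧
        g '' vertices D s ψ = vertices D (s + h.1) (ψ + h.2) := by
  obtain ⟨K, u, h⟩ := Generic.exists_isDeformation (p := (s, ψ)) hd hD hb hG
  have hmap := h.eventually_isDiagramMap hb (hG.weight_pos hd)
  refine ⟨hmap.mono fun b hb i j => hb.neighbours_iff (by omega) i j, ?_⟩
  obtain ⟨m, hm, hm'⟩ := h.exists_W1inf hb
  refine ⟨m, hm, ?_⟩
  filter_upwards [hmap, hm'] with b h1 ⟨g, hg, hgD⟩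
  refine ⟨g, hg, fun i => ?_, ?_⟩
  · exact (image_congr fun x hx => hgD x (modCell_subset_closure D s ψ i hx)).trans
      (h1.image_modCell i)
  · exact (image_congr fun x hx => hgD x (vertices_subset_closure (p := (s, ψ)) h1.nonneg_left
      hx)).trans h1.image_vertices

end

/-! ### Plane geometry: vertices are isolated and finite in number -/

section

section Plane

theorem inner_eq_plane (u v : Pt 2) : ⟪u, v⟫ = u 0 * v 0 + u 1 * v 1 := by
  rw [PiLp.inner_apply, Fin.sum_univ_two]
  simp [mul_comm]

theorem det_rows (u v : Pt 2) : (rows u v).det = u 0 * v 1 - u 1 * v 0 := by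
  rw [rows, Matrix.det_fin_two_of]

theorem det_rows_sq (u v : Pt 2) : (rows u v).det ^ 2 = gram u v := by
  rw [gram, ← real_inner_self_eq_norm_sq, ← real_inner_self_eq_norm_sq, inner_eq_plane,
    inner_eq_plane, inner_eq_plane, det_rows]
  ring

theorem det_rows_ne_zero {u v : Pt 2} (h : gram u v ≠ 0) : (rows u v).det ≠ 0 := by
  intro h0
  rw [← det_rows_sq, h0] at h
  simp at h

/-- Two independent linear forms on the plane separate points. -/
theorem eq_zero_of_inner_eq_zero {u v z : Pt 2} (h : gram u v ≠ 0) (hu : ⟪u, z⟫ = 0)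
    (hv : ⟪v, z⟫ = 0) : z = 0 := by
  have hd := det_rows_ne_zero h
  rw [det_rows] at hd
  rw [inner_eq_plane] at hu hv
  have h0 : z 0 = 0 := (mul_eq_zero.1 (show (u 0 * v 1 - u 1 * v 0) * z 0 = 0 by
    linear_combination v 1 * hu - u 1 * hv)).resolve_left hd
  have h1 : z 1 = 0 := (mul_eq_zero.1 (show (u 0 * v 1 - u 1 * v 0) * z 1 = 0 by
    linear_combination u 0 * hv - v 0 * hu)).resolve_left hd
  ext i
  fin_cases i
  · exact h0
  · exact h1

/-- The common zeros of two functions with independent gradients are isolated. -/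
theorem eventually_eq_of_gram_ne_zero {f₁ f₂ : Pt 2 → ℝ} {g₁ g₂ q : Pt 2}
    (h₁ : HasFDerivAt f₁ (innerSL ℝ g₁) q) (h₂ : HasFDerivAt f₂ (innerSL ℝ g₂) q)
    (h : gram g₁ g₂ ≠ 0) : ∀ᶠ x in 𝓝 q, f₁ x = 0 → f₂ x = 0 → x = q := by
  have hinj : LinearMap.ker (((innerSL ℝ g₁).prod (innerSL ℝ g₂) : Pt 2 →L[ℝ] ℝ × ℝ) :
      Pt 2 →ₗ[ℝ] ℝ × ℝ) = ⊥ := by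
    rw [LinearMap.ker_eq_bot']
    intro z hz
    have h1 : ⟪g₁, z⟫ = 0 := congrArg Prod.fst hz
    have h2 : ⟪g₂, z⟫ = 0 := congrArg Prod.snd hz
    exact eq_zero_of_inner_eq_zero h h1 h2
  obtain ⟨C, -, hC⟩ := LinearMap.exists_antilipschitzWith _ hinj
  have := (h₁.prodMk h₂).eventually_ne (c := (0, 0)) ⟨C, hC⟩
  rw [eventually_nhdsWithin_iff] at this
  filter_upwards [this] with x hx hx1 hx2
  by_contra hne
  exact hx hne (Prod.ext hx1 hx2)

end Plane

theorem ncard_pair_le {α : Type*} (a b : α) : ({a, b} : Set α).ncard ≤ 2 :=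
  (ncard_insert_le a {b}).trans (by rw [ncard_singleton])

variable {N : ℕ} {D : Set (Pt 2)} {p : Params 2 N} {φ : Pt 2 → ℝ}

/-- At a vertex, the two equations of which it is the solution. -/
theorem IsRegularAt.of_mem_vertices {d : ℕ} {D : Set (Pt d)} {p : Params d N} {φ : Pt d → ℝ}
    {q : Pt d} (hp : ∀ i, 0 ≤ p.2 i) (h : IsRegularAt D p φ q) (hq : q ∈ vertices D p.1 p.2) :
    (q ∈ frontier D ∧ ∃ a b, active p 0 q = {a, b} ∧
      gram (powerGrad p a q - powerGrad p b q) (gradient φ q) ≠ 0) ∨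
    (q ∉ frontier D ∧ ∃ a b c, active p 0 q = {a, b, c} ∧
      gram (powerGrad p a q - powerGrad p c q) (powerGrad p b q - powerGrad p c q) ≠ 0) := by
  have hq' := ((mem_vertices_iff hp).1 hq).2
  rcases h with h | h | ⟨hf, a, b, hA, -⟩ | h
  · have := ncard_le_one_iff_subsingleton.2 h
    omega
  · exact Or.inl h
  · have : (active p 0 q).ncard ≤ 2 := hA ▸ ncard_pair_le a b
    rcases hq' with h | h
    · omega
    · exact absurd h.1 hf
  · exact Or.inr h

theorem hasFDerivAt_power_sub (a b : Option (Fin N)) (q : Pt 2) :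
    HasFDerivAt (fun x => power p a x - power p b x)
      (innerSL ℝ (powerGrad p a q - powerGrad p b q)) q := by
  rw [map_sub]
  exact (hasFDerivAt_power p a q).sub (hasFDerivAt_power p b q)

/-- Active sets can only shrink near `q`. A nearby vertex is either excluded by counting, or has the
same active set as `q`; it then solves the same two equations with independent gradients, of which
`q` is an isolated solution. -/
theorem Generic.eventually_vertex_eq (hG : Generic D p.1 p.2) (hφ : ContDiff ℝ ∞ φ)
    (hφv : ∀ q ∈ vertices D p.1 p.2, q ∈ frontier D → IsLevelSetAt D q φ) {q : Pt 2}
    (hq : q ∈ closure D) : ∀ᶠ x in 𝓝 q, x ∈ vertices D p.1 p.2 → x = q := by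
  have hp : ∀ i, 0 ≤ p.2 i := fun i => (hG.weight_pos le_rfl i).le
  have hsub : ∀ᶠ x in 𝓝 q, active p 0 x ⊆ active p 0 q :=
    ((Continuous.prodMk_right (0 : ℝ)).tendsto q).eventually (eventually_active_subset_point 0 p q)
  have heq : ∀ {x} {a b : Option (Fin N)}, active p 0 x = active p 0 q → a ∈ active p 0 q →
      b ∈ active p 0 q → power p a x - power p b x = 0 := fun hx ha hb => by
    rw [← hx] at ha hb
    exact sub_eq_zero.2 (power_eq_of_mem_active ha hb)
  rcases hG.isRegularAt le_rfl hφv hq with h | ⟨hf, a, b, hA, hgr⟩ | ⟨hf, a, b, hA, hgr⟩ |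
    ⟨hf, a, b, c, hA, hgr⟩
  · filter_upwards [hsub] with x hx hv
    have h1 := ncard_le_one_iff_subsingleton.2 (h.anti hx)
    have h2 := ((mem_vertices_iff hp).1 hv).2
    omega
  · have hn : (active p 0 q).ncard ≤ 2 := hA ▸ ncard_pair_le a b
    by_cases hab : a = b
    · simp [hab, gram] at hgr
    have hv : q ∈ vertices D p.1 p.2 := (mem_vertices_iff hp).2
      ⟨hq, Or.inr ⟨hf, by rw [hA, ncard_pair hab]⟩⟩
    have hφq := hφv q hv hf
    have hd := eventually_eq_of_gram_ne_zero (hasFDerivAt_power_sub a b q)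
      (hφ.differentiable (by simp) q).hasGradientAt.hasFDerivAt hgr
    filter_upwards [hsub, hd, hφq.2.2] with x h1 h2 h3 hx
    have h4 := ((mem_vertices_iff hp).1 hx).2
    have h5 := ncard_le_ncard h1
    have h6 : active p 0 x = active p 0 q := eq_of_subset_of_ncard_le h1 (by omega)
    refine h2 (heq h6 (by simp [hA]) (by simp [hA])) (h3.2.1 ?_)
    rcases h4 with h4 | h4
    · omega
    · exact h4.1
  · have hn : (active p 0 q).ncard ≤ 2 := hA ▸ ncard_pair_le a b
    filter_upwards [hsub, isClosed_frontier.isOpen_compl.mem_nhds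
      (show q ∈ (frontier D)ᶜ from hf)] with x h1 h2 hx
    have h5 := ncard_le_ncard h1
    rcases ((mem_vertices_iff hp).1 hx).2 with h4 | h4
    · omega
    · exact absurd h4.1 h2
  · have hn : (active p 0 q).ncard ≤ 3 := by
      rw [hA]
      exact (ncard_insert_le _ _).trans (Nat.succ_le_succ (ncard_pair_le b c))
    have hd := eventually_eq_of_gram_ne_zero (hasFDerivAt_power_sub a c q)
      (hasFDerivAt_power_sub b c q) hgr
    filter_upwards [hsub, hd, isClosed_frontier.isOpen_compl.mem_nhds
      (show q ∈ (frontier D)ᶜ from hf)] with x h1 h2 h3 hx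
    have h5 := ncard_le_ncard h1
    have h6 : 3 ≤ (active p 0 x).ncard := by
      rcases ((mem_vertices_iff hp).1 hx).2 with h4 | h4
      · exact h4
      · exact absurd h4.1 h3
    have h7 : active p 0 x = active p 0 q := eq_of_subset_of_ncard_le h1 (by omega)
    exact h2 (heq h7 (by simp [hA]) (by simp [hA])) (heq h7 (by simp [hA]) (by simp [hA]))

theorem Generic.finite_vertices (hG : Generic D p.1 p.2) (hb : Bornology.IsBounded D)
    (hφ : ContDiff ℝ ∞ φ)
    (hφv : ∀ q ∈ vertices D p.1 p.2, q ∈ frontier D → IsLevelSetAt D q φ) :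
    (vertices D p.1 p.2).Finite := by
  have hp : ∀ i, 0 ≤ p.2 i := fun i => (hG.weight_pos le_rfl i).le
  obtain ⟨t, -, ht⟩ := hb.isCompact_closure.elim_nhds_subcover
    (fun q => {x | x ∈ vertices D p.1 p.2 → x = q}) fun q hq => hG.eventually_vertex_eq hφ hφv hq
  refine t.finite_toSet.subset fun x hx => ?_
  obtain ⟨q, hq, hxq⟩ := mem_iUnion₂.1 (ht (vertices_subset_closure hp hx))
  have : x = q := hxq hx
  rwa [this]

end

/-! ### Derivatives of points that stay at equal powers -/

section

variable {N : ℕ} {D : Set (Pt 2)} {p p₀ : Params 2 N} {φ : Pt 2 → ℝ} {Q : Params 2 N → Pt 2}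

theorem gram_sub_left {E : Type*} [NormedAddCommGroup E] [InnerProductSpace ℝ E] (u v : E) :
    gram (u - v) u = gram u v := by
  rw [gram, gram, norm_sub_sq_real, inner_sub_left, real_inner_self_eq_norm_sq,
    real_inner_comm u v]
  ring

/-- The opposite of the derivative of `power p a x` with respect to `p`. -/
def paramVar (p : Params 2 N) (x : Pt 2) (k : Params 2 N) : Option (Fin N) → ℝ
  | none => 0
  | some i => ⟪powerGrad p (some i) x, k.1 i⟫ + k.2 i

theorem fderiv_power_comp (hQ : DifferentiableAt ℝ Q p) (a : Option (Fin N)) (k : Params 2 N) :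
    fderiv ℝ (fun p' => power p' a (Q p')) p k =
      ⟪powerGrad p a (Q p), fderiv ℝ Q p k⟫ - paramVar p (Q p) k a := by
  rcases a with _ | i
  · simp [power, powerGrad, paramVar]
  · have h1 : HasFDerivAt (fun p' : Params 2 N => p'.1 i) _ p :=
      (hasFDerivAt_apply (𝕜 := ℝ) i p.1).comp p hasFDerivAt_fst
    have h2 : HasFDerivAt (fun p' : Params 2 N => p'.2 i) _ p :=
      (hasFDerivAt_apply (𝕜 := ℝ) i p.2).comp p hasFDerivAt_snd
    have h4 : fderiv ℝ (fun p' => power p' (some i) (Q p')) p = _ :=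
      (((hQ.hasFDerivAt.sub h1).norm_sq).sub h2).fderiv
    rw [h4]
    simp only [powerGrad, paramVar, _root_.sub_apply, smul_apply, ContinuousLinearMap.comp_apply,
      innerSL_apply_apply, inner_smul_left, ContinuousLinearMap.proj_apply,
      ContinuousLinearMap.coe_fst', ContinuousLinearMap.coe_snd', inner_sub_right]
    simp
    ring

/-- Near `p`, the point `Q p` stays at equal powers from the cells with indices in `A` and, if the
proposition `F` holds, on the boundary of `D`. -/
structure IsTracking (D : Set (Pt 2)) (φ : Pt 2 → ℝ) (A : Set (Option (Fin N))) (F : Prop)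
    (Q : Params 2 N → Pt 2) (p : Params 2 N) : Prop where
  differentiableAt : DifferentiableAt ℝ Q p
  power_eq : ∀ a ∈ A, ∀ b ∈ A, ∀ᶠ p' in 𝓝 p, power p' a (Q p') = power p' b (Q p')
  isUnitNormalAt : F → IsUnitNormalAt D (Q p) (‖gradient φ (Q p)‖⁻¹ • gradient φ (Q p))
  level_eq : F → ∀ᶠ p' in 𝓝 p, φ (Q p') = 0

/-- The differential of `Q` with respect to `s_i` and `ψ_i` solves a linear equation. -/
structure SolvesRow (Q : Params 2 N → Pt 2) (p : Params 2 N) (i : Fin N) (u x : Pt 2) (c : ℝ) :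
    Prop where
  seed : ∀ k, ⟪u, fderiv ℝ Q p (Pi.single i k, 0)⟫ = ⟪x, k⟫
  weight : ⟪u, fderiv ℝ Q p (0, Pi.single i 1)⟫ = c

namespace SolvesRow

variable {i : Fin N} {u v x y : Pt 2} {c c' : ℝ}

theorem rows_eq (h : SolvesRow Q p i u x c) (h' : SolvesRow Q p i v y c') :
    rows u v * seedJacobian Q p i = rows x y ∧ rows u v *ᵥ weightDeriv Q p i = ![c, c'] := by
  have key : ∀ (w : Pt 2) b, w b = ⟪w, EuclideanSpace.single b (1 : ℝ)⟫ := fun w b => by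
    rw [EuclideanSpace.inner_single_right]
    simp
  constructor
  · ext a b
    have h1 := (h.seed (EuclideanSpace.single b 1)).trans (key x b).symm
    have h2 := (h'.seed (EuclideanSpace.single b 1)).trans (key y b).symm
    rw [inner_eq_plane] at h1 h2
    rw [Matrix.mul_apply, Fin.sum_univ_two]
    fin_cases a
    · simpa [rows, seedJacobian, Matrix.of_apply] using h1.trans (by fin_cases b <;> rfl)
    · simpa [rows, seedJacobian] using h2.trans (by fin_cases b <;> rfl)
  · have h1 := h.weight
    have h2 := h'.weight
    rw [inner_eq_plane] at h1 h2
    ext a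
    rw [Matrix.mulVec, dotProduct, Fin.sum_univ_two]
    fin_cases a
    · simpa [rows, weightDeriv] using h1
    · simpa [rows, weightDeriv] using h2

theorem derivatives_eq_zero (h : SolvesRow Q p i u 0 0) (h' : SolvesRow Q p i v 0 0)
    (hg : gram u v ≠ 0) : seedJacobian Q p i = 0 ∧ weightDeriv Q p i = 0 := by
  have h1 : ∀ k, fderiv ℝ Q p (Pi.single i k, 0) = 0 := fun k =>
    eq_zero_of_inner_eq_zero hg ((h.seed k).trans (by simp)) ((h'.seed k).trans (by simp))
  have h2 : fderiv ℝ Q p (0, Pi.single i 1) = 0 := eq_zero_of_inner_eq_zero hg h.weight h'.weight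
  constructor
  · ext a b
    simp [seedJacobian, h1]
  · ext a
    simp [weightDeriv, h2]

end SolvesRow

namespace IsTracking

variable {A : Set (Option (Fin N))} {F : Prop} {i : Fin N} {a b : Option (Fin N)}

/-- Differentiate the identity between the powers of indices `a` and `b` at `Q p`: the motion of the
point balances the explicit dependence on the parameters. -/
theorem inner_fderiv (h : IsTracking D φ A F Q p) (ha : a ∈ A) (hb : b ∈ A) (k : Params 2 N) :
    ⟪powerGrad p a (Q p) - powerGrad p b (Q p), fderiv ℝ Q p k⟫ =
      paramVar p (Q p) k a - paramVar p (Q p) k b := by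
  have h1 := fderiv_power_comp h.differentiableAt a
  have h2 := fderiv_power_comp h.differentiableAt b
  have h3 := (EventuallyEq.fderiv_eq (𝕜 := ℝ) (h.power_eq a ha b hb))
  have h4 := h1 k
  rw [h3, h2 k] at h4
  rw [inner_sub_left]
  linarith

/-- Only the power of index `i` depends explicitly on the varied parameters. Dividing the
differentiated identity by the factor 2 of the gradients leaves `Q p - s_i` for the seed and 1/2 for
the weight. -/
theorem solvesRow (h : IsTracking D φ A F Q p) (hi : some i ∈ A) (hb : b ∈ A) (hib : b ≠ some i)
    {u : Pt 2} (hu : powerGrad p (some i) (Q p) - powerGrad p b (Q p) = (2 : ℝ) • u) :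
    SolvesRow Q p i u (Q p - p.1 i) (1 / 2) := by
  have h1 := h.inner_fderiv hi hb
  have hb0 : ∀ k : Params 2 N, (∀ j ≠ i, k.1 j = 0 ∧ k.2 j = 0) → paramVar p (Q p) k b = 0 := by
    intro k hk
    rcases b with _ | j
    · rfl
    · obtain ⟨h2, h3⟩ := hk j fun hj => hib (by rw [hj])
      simp [paramVar, h2, h3]
  simp only [hu, inner_smul_left] at h1
  constructor
  · intro k
    have h2 := h1 (Pi.single i k, 0)
    rw [hb0 _ fun j hj => ⟨by simp [hj], rfl⟩] at h2
    simp only [paramVar, powerGrad, inner_smul_left, Pi.single_eq_same] at h2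
    simpa using h2
  · have h2 := h1 (0, Pi.single i 1)
    rw [hb0 _ fun j hj => ⟨rfl, by simp [hj]⟩] at h2
    simp only [paramVar, Pi.single_eq_same] at h2
    simp at h2
    linarith

theorem solvesRow_zero (h : IsTracking D φ A F Q p) (hi : some i ∉ A) (ha : a ∈ A) (hb : b ∈ A) :
    SolvesRow Q p i (powerGrad p a (Q p) - powerGrad p b (Q p)) 0 0 := by
  have hb0 : ∀ b ∈ A, ∀ k : Params 2 N, (∀ j ≠ i, k.1 j = 0 ∧ k.2 j = 0) →
      paramVar p (Q p) k b = 0 := by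
    intro b hb k hk
    rcases b with _ | j
    · rfl
    · obtain ⟨h2, h3⟩ := hk j fun hj => hi (by rwa [← hj])
      simp [paramVar, h2, h3]
  constructor
  · intro k
    rw [h.inner_fderiv ha hb, hb0 a ha _ fun j hj => ⟨by simp [hj], rfl⟩,
      hb0 b hb _ fun j hj => ⟨by simp [hj], rfl⟩]
    simp
  · rw [h.inner_fderiv ha hb, hb0 a ha _ fun j hj => ⟨rfl, by simp [hj]⟩,
      hb0 b hb _ fun j hj => ⟨rfl, by simp [hj]⟩, sub_zero]

/-- Since `φ (Q p)` is constantly zero, the derivative of `Q` is tangent to the boundary, which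
gives the zero right-hand side. The scalar `c` allows for the normalization of the normal. -/
theorem solvesRow_gradient (h : IsTracking D φ A F Q p) (hφ : ContDiff ℝ ∞ φ) (hF : F) (i : Fin N)
    (c : ℝ) : SolvesRow Q p i (c • gradient φ (Q p)) 0 0 := by
  have h1 : HasFDerivAt (fun p' => φ (Q p'))
      ((innerSL ℝ (gradient φ (Q p))).comp (fderiv ℝ Q p)) p :=
    (hφ.differentiable (by simp) (Q p)).hasGradientAt.hasFDerivAt.comp p
      h.differentiableAt.hasFDerivAt
  have h2 : HasFDerivAt (fun p' => φ (Q p')) (0 : Params 2 N →L[ℝ] ℝ) p :=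
    (hasFDerivAt_const (0 : ℝ) p).congr_of_eventuallyEq (h.level_eq hF)
  have h3 : ∀ k, ⟪gradient φ (Q p), fderiv ℝ Q p k⟫ = 0 := fun k =>
    congrArg (fun L : Params 2 N →L[ℝ] ℝ => L k) (h1.unique h2)
  constructor
  · intro k
    rw [inner_smul_left, h3]
    simp
  · rw [inner_smul_left, h3]
    simp

end IsTracking

end

/-! ### Following points along the deformation -/

section

section

variable {d N : ℕ} {D : Set (Pt d)} {p₀ : Params d N} {K : Set (Pt d)}
  {u : Params d N × Pt d → Pt d}

/-- The point that corresponds to `x` in the diagram of parameters `p`. -/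
def follow (u : Params d N × Pt d → Pt d) (p₀ : Params d N) (x : Pt d) (p : Params d N) : Pt d :=
  x + u (p - p₀, x)

theorem tendsto_sub_self (p₀ : Params d N) : Tendsto (fun p => p - p₀) (𝓝 p₀) (𝓝 0) :=
  Continuous.tendsto' (by fun_prop) _ _ (sub_self p₀)

namespace IsDeformation

theorem follow_self (h : IsDeformation D p₀ K u) (x : Pt d) : follow u p₀ x p₀ = x := by
  simp [follow, h.eq_zero]

theorem tendsto_follow (h : IsDeformation D p₀ K u) {α : Type*} {l : Filter α}
    {f : α → Params d N} {y : α → Pt d} {x : Pt d} (hf : Tendsto f l (𝓝 p₀))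
    (hy : Tendsto y l (𝓝 x)) : Tendsto (fun a => follow u p₀ (y a) (f a)) l (𝓝 x) :=
  (h.tendsto x).comp (((tendsto_sub_self p₀).comp hf).prodMk_nhds hy)

theorem eventually_isDiagramMap_follow (h : IsDeformation D p₀ K u) (hb : Bornology.IsBounded D)
    (hp : ∀ i, 0 < p₀.2 i) :
    ∀ᶠ p in 𝓝 p₀, IsDiagramMap D p₀ p fun x => follow u p₀ x p := by
  filter_upwards [(tendsto_sub_self p₀).eventually (h.eventually_isDiagramMap hb hp)] with p h1
  rwa [add_sub_cancel] at h1

theorem eventually_contDiffAt_follow (h : IsDeformation D p₀ K u) :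
    ∀ᶠ p in 𝓝 p₀, ∀ x, ContDiffAt ℝ ∞ (follow u p₀ x) p := by
  filter_upwards [(tendsto_sub_self p₀).eventually h.eventually_contDiffAt] with p h1 x
  have h2 : ContDiffAt ℝ ∞ (fun p : Params d N => (p - p₀, x)) p := by fun_prop
  exact contDiffAt_const.add ((h1 x).comp p h2)

/-- The vertices of a perturbed diagram that are close to `q` come from `q`. -/
theorem eventually_eq_follow (h : IsDeformation D p₀ K u) (hb : Bornology.IsBounded D)
    (hp : ∀ i, 0 < p₀.2 i) (hfin : (vertices D p₀.1 p₀.2).Finite) (q : Pt d) :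
    ∀ᶠ z : Params d N × Pt d in 𝓝 (p₀, q), z.2 ∈ vertices D z.1.1 z.1.2 →
      z.2 = follow u p₀ q z.1 := by
  -- Every perturbed vertex follows some original vertex; the finitely many vertices other than `q`
  -- are followed by points that stay away from `q`.
  have h1 : ∀ᶠ z : Params d N × Pt d in 𝓝 (p₀, q), ∀ x ∈ vertices D p₀.1 p₀.2,
      x ≠ q → z.2 ≠ follow u p₀ x z.1 := by
    refine hfin.eventually_all.2 fun x _ => ?_
    by_cases hx : x = q
    · exact .of_forall fun _ h => absurd hx h
    have h2 : Tendsto (fun z : Params d N × Pt d => follow u p₀ x z.1) (𝓝 (p₀, q)) (𝓝 x) :=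
      h.tendsto_follow (continuous_fst.tendsto _) tendsto_const_nhds
    have h3 : Tendsto (fun z : Params d N × Pt d => z.2) (𝓝 (p₀, q)) (𝓝 q) :=
      continuous_snd.tendsto _
    exact ((h3.sub h2).eventually_ne (sub_ne_zero.2 (Ne.symm hx))).mono fun _ h _ => sub_ne_zero.1 h
  have h2 := (continuous_fst.tendsto (p₀, q)).eventually (h.eventually_isDiagramMap_follow hb hp)
  filter_upwards [h1, h2] with z h1 h2 hz
  obtain ⟨x, hx⟩ := h2.surjective z.2
  simp only at hx
  rw [← hx, h2.mem_vertices_iff] at hz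
  by_contra hne
  refine h1 x hz (fun hxq => hne ?_) hx.symm
  rw [← hx, hxq]

end IsDeformation

end

section

variable {N : ℕ} {D : Set (Pt 2)} {p₀ : Params 2 N} {K : Set (Pt 2)}
  {u : Params 2 N × Pt 2 → Pt 2} {φ : Pt 2 → ℝ} {q : Pt 2}

theorem IsLevelSetAt.eventually {d : ℕ} {D : Set (Pt d)} {φ : Pt d → ℝ} {q : Pt d}
    (h : IsLevelSetAt D q φ) : ∀ᶠ x in 𝓝 q, IsLevelSetAt D x φ := by
  have h1 : ∀ᶠ x in 𝓝 q, gradient φ x ≠ 0 :=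
    (contDiff_gradient h.1).continuous.continuousAt.eventually_ne h.2.1
  filter_upwards [h1, eventually_eventually_nhds.2 h.2.2] with x h2 h3
  exact ⟨h.1, h2, h3⟩

theorem IsDeformation.eventually_isTracking (h : IsDeformation D p₀ K u)
    (hb : Bornology.IsBounded D) (hp : ∀ i, 0 < p₀.2 i)
    (hφv : q ∈ frontier D → IsLevelSetAt D q φ) (hq : q ∈ closure D) :
    ∀ᶠ p in 𝓝 p₀, IsTracking D φ (active p₀ 0 q) (q ∈ frontier D) (follow u p₀ q) p := by
  have h1 := h.eventually_isDiagramMap_follow hb hp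
  have ht : Tendsto (follow u p₀ q) (𝓝 p₀) (𝓝 q) :=
    h.tendsto_follow tendsto_id tendsto_const_nhds
  have h2 : q ∈ frontier D → ∀ᶠ p in 𝓝 p₀, IsLevelSetAt D (follow u p₀ q p) φ := fun hf =>
    ht.eventually (hφv hf).eventually
  have h3 : q ∈ frontier D → ∀ᶠ p in 𝓝 p₀, φ (follow u p₀ q p) = 0 := fun hf => by
    filter_upwards [h1, ht.eventually (hφv hf).2.2] with p h3 h4
    exact h4.2.1 ((h3.mem_frontier_iff q).2 hf)
  -- The identities must hold in a neighbourhood of each nearby `p`, not only at `p`, to be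
  -- differentiated there.
  filter_upwards [eventually_eventually_nhds.2 h1, h.eventually_contDiffAt_follow,
    eventually_imp_distrib_left.2 h2,
    eventually_imp_distrib_left.2 fun hf => eventually_eventually_nhds.2 (h3 hf)]
    with p h4 h5 h6 h7
  refine ⟨?_, fun a ha b hb => ?_, fun hf => ⟨(h4.self_of_nhds.mem_frontier_iff q).2 hf, φ, h6 hf,
    rfl⟩, h7⟩
  · exact (h5 q).differentiableAt (by simp)
  · filter_upwards [h4] with p' h8
    have h9 := h8.active_eq q hq
    exact power_eq_of_mem_active (h9 ▸ ha) (h9 ▸ hb)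

end

end

/-! ### The linear systems and their invertibility -/

section

variable {N : ℕ} {D : Set (Pt 2)} {p p₀ : Params 2 N} {K : Set (Pt 2)}
  {u : Params 2 N × Pt 2 → Pt 2} {φ : Pt 2 → ℝ} {q : Pt 2} {Q : Params 2 N → Pt 2}

theorem eventually_gram_ne_zero {X E : Type*} [TopologicalSpace X] [NormedAddCommGroup E]
    [InnerProductSpace ℝ E] {α : Type*} {l : Filter α} {f : α → X} {x : X} (hf : Tendsto f l (𝓝 x))
    {v w : X → E} (hv : Continuous v) (hw : Continuous w) (h : gram (v x) (w x) ≠ 0) :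
    ∀ᶠ y in l, gram (v (f y)) (w (f y)) ≠ 0 :=
  hf.eventually ((continuous_gram hv hw).continuousAt.eventually_ne h)

theorem continuous_powerGrad_sub (a b : Option (Fin N)) :
    Continuous fun z : Params 2 N × Pt 2 => powerGrad z.1 a z.2 - powerGrad z.1 b z.2 :=
  (contDiff_powerGrad (n := 0) a).continuous.sub (contDiff_powerGrad (n := 0) b).continuous

theorem isUnit_det_rows {v w : Pt 2} {c : ℝ} (h : gram (c • v) w ≠ 0) :
    IsUnit (rows v w).det := by
  rw [gram_smul_left] at h
  exact (det_rows_ne_zero (right_ne_zero_of_mul h)).isUnit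

/-- The systems use differences from index `i` rather than from `c`; this change of base leaves the
Gram determinant unchanged. -/
theorem Generic.gram_sub_sub_ne_zero (hG : Generic D p.1 p.2) {i j : Fin N} {c : Option (Fin N)}
    (hij : i ≠ j) (hic : some i ≠ c) (hjc : some j ≠ c) (hv : q ∈ vertices D p.1 p.2)
    (hi : some i ∈ active p 0 q) (hj : some j ∈ active p 0 q) (hc : c ∈ active p 0 q) :
    gram (powerGrad p (some i) q - powerGrad p (some j) q)
      (powerGrad p (some i) q - powerGrad p c q) ≠ 0 := by
  have := hG.gram_three_ne_zero le_rfl hij hic hjc hv hi hj hc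
  rwa [← gram_sub_left, sub_sub_sub_cancel_right] at this

theorem IsTracking.derivatives_eq_zero {A : Set (Option (Fin N))} {F : Prop}
    (h : IsTracking D φ A F Q p) (hφ : ContDiff ℝ ∞ φ)
    (hA : (F ∧ ∃ a ∈ A, ∃ b ∈ A,
        gram (powerGrad p a (Q p) - powerGrad p b (Q p)) (gradient φ (Q p)) ≠ 0) ∨
      ∃ a ∈ A, ∃ b ∈ A, ∃ c ∈ A, gram (powerGrad p a (Q p) - powerGrad p c (Q p))
        (powerGrad p b (Q p) - powerGrad p c (Q p)) ≠ 0) {i : Fin N} (hi : some i ∉ A) :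
    seedJacobian Q p i = 0 ∧ weightDeriv Q p i = 0 := by
  rcases hA with ⟨hF, a, ha, b, hb, hg⟩ | ⟨a, ha, b, hb, c, hc, hg⟩
  · refine (h.solvesRow_zero hi ha hb).derivatives_eq_zero ?_ hg
    simpa using h.solvesRow_gradient hφ hF i 1
  · exact (h.solvesRow_zero hi ha hc).derivatives_eq_zero (h.solvesRow_zero hi hb hc) hg

theorem Generic.eventually_derivatives_eq_zero (hG : Generic D p₀.1 p₀.2)
    (hφ : ContDiff ℝ ∞ φ)
    (hφv : ∀ q ∈ vertices D p₀.1 p₀.2, q ∈ frontier D → IsLevelSetAt D q φ)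
    (hq : q ∈ vertices D p₀.1 p₀.2)
    (hQ : Tendsto (fun p => (p, Q p)) (𝓝 p₀) (𝓝 (p₀, q)))
    (h : ∀ᶠ p in 𝓝 p₀, IsTracking D φ (active p₀ 0 q) (q ∈ frontier D) Q p) :
    ∀ᶠ p in 𝓝 p₀, ∀ i, some i ∉ active p₀ 0 q →
      seedJacobian Q p i = 0 ∧ weightDeriv Q p i = 0 := by
  have hp : ∀ i, 0 ≤ p₀.2 i := fun i => (hG.weight_pos le_rfl i).le
  have hgc : Continuous fun z : Params 2 N × Pt 2 => gradient φ z.2 :=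
    (contDiff_gradient hφ).continuous.comp continuous_snd
  rcases (hG.isRegularAt le_rfl hφv (vertices_subset_closure hp hq)).of_mem_vertices hp hq with
    ⟨hf, a, b, hA, hg⟩ | ⟨hf, a, b, c, hA, hg⟩
  · filter_upwards [h, eventually_gram_ne_zero hQ (continuous_powerGrad_sub a b) hgc hg]
      with p h1 h2 i hi
    exact h1.derivatives_eq_zero hφ (Or.inl ⟨hf, a, by simp [hA], b, by simp [hA], h2⟩) hi
  · filter_upwards [h, eventually_gram_ne_zero hQ (continuous_powerGrad_sub a c)
      (continuous_powerGrad_sub b c) hg] with p h1 h2 i hi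
    exact h1.derivatives_eq_zero hφ
      (Or.inr ⟨a, by simp [hA], b, by simp [hA], c, by simp [hA], h2⟩) hi

/-- The vector `w` treats two systems at once: it is `s_k - s_i` when `c` is a third cell and `Q p -
s_i` when `c` is the void. Invertibility at `p₀` persists by continuity. -/
theorem Generic.eventually_system_three (hG : Generic D p₀.1 p₀.2)
    (hq : q ∈ vertices D p₀.1 p₀.2)
    (hQ : Tendsto (fun p => (p, Q p)) (𝓝 p₀) (𝓝 (p₀, q)))
    (h : ∀ᶠ p in 𝓝 p₀, IsTracking D φ (active p₀ 0 q) (q ∈ frontier D) Q p) :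
    ∀ᶠ p in 𝓝 p₀, ∀ i j c, i ≠ j → some i ≠ c → some j ≠ c → some i ∈ active p₀ 0 q →
      some j ∈ active p₀ 0 q → c ∈ active p₀ 0 q → ∀ w : Pt 2,
      powerGrad p (some i) (Q p) - powerGrad p c (Q p) = (2 : ℝ) • w →
      IsUnit (rows (p.1 j - p.1 i) w).det ∧
      rows (p.1 j - p.1 i) w * seedJacobian Q p i = rows (Q p - p.1 i) (Q p - p.1 i) ∧
      rows (p.1 j - p.1 i) w *ᵥ weightDeriv Q p i = ![1 / 2, 1 / 2] := by
  have h1 : ∀ᶠ p in 𝓝 p₀, ∀ i j c, i ≠ j → some i ≠ c → some j ≠ c → some i ∈ active p₀ 0 q →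
      some j ∈ active p₀ 0 q → c ∈ active p₀ 0 q →
      gram (powerGrad p (some i) (Q p) - powerGrad p (some j) (Q p))
        (powerGrad p (some i) (Q p) - powerGrad p c (Q p)) ≠ 0 := by
    simp only [eventually_all]
    intro i j c hij hic hjc hi hj hc
    have := eventually_gram_ne_zero hQ (continuous_powerGrad_sub (some i) (some j))
      (continuous_powerGrad_sub (some i) c) (hG.gram_sub_sub_ne_zero hij hic hjc hq hi hj hc)
    exact this
  filter_upwards [h, h1] with p h h1 i j c hij hic hjc hi hj hc w hw
  have h2 := h1 i j c hij hic hjc hi hj hc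
  rw [powerGrad_some_sub_some, hw, gram_smul_right] at h2
  exact ⟨isUnit_det_rows (right_ne_zero_of_mul h2),
    (h.solvesRow hi hj (fun hh => hij (Option.some_injective _ hh).symm)
      (powerGrad_some_sub_some p i j (Q p))).rows_eq (h.solvesRow hi hc hic.symm hw)⟩

/-- Here too `w` covers both a second cell and the void; the second row is the unit normal, read off
from the gradient of `φ`. -/
theorem Generic.eventually_system_frontier (hG : Generic D p₀.1 p₀.2) (hφ : ContDiff ℝ ∞ φ)
    (hφv : ∀ q ∈ vertices D p₀.1 p₀.2, q ∈ frontier D → IsLevelSetAt D q φ)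
    (hq : q ∈ vertices D p₀.1 p₀.2) (hf : q ∈ frontier D)
    (hQ : Tendsto (fun p => (p, Q p)) (𝓝 p₀) (𝓝 (p₀, q)))
    (h : ∀ᶠ p in 𝓝 p₀, IsTracking D φ (active p₀ 0 q) (q ∈ frontier D) Q p) :
    ∀ᶠ p in 𝓝 p₀, ∀ i c, some i ≠ c → some i ∈ active p₀ 0 q → c ∈ active p₀ 0 q → ∀ w : Pt 2,
      powerGrad p (some i) (Q p) - powerGrad p c (Q p) = (2 : ℝ) • w →
      ∃ n, IsUnitNormalAt D (Q p) n ∧ IsUnit (rows w n).det ∧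
        rows w n * seedJacobian Q p i = rows (Q p - p.1 i) 0 ∧
        rows w n *ᵥ weightDeriv Q p i = ![1 / 2, 0] := by
  have hgc : Continuous fun z : Params 2 N × Pt 2 => gradient φ z.2 :=
    (contDiff_gradient hφ).continuous.comp continuous_snd
  have h1 : ∀ᶠ p in 𝓝 p₀, ∀ a b, a ≠ b → a ∈ active p₀ 0 q → b ∈ active p₀ 0 q →
      gram (powerGrad p a (Q p) - powerGrad p b (Q p)) (gradient φ (Q p)) ≠ 0 := by
    simp only [eventually_all]
    intro a b hab ha hb
    have := eventually_gram_ne_zero hQ (continuous_powerGrad_sub a b) hgc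
      (hG.gram_frontier_ne_zero le_rfl hab ha hb hf hq (hφv q hq hf))
    exact this
  have h2 : ∀ᶠ p in 𝓝 p₀, gradient φ (Q p) ≠ 0 :=
    hQ.eventually (hgc.continuousAt.eventually_ne (hφv q hq hf).2.1)
  filter_upwards [h, h1, h2] with p h h1 h2 i c hic hi hc w hw
  refine ⟨_, h.isUnitNormalAt hf, ?_,
    (h.solvesRow hi hc hic.symm hw).rows_eq (h.solvesRow_gradient hφ hf i _)⟩
  have h3 := h1 _ c hic hi hc
  rw [hw] at h3
  refine isUnit_det_rows (c := 2) ?_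
  rw [gram_smul_right]
  exact mul_ne_zero (pow_ne_zero 2 (inv_ne_zero (norm_ne_zero_iff.2 h2))) h3

end

/-! ### Rotations and angles -/

section

section Rotation

theorem contDiff_perp {n : WithTop ℕ∞} : ContDiff ℝ n perp := by
  refine contDiff_euclidean.2 fun i => ?_
  fin_cases i
  · simp only [perp]
    simp
    fun_prop
  · simp only [perp]
    simp
    fun_prop

theorem contDiffAt_rotateAbout {E : Type*} [NormedAddCommGroup E] [NormedSpace ℝ E]
    {n : WithTop ℕ∞} {c q : E → Pt 2} {θ : E → ℝ} {x : E} (hc : ContDiffAt ℝ n c x)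
    (hq : ContDiffAt ℝ n q x) (hθ : ContDiffAt ℝ n θ x) :
    ContDiffAt ℝ n (fun y => rotateAbout (c y) (q y) (θ y)) x :=
  hc.add ((hθ.cos.smul (hq.sub hc)).add
    (hθ.sin.smul (contDiff_perp.contDiffAt.comp x (hq.sub hc))))

theorem continuous_rotateAbout : Continuous fun z : (Pt 2 × Pt 2) × ℝ =>
    rotateAbout z.1.1 z.1.2 z.2 := by
  have h : Continuous perp := (contDiff_perp (n := 0)).continuous
  unfold rotateAbout
  fun_prop

theorem tendsto_rotateAbout {ι : Type*} {l : Filter ι} {c q : ι → Pt 2} {θ : ι → ℝ} {c₀ q₀ : Pt 2}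
    {θ₀ : ℝ} (hc : Tendsto c l (𝓝 c₀)) (hq : Tendsto q l (𝓝 q₀)) (hθ : Tendsto θ l (𝓝 θ₀)) :
    Tendsto (fun a => rotateAbout (c a) (q a) (θ a)) l (𝓝 (rotateAbout c₀ q₀ θ₀)) :=
  (continuous_rotateAbout.tendsto ((c₀, q₀), θ₀)).comp ((hc.prodMk_nhds hq).prodMk_nhds hθ)

theorem rotateAbout_zero (c q : Pt 2) : rotateAbout c q 0 = q := by
  simp [rotateAbout]

theorem perp_apply_zero (w : Pt 2) : perp w 0 = -(w 1) := rfl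

theorem perp_apply_one (w : Pt 2) : perp w 1 = w 0 := rfl

theorem norm_sq_plane (w : Pt 2) : ‖w‖ ^ 2 = w 0 ^ 2 + w 1 ^ 2 := by
  rw [← real_inner_self_eq_norm_sq, inner_eq_plane]
  ring

theorem ext_plane {v w : Pt 2} (h0 : v 0 = w 0) (h1 : v 1 = w 1) : v = w := by
  ext i
  fin_cases i
  · exact h0
  · exact h1

theorem rotateAbout_rotateAbout (c q : Pt 2) (θ η : ℝ) :
    rotateAbout c (rotateAbout c q θ) η = rotateAbout c q (θ + η) := by
  refine ext_plane ?_ ?_ <;>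
  · simp [rotateAbout, perp_apply_zero, perp_apply_one, Real.cos_add, Real.sin_add]
    ring

theorem norm_sq_rotateAbout_sub (c q : Pt 2) (θ : ℝ) :
    ‖rotateAbout c q θ - c‖ ^ 2 = ‖q - c‖ ^ 2 := by
  rw [norm_sq_plane, norm_sq_plane]
  simp [rotateAbout, perp_apply_zero, perp_apply_one]
  linear_combination (((q 0 - c 0) ^ 2 + (q 1 - c 1) ^ 2) * Real.sin_sq_add_cos_sq θ)

/-- The angle of the rotation of center `c` that sends `q` to a point close to `q`. -/
def angle (c : Pt 2) (r : ℝ) (q x : Pt 2) : ℝ := Real.arcsin ((rows (q - c) (x - c)).det / r)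

theorem angle_self (c : Pt 2) (r : ℝ) (q : Pt 2) : angle c r q q = 0 := by
  simp [angle, det_rows, mul_comm]

/-- The positive inner product puts the angle strictly between `-π / 2` and `π / 2`, where the
arcsine recovers it from its sine and the cosine is the positive square root. -/
theorem rotateAbout_angle {c q x : Pt 2} {r : ℝ} (hr : 0 < r) (hq : ‖q - c‖ ^ 2 = r)
    (hx : ‖x - c‖ ^ 2 = r) (h : 0 < ⟪q - c, x - c⟫) : rotateAbout c q (angle c r q x) = x := by
  have h1 : (⟪q - c, x - c⟫ / r) ^ 2 + ((rows (q - c) (x - c)).det / r) ^ 2 = 1 := by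
    rw [div_pow, div_pow, ← add_div, det_rows_sq, gram, hq, hx]
    field_simp
    ring
  have hS : -1 ≤ (rows (q - c) (x - c)).det / r ∧ (rows (q - c) (x - c)).det / r ≤ 1 :=
    abs_le.1 (by rw [← sq_le_one_iff_abs_le_one]; nlinarith [sq_nonneg (⟪q - c, x - c⟫ / r)])
  have hcos : Real.cos (angle c r q x) = ⟪q - c, x - c⟫ / r := by
    rw [angle, Real.cos_arcsin, ← eq_sub_of_add_eq h1, Real.sqrt_sq (by positivity)]
  have hsin : Real.sin (angle c r q x) = (rows (q - c) (x - c)).det / r :=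
    Real.sin_arcsin hS.1 hS.2
  rw [norm_sq_plane] at hq
  have hr' : r ≠ 0 := hr.ne'
  simp only [PiLp.sub_apply] at hq
  rw [rotateAbout, hcos, hsin, inner_eq_plane, det_rows]
  refine ext_plane ?_ ?_
  · simp [perp_apply_zero]
    field_simp
    linear_combination (x 0 - c 0) * hq
  · simp [perp_apply_one]
    field_simp
    linear_combination (x 1 - c 1) * hq

theorem cos_sin_of_rotateAbout_eq {c q x : Pt 2} {α : ℝ} (hq : q - c ≠ 0)
    (h : rotateAbout c q α = x) :
    Real.cos α = ⟪‖q - c‖⁻¹ • (q - c), ‖x - c‖⁻¹ • (x - c)⟫ ∧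
      Real.sin α = (rows (‖q - c‖⁻¹ • (q - c)) (‖x - c‖⁻¹ • (x - c))).det := by
  have hn : ‖x - c‖ = ‖q - c‖ := by
    rw [← sq_eq_sq₀ (norm_nonneg _) (norm_nonneg _), ← h, norm_sq_rotateAbout_sub]
  have hx : x - c = Real.cos α • (q - c) + Real.sin α • perp (q - c) := by
    rw [← h, rotateAbout, add_sub_cancel_left]
  have hr : ‖q - c‖ ≠ 0 := norm_ne_zero_iff.2 hq
  have hr2 := norm_sq_plane (q - c)
  rw [hn, inner_eq_plane, det_rows, hx]
  simp only [PiLp.smul_apply, PiLp.add_apply, smul_eq_mul, perp_apply_zero, perp_apply_one]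
  constructor
  · field_simp
    linear_combination Real.cos α * hr2
  · field_simp
    linear_combination Real.sin α * hr2

/-- The quotient is the cotangent of `α / 2`, that is, the tangent of `π / 2 - α / 2`, which lies in
the range of the arctangent. At `α = π` division by zero returns 0, the correct value. -/
theorem eq_pi_sub_two_mul_arctan {α : ℝ} (h0 : 0 < α) (h1 : α < 2 * Real.pi) :
    α = Real.pi - 2 * Real.arctan ((1 + Real.cos α) / Real.sin α) := by
  have h : (1 + Real.cos α) / Real.sin α = Real.tan (Real.pi / 2 - α / 2) := by
    have hs : Real.sin (α / 2) ≠ 0 :=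
      (Real.sin_pos_of_pos_of_lt_pi (by linarith) (by linarith)).ne'
    rw [Real.tan_pi_div_two_sub, Real.tan_eq_sin_div_cos, inv_div]
    have hα : α = 2 * (α / 2) := by ring
    rw [hα, Real.cos_two_mul, Real.sin_two_mul, ← hα]
    by_cases hc : Real.cos (α / 2) = 0
    · simp [hc]
    · field_simp
      ring
  rw [h, Real.arctan_tan (by linarith) (by linarith)]
  ring

end Rotation

end

/-! ### Persistence of circular arcs -/

section

variable {N : ℕ} {D : Set (Pt 2)} {p p₀ : Params 2 N} {K : Set (Pt 2)}
  {u : Params 2 N × Pt 2 → Pt 2} {i : Fin N} {q₀ q₁ : Pt 2} {α : ℝ}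

theorem contDiffAt_det_rows {E : Type*} [NormedAddCommGroup E] [NormedSpace ℝ E]
    {n : WithTop ℕ∞} {v w : E → Pt 2} {x : E} (hv : ContDiffAt ℝ n v x)
    (hw : ContDiffAt ℝ n w x) : ContDiffAt ℝ n (fun y => (rows (v y) (w y)).det) x := by
  have hv' := contDiffAt_euclidean.1 hv
  have hw' := contDiffAt_euclidean.1 hw
  simp only [det_rows]
  exact ((hv' 0).mul (hw' 1)).sub ((hv' 1).mul (hw' 0))

theorem contDiffAt_seed (i : Fin N) (p : Params 2 N) :
    ContDiffAt ℝ ∞ (fun p : Params 2 N => p.1 i) p := by fun_prop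

theorem contDiffAt_weight (i : Fin N) (p : Params 2 N) :
    ContDiffAt ℝ ∞ (fun p : Params 2 N => p.2 i) p := by fun_prop

theorem norm_sq_eq_weight (hp : ∀ i, 0 ≤ p.2 i) {x : Pt 2} (hi : x ∈ modCell D p.1 p.2 i)
    (h0 : x ∈ voidCell D p.1 p.2) : ‖x - p.1 i‖ ^ 2 = p.2 i :=
  sub_eq_zero.1 (power_eq_of_mem_active ((mem_modCell_iff hp).1 hi).2
    ((mem_voidCell_iff hp).1 h0).2)

/-- The angle of the arc of center `s_i` between the points that follow `q₀` and `q₁`, when it is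
close to `α`. -/
def arcAngle (u : Params 2 N × Pt 2 → Pt 2) (p₀ : Params 2 N) (i : Fin N) (q₀ q₁ : Pt 2) (α : ℝ)
    (p : Params 2 N) : ℝ :=
  α + angle (p.1 i) (p.2 i) (rotateAbout (p.1 i) (follow u p₀ q₀ p) α) (follow u p₀ q₁ p)

namespace IsDeformation

theorem arcAngle_self (h : IsDeformation D p₀ K u) (hα : rotateAbout (p₀.1 i) q₀ α = q₁) :
    arcAngle u p₀ i q₀ q₁ α p₀ = α := by
  rw [arcAngle, h.follow_self, h.follow_self, hα, angle_self, add_zero]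

/-- The angle is `α` plus a small correction, an arcsine whose argument is near 0 and so avoids the
singular values 1 and -1. This tracks the angle continuously even beyond `π`. -/
theorem eventually_contDiffAt_arcAngle (h : IsDeformation D p₀ K u) (hp : ∀ i, 0 < p₀.2 i)
    (hα : rotateAbout (p₀.1 i) q₀ α = q₁) :
    ∀ᶠ p in 𝓝 p₀, ContDiffAt ℝ ∞ (arcAngle u p₀ i q₀ q₁ α) p := by
  let S : Params 2 N → ℝ := fun p => (rows (rotateAbout (p.1 i) (follow u p₀ q₀ p) α - p.1 i)
    (follow u p₀ q₁ p - p.1 i)).det / p.2 i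
  have hw : ∀ᶠ p in 𝓝 p₀, p.2 i ≠ 0 :=
    (contDiffAt_weight i p₀).continuousAt.eventually_ne (hp i).ne'
  have hS : ∀ᶠ p in 𝓝 p₀, ContDiffAt ℝ ∞ S p := by
    filter_upwards [hw, h.eventually_contDiffAt_follow] with p h1 h2
    have hc := contDiffAt_seed i p
    exact (contDiffAt_det_rows ((contDiffAt_rotateAbout hc (h2 q₀) contDiffAt_const).sub hc)
      ((h2 q₁).sub hc)).div (contDiffAt_weight i p) h1
  have hS0 : S p₀ = 0 := by
    simp [S, h.follow_self, hα, det_rows, mul_comm]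
  have hc := hS.self_of_nhds.continuousAt
  filter_upwards [hS, hc.eventually_ne (show S p₀ ≠ -1 by simp [hS0]),
    hc.eventually_ne (show S p₀ ≠ 1 by simp [hS0])] with p h1 h2 h3
  exact contDiffAt_const.add ((Real.contDiffAt_arcsin h2 h3).comp p h1)

/-- The deformation moves the points of an arc by a rotation of angle less than `π / 2`. -/
theorem eventually_inner_pos (h : IsDeformation D p₀ K u) (hp : ∀ i, 0 < p₀.2 i)
    (hq₀ : ‖q₀ - p₀.1 i‖ ^ 2 = p₀.2 i) :
    ∀ᶠ p in 𝓝 p₀, ∀ θ ∈ Icc 0 α,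
      0 < ⟪rotateAbout (p.1 i) (follow u p₀ q₀ p) θ - p.1 i,
        follow u p₀ (rotateAbout (p₀.1 i) q₀ θ) p - p.1 i⟫ := by
  refine isCompact_Icc.eventually_forall_of_forall_eventually
    (P := fun (p : Params 2 N) (θ : ℝ) => 0 < ⟪rotateAbout (p.1 i) (follow u p₀ q₀ p) θ - p.1 i,
      follow u p₀ (rotateAbout (p₀.1 i) q₀ θ) p - p.1 i⟫) fun θ _ => ?_
  have hf : Tendsto (fun z : Params 2 N × ℝ => z.1) (𝓝 (p₀, θ)) (𝓝 p₀) := continuous_fst.tendsto _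
  have hs : Tendsto (fun z : Params 2 N × ℝ => z.2) (𝓝 (p₀, θ)) (𝓝 θ) := continuous_snd.tendsto _
  have h1 := h.tendsto_follow hf (tendsto_rotateAbout (c := fun _ => p₀.1 i) (q := fun _ => q₀)
    tendsto_const_nhds tendsto_const_nhds hs)
  have h3 : Tendsto (fun z : Params 2 N × ℝ => z.1.1 i) (𝓝 (p₀, θ)) (𝓝 (p₀.1 i)) :=
    (contDiffAt_seed i p₀).continuousAt.tendsto.comp hf
  have h4 := tendsto_rotateAbout h3 (h.tendsto_follow (y := fun _ => q₀) hf tendsto_const_nhds) hs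
  have h5 := (h4.sub h3).inner (𝕜 := ℝ) (h1.sub h3)
  refine h5.eventually (lt_mem_nhds ?_)
  rw [real_inner_self_eq_norm_sq, norm_sq_rotateAbout_sub, hq₀]
  exact hp i

theorem eventually_isArc (h : IsDeformation D p₀ K u) (hb : Bornology.IsBounded D)
    (hp : ∀ i, 0 < p₀.2 i) (harc : IsArc D p₀ i q₀ q₁ α) :
    ∀ᶠ p in 𝓝 p₀, IsArc D p i (follow u p₀ q₀ p) (follow u p₀ q₁ p)
      (arcAngle u p₀ i q₀ q₁ α p) := by
  obtain ⟨hα0, hα1, hv₀, hv₁, hα, hmem, hnv⟩ := harc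
  have hp' : ∀ i, 0 ≤ p₀.2 i := fun i => (hp i).le
  have hq₀ : ‖q₀ - p₀.1 i‖ ^ 2 = p₀.2 i := by
    have := hmem 0 ⟨le_rfl, hα0.le⟩
    rw [rotateAbout_zero] at this
    exact norm_sq_eq_weight hp' this.1 this.2
  have hA := (h.eventually_contDiffAt_arcAngle hp hα).self_of_nhds.continuousAt
  have hA0 := h.arcAngle_self hα
  have hw : ∀ᶠ p in 𝓝 p₀, 0 < p.2 i :=
    (contDiffAt_weight i p₀).continuousAt.eventually (lt_mem_nhds (hp i))
  filter_upwards [hA.eventually (lt_mem_nhds (hA0.symm ▸ hα0)),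
    hA.eventually (gt_mem_nhds (hA0.symm ▸ hα1)), h.eventually_isDiagramMap_follow hb hp,
    h.eventually_inner_pos (α := α) hp hq₀, hw] with p h0 h1 hg hpos hr
  set A := arcAngle u p₀ i q₀ q₁ α p
  set c := p.1 i
  set x : ℝ → Pt 2 := fun θ => rotateAbout (p₀.1 i) q₀ θ
  set y : ℝ → Pt 2 := fun θ => follow u p₀ (x θ) p
  have hx0 : x 0 = q₀ := rotateAbout_zero _ _
  have hcell : ∀ θ ∈ Icc 0 α, y θ ∈ modCell D p.1 p.2 i ∩ voidCell D p.1 p.2 := fun θ hθ =>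
    ⟨(hg.mem_cell_iff (some i) _).2 (hmem θ hθ).1, (hg.mem_cell_iff none _).2 (hmem θ hθ).2⟩
  have hy : ∀ θ ∈ Icc 0 α, ‖y θ - c‖ ^ 2 = p.2 i := fun θ hθ =>
    norm_sq_eq_weight hg.nonneg_right (hcell θ hθ).1 (hcell θ hθ).2
  have hy0 : y 0 = follow u p₀ q₀ p := by simp only [y, hx0]
  have hy1 : y α = follow u p₀ q₁ p := by simp only [y, x, hα]
  -- The motion need not preserve angles along the arc: `β θ` is the angle, measured from the new
  -- starting point, of the image of the point of angle `θ`. It is continuous and goes from 0 to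
  -- `A`, so its values cover `[0, A]`, and each point of the new arc is the image of a point of the
  -- old one.
  let β : ℝ → ℝ := fun θ => θ + angle c (p.2 i) (rotateAbout c (y 0) θ) (y θ)
  have hβ : ∀ θ ∈ Icc 0 α, rotateAbout c (y 0) (β θ) = y θ := fun θ hθ => by
    rw [← rotateAbout_rotateAbout]
    refine rotateAbout_angle hr ?_ (hy θ hθ) ?_
    · rw [norm_sq_rotateAbout_sub, hy 0 ⟨le_rfl, hα0.le⟩]
    · rw [hy0]
      exact hpos θ hθ
  have hβ0 : β 0 = 0 := by simp only [β]; rw [rotateAbout_zero, angle_self, add_zero]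
  have hβ1 : β α = A := by simp only [β, A, arcAngle, hy0, hy1, c]
  have hβc : Continuous β := by
    obtain ⟨C, hC⟩ := hg.lipschitz
    have hr' : ∀ c q, Continuous fun θ => rotateAbout c q θ := fun c q =>
      continuous_rotateAbout.comp (Continuous.prodMk_right (c, q))
    have hyc : Continuous y := hC.continuous.comp (hr' _ _)
    have h2 := hr' c (y 0)
    simp only [β, angle, det_rows]
    exact continuous_id.add (Real.continuous_arcsin.comp (by fun_prop))
  have hsurj : ∀ η ∈ Icc 0 A, ∃ θ ∈ Icc 0 α, β θ = η := fun η hη => by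
    have := intermediate_value_Icc hα0.le hβc.continuousOn
    rw [hβ0, hβ1] at this
    exact this hη
  rw [← hy0, ← hy1]
  refine ⟨h0, h1, ?_, ?_, ?_, fun η hη => ?_, fun η hη => ?_⟩
  · rw [hy0]
    exact (hg.mem_vertices_iff q₀).2 hv₀
  · rw [hy1]
    exact (hg.mem_vertices_iff q₁).2 hv₁
  · rw [← hβ1]
    exact hβ α ⟨hα0.le, le_rfl⟩
  · obtain ⟨θ, hθ, rfl⟩ := hsurj η hη
    rw [hβ θ hθ]
    exact hcell θ hθ
  · obtain ⟨θ, hθ, rfl⟩ := hsurj η (Ioo_subset_Icc_self hη)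
    rw [hβ θ hθ]
    -- An interior angle of the new arc comes from an interior angle of the old one, where there is
    -- no vertex.
    have hθ0 : θ ≠ 0 := fun hh => by
      rw [hh, hβ0] at hη
      exact lt_irrefl _ hη.1
    have hθ1 : θ ≠ α := fun hh => by
      rw [hh, hβ1] at hη
      exact lt_irrefl _ hη.2
    exact fun hv => hnv θ ⟨lt_of_le_of_ne hθ.1 hθ0.symm, lt_of_le_of_ne hθ.2 hθ1⟩
      ((hg.mem_vertices_iff _).1 hv)

end IsDeformation

end

/-! ### Vertex systems and arc functions in the plane -/

section

variable {N : ℕ} {D : Set (Pt 2)} {p₀ : Params 2 N} {K : Set (Pt 2)}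
  {u : Params 2 N × Pt 2 → Pt 2} {φ : Pt 2 → ℝ} {q : Pt 2}

/-- The linear systems satisfied by the differential of a function `Q` that follows the vertex `q`
of the diagram of parameters `p₀`, at the parameters `p`. -/
structure SolvesSystems (D : Set (Pt 2)) (p₀ : Params 2 N) (q : Pt 2) (Q : Params 2 N → Pt 2)
    (p : Params 2 N) : Prop where
  notMem : ∀ l, q ∉ modCell D p₀.1 p₀.2 l → seedJacobian Q p l = 0 ∧ weightDeriv Q p l = 0
  three : ∀ i j k, i ≠ j → i ≠ k → j ≠ k →
    q ∈ modCell D p₀.1 p₀.2 i → q ∈ modCell D p₀.1 p₀.2 j → q ∈ modCell D p₀.1 p₀.2 k →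
    IsUnit (rows (p.1 j - p.1 i) (p.1 k - p.1 i)).det ∧
    rows (p.1 j - p.1 i) (p.1 k - p.1 i) * seedJacobian Q p i =
      rows (Q p - p.1 i) (Q p - p.1 i) ∧
    rows (p.1 j - p.1 i) (p.1 k - p.1 i) *ᵥ weightDeriv Q p i = ![1 / 2, 1 / 2]
  void : ∀ i j, i ≠ j →
    q ∈ modCell D p₀.1 p₀.2 i → q ∈ modCell D p₀.1 p₀.2 j → q ∈ voidCell D p₀.1 p₀.2 →
    IsUnit (rows (p.1 j - p.1 i) (Q p - p.1 i)).det ∧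
    rows (p.1 j - p.1 i) (Q p - p.1 i) * seedJacobian Q p i =
      rows (Q p - p.1 i) (Q p - p.1 i) ∧
    rows (p.1 j - p.1 i) (Q p - p.1 i) *ᵥ weightDeriv Q p i = ![1 / 2, 1 / 2]
  boundary : ∀ i j, i ≠ j →
    q ∈ modCell D p₀.1 p₀.2 i → q ∈ modCell D p₀.1 p₀.2 j → q ∈ frontier D →
    ∃ n, IsUnitNormalAt D (Q p) n ∧
      IsUnit (rows (p.1 j - p.1 i) n).det ∧
      rows (p.1 j - p.1 i) n * seedJacobian Q p i = rows (Q p - p.1 i) 0 ∧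
      rows (p.1 j - p.1 i) n *ᵥ weightDeriv Q p i = ![1 / 2, 0]
  boundary_void : ∀ i, q ∈ modCell D p₀.1 p₀.2 i → q ∈ voidCell D p₀.1 p₀.2 → q ∈ frontier D →
    ∃ n, IsUnitNormalAt D (Q p) n ∧
      IsUnit (rows (Q p - p.1 i) n).det ∧
      rows (Q p - p.1 i) n * seedJacobian Q p i = rows (Q p - p.1 i) 0 ∧
      rows (Q p - p.1 i) n *ᵥ weightDeriv Q p i = ![1 / 2, 0]

theorem IsDeformation.eventually_solvesSystems (h : IsDeformation D p₀ K u)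
    (hG : Generic D p₀.1 p₀.2) (hb : Bornology.IsBounded D) (hφ : ContDiff ℝ ∞ φ)
    (hφv : ∀ q ∈ vertices D p₀.1 p₀.2, q ∈ frontier D → IsLevelSetAt D q φ)
    (hq : q ∈ vertices D p₀.1 p₀.2) :
    ∀ᶠ p in 𝓝 p₀, SolvesSystems D p₀ q (follow u p₀ q) p := by
  have hp : ∀ i, 0 < p₀.2 i := hG.weight_pos le_rfl
  have hp' : ∀ i, 0 ≤ p₀.2 i := fun i => (hp i).le
  have hcl := vertices_subset_closure hp' hq
  have hQ : Tendsto (fun p => (p, follow u p₀ q p)) (𝓝 p₀) (𝓝 (p₀, q)) :=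
    tendsto_id.prodMk_nhds (h.tendsto_follow tendsto_id tendsto_const_nhds)
  have ht := h.eventually_isTracking hb hp (hφv q hq) hcl
  filter_upwards [hG.eventually_derivatives_eq_zero hφ hφv hq hQ ht,
    hG.eventually_system_three hq hQ ht, eventually_imp_distrib_left.2
      fun hf => hG.eventually_system_frontier hφ hφv hq hf hQ ht] with p h1 h2 h3
  have hcell : ∀ i, q ∈ modCell D p₀.1 p₀.2 i → some i ∈ active p₀ 0 q := fun i hi =>
    ((mem_modCell_iff hp').1 hi).2
  have hvoid : q ∈ voidCell D p₀.1 p₀.2 → none ∈ active p₀ 0 q := fun h0 =>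
    ((mem_voidCell_iff hp').1 h0).2
  have hne : ∀ {i j : Fin N}, i ≠ j → some i ≠ some j := fun hij hh =>
    hij (Option.some_injective _ hh)
  refine ⟨fun l hl => h1 l fun hl' => hl ((mem_modCell_iff hp').2 ⟨hcl, hl'⟩), ?_, ?_, ?_, ?_⟩
  · intro i j k hij hik hjk hi hj hk
    exact h2 i j (some k) hij (hne hik) (hne hjk) (hcell i hi) (hcell j hj) (hcell k hk) _
      (powerGrad_some_sub_some p i k _)
  · intro i j hij hi hj h0
    exact h2 i j none hij (by simp) (by simp) (hcell i hi) (hcell j hj) (hvoid h0) _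
      (powerGrad_some_sub_none p i _)
  · intro i j hij hi hj hf
    exact h3 hf i (some j) (hne hij) (hcell i hi) (hcell j hj) _ (powerGrad_some_sub_some p i j _)
  · intro i hi h0 hf
    exact h3 hf i none (by simp) (hcell i hi) (hvoid h0) _ (powerGrad_some_sub_none p i _)

theorem IsDeformation.eventually_arc (h : IsDeformation D p₀ K u) (hb : Bornology.IsBounded D)
    (hp : ∀ i, 0 < p₀.2 i) {i : Fin N} {q₀ q₁ : Pt 2} {α : ℝ} (harc : IsArc D p₀ i q₀ q₁ α) :
    ∃ (Q₀ Q₁ : Params 2 N → Pt 2) (A : Params 2 N → ℝ),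
      Q₀ p₀ = q₀ ∧ Q₁ p₀ = q₁ ∧ A p₀ = α ∧
      ∀ᶠ p in 𝓝 p₀,
        ContDiffAt ℝ ∞ Q₀ p ∧ ContDiffAt ℝ ∞ Q₁ p ∧ ContDiffAt ℝ ∞ A p ∧
        IsArc D p i (Q₀ p) (Q₁ p) (A p) ∧
        Real.cos (A p) =
          ⟪‖Q₀ p - p.1 i‖⁻¹ • (Q₀ p - p.1 i), ‖Q₁ p - p.1 i‖⁻¹ • (Q₁ p - p.1 i)⟫ ∧
        Real.sin (A p) =
          (rows (‖Q₀ p - p.1 i‖⁻¹ • (Q₀ p - p.1 i))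
            (‖Q₁ p - p.1 i‖⁻¹ • (Q₁ p - p.1 i))).det ∧
        A p = Real.pi - 2 * Real.arctan ((1 + Real.cos (A p)) / Real.sin (A p)) ∧
        ∀ n r : ℕ, r ≤ n → ContDiffAt ℝ ∞
          (fun p' : Params 2 N => rotateAbout (p'.1 i) (Q₀ p') ((r : ℝ) / n * A p')) p := by
  refine ⟨_, _, _, h.follow_self q₀, h.follow_self q₁,
    h.arcAngle_self (i := i) (q₀ := q₀) (q₁ := q₁) (α := α) harc.2.2.2.2.1, ?_⟩
  have hw : ∀ᶠ p in 𝓝 p₀, 0 < p.2 i :=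
    (contDiffAt_weight i p₀).continuousAt.eventually (lt_mem_nhds (hp i))
  filter_upwards [h.eventually_contDiffAt_follow,
    h.eventually_contDiffAt_arcAngle (i := i) hp harc.2.2.2.2.1, h.eventually_isArc hb hp harc,
    h.eventually_isDiagramMap_follow hb hp, hw] with p h1 h2 h3 h4 h5
  obtain ⟨hA0, hA1, -, -, hA, hmem, -⟩ := id h3
  have h0 := hmem 0 ⟨le_rfl, hA0.le⟩
  rw [rotateAbout_zero] at h0
  have h6 := norm_sq_eq_weight h4.nonneg_right h0.1 h0.2
  -- The starting point lies on the circle of squared radius `p.2 i > 0`, so the direction from the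
  -- center is well defined.
  have hne : follow u p₀ q₀ p - p.1 i ≠ 0 := fun hh => by
    rw [hh, norm_zero] at h6
    linarith
  obtain ⟨hcos, hsin⟩ := cos_sin_of_rotateAbout_eq hne hA
  exact ⟨h1 q₀, h1 q₁, h2, h3, hcos, hsin, eq_pi_sub_two_mul_arctan hA0 hA1, fun n r _ =>
    contDiffAt_rotateAbout (contDiffAt_seed i p) (h1 q₀) (contDiffAt_const.mul h2)⟩

end

end ModLaguerre

end

/-! ### The deformation of the diagram and its planar consequences -/

theorem propositionA1 :
    -- the deformation of the diagram, in dimension `d ≥ 2`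
    (∀ (d : ℕ), 2 ≤ d → ∀ (N : ℕ) (D : Set (Pt d)), IsOpen D → Bornology.IsBounded D →
      ∀ (s : Fin N → Pt d) (ψ : Fin N → ℝ), Generic D s ψ →
      (∀ᶠ h : Params d N in 𝓝 0, ∀ i j,
        Neighbours D (s + h.1) (ψ + h.2) i j ↔ Neighbours D s ψ i j) ∧
      ∃ m : Params d N → W1inf d,
        (∀ᶠ h in 𝓝 0, DifferentiableAt ℝ m h) ∧
        ∀ᶠ h in 𝓝 0, ∃ g : Pt d → Pt d, IsContinuousRep (m h) g ∧
          (∀ i, g '' modCell D s ψ i = modCell D (s + h.1) (ψ + h.2) i) ∧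
          g '' vertices D s ψ = vertices D (s + h.1) (ψ + h.2)) ∧
    -- the vertices as functions of the parameters, in dimension `2`
    (∀ (N : ℕ) (D : Set (Pt 2)), IsOpen D → Bornology.IsBounded D →
      ∀ (s : Fin N → Pt 2) (ψ : Fin N → ℝ), Generic D s ψ →
      (vertices D s ψ).Finite ∧
      (∀ q ∈ vertices D s ψ, ∃ Q : Params 2 N → Pt 2,
        Q (s, ψ) = q ∧
        (∀ᶠ p in 𝓝 (s, ψ), ContDiffAt ℝ ∞ Q p) ∧
        -- `Q p` is a vertex of the perturbed diagram, of the same type as `q`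
        (∀ᶠ p in 𝓝 (s, ψ), Q p ∈ vertices D p.1 p.2 ∧
          (∀ a, Q p ∈ cell D p.1 p.2 a ↔ q ∈ cell D s ψ a) ∧
          (Q p ∈ frontier D ↔ q ∈ frontier D)) ∧
        -- and the only one near `q`
        (∀ᶠ z : Params 2 N × Pt 2 in 𝓝 ((s, ψ), q),
          z.2 ∈ vertices D z.1.1 z.1.2 → z.2 = Q z.1) ∧
        ∀ᶠ p in 𝓝 (s, ψ),
          -- no dependence on the seeds and weights of the other cells
          (∀ l, q ∉ modCell D s ψ l → seedJacobian Q p l = 0 ∧ weightDeriv Q p l = 0) ∧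
          -- vertices between three cells
          (∀ i j k, i ≠ j → i ≠ k → j ≠ k →
            q ∈ modCell D s ψ i → q ∈ modCell D s ψ j → q ∈ modCell D s ψ k →
            IsUnit (rows (p.1 j - p.1 i) (p.1 k - p.1 i)).det ∧
            rows (p.1 j - p.1 i) (p.1 k - p.1 i) * seedJacobian Q p i =
              rows (Q p - p.1 i) (Q p - p.1 i) ∧
            rows (p.1 j - p.1 i) (p.1 k - p.1 i) *ᵥ weightDeriv Q p i = ![1 / 2, 1 / 2]) ∧
          -- vertices between two cells and the void
          (∀ i j, i ≠ j →
            q ∈ modCell D s ψ i → q ∈ modCell D s ψ j → q ∈ voidCell D s ψ →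
            IsUnit (rows (p.1 j - p.1 i) (Q p - p.1 i)).det ∧
            rows (p.1 j - p.1 i) (Q p - p.1 i) * seedJacobian Q p i =
              rows (Q p - p.1 i) (Q p - p.1 i) ∧
            rows (p.1 j - p.1 i) (Q p - p.1 i) *ᵥ weightDeriv Q p i = ![1 / 2, 1 / 2]) ∧
          -- vertices between two cells and the boundary of `D`
          (∀ i j, i ≠ j →
            q ∈ modCell D s ψ i → q ∈ modCell D s ψ j → q ∈ frontier D →
            ∃ n, IsUnitNormalAt D (Q p) n ∧
              IsUnit (rows (p.1 j - p.1 i) n).det ∧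
              rows (p.1 j - p.1 i) n * seedJacobian Q p i = rows (Q p - p.1 i) 0 ∧
              rows (p.1 j - p.1 i) n *ᵥ weightDeriv Q p i = ![1 / 2, 0]) ∧
          -- vertices between one cell, the void and the boundary of `D`
          (∀ i, q ∈ modCell D s ψ i → q ∈ voidCell D s ψ → q ∈ frontier D →
            ∃ n, IsUnitNormalAt D (Q p) n ∧
              IsUnit (rows (Q p - p.1 i) n).det ∧
              rows (Q p - p.1 i) n * seedJacobian Q p i = rows (Q p - p.1 i) 0 ∧
              rows (Q p - p.1 i) n *ᵥ weightDeriv Q p i = ![1 / 2, 0])) ∧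
      -- vertices obtained by subdivision of a circular arc
      ∀ (i : Fin N) (q₀ q₁ : Pt 2) (α : ℝ), IsArc D (s, ψ) i q₀ q₁ α →
        ∃ (Q₀ Q₁ : Params 2 N → Pt 2) (A : Params 2 N → ℝ),
          Q₀ (s, ψ) = q₀ ∧ Q₁ (s, ψ) = q₁ ∧ A (s, ψ) = α ∧
          ∀ᶠ p in 𝓝 (s, ψ),
            ContDiffAt ℝ ∞ Q₀ p ∧ ContDiffAt ℝ ∞ Q₁ p ∧ ContDiffAt ℝ ∞ A p ∧
            IsArc D p i (Q₀ p) (Q₁ p) (A p) ∧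
            Real.cos (A p) =
              ⟪‖Q₀ p - p.1 i‖⁻¹ • (Q₀ p - p.1 i), ‖Q₁ p - p.1 i‖⁻¹ • (Q₁ p - p.1 i)⟫ ∧
            Real.sin (A p) =
              (rows (‖Q₀ p - p.1 i‖⁻¹ • (Q₀ p - p.1 i))
                (‖Q₁ p - p.1 i‖⁻¹ • (Q₁ p - p.1 i))).det ∧
            A p = Real.pi - 2 * Real.arctan ((1 + Real.cos (A p)) / Real.sin (A p)) ∧
            ∀ n r : ℕ, r ≤ n → ContDiffAt ℝ ∞
              (fun p' : Params 2 N => rotateAbout (p'.1 i) (Q₀ p') ((r : ℝ) / n * A p')) p) := by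
  refine ⟨fun d hd N D hD hb s ψ hG => hG.exists_deformation hd hD hb s ψ,
    fun N D hD hb s ψ hG => ?_⟩
  have hp : ∀ i, 0 < ψ i := hG.weight_pos le_rfl
  obtain ⟨φ, hφ, hφv⟩ := Generic.exists_levelSet (p := (s, ψ)) le_rfl hG hD
  obtain ⟨K, u, h⟩ := Generic.exists_isDeformation (p := (s, ψ)) le_rfl hD hb hG
  have hfin := Generic.finite_vertices (p := (s, ψ)) hG hb hφ hφv
  -- A single deformation serves all vertices and arcs; each required function is the trajectory of
  -- a point under it or is built from such trajectories.
  refine ⟨hfin, fun q hq => ⟨follow u (s, ψ) q, h.follow_self q,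
    h.eventually_contDiffAt_follow.mono fun p hp => hp q, ?_,
    h.eventually_eq_follow hb hp hfin q, ?_⟩, fun i q₀ q₁ α harc => h.eventually_arc hb hp harc⟩
  · filter_upwards [h.eventually_isDiagramMap_follow hb hp] with p hg
    exact ⟨(hg.mem_vertices_iff q).2 hq, fun a => hg.mem_cell_iff a q, hg.mem_frontier_iff q⟩
  · filter_upwards [h.eventually_solvesSystems hG hb hφ hφv hq] with p hs
    exact ⟨hs.notMem, hs.three, hs.void, hs.boundary, hs.boundary_void⟩
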